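/- Let $V=\bigoplus_{n\ge 0}V_n$ be a vertex operator algebra over $\mathbb C$ that is $C_2$-cofinite (that is, $\dim V/C_2(V)<\infty$, where $C_2(V)$ is spanned by the elements $v_{-2}w$ with $v,w\in V$ and $v$ homogeneous of positive weight) and of CFT type ($\dim V_0=1$). $V$-modules are weak $V$-modules. For $V$-modules $W,U,S$, a (logarithmic) intertwining operator of type $(W:U\to S)$ is a linear map $\mathcal Y(\cdot,z):W\to \mathrm{Hom}(U,S)\{z\}[\log z]$, $\mathcal Y(w,z)=\sum_{i=0}^{k}\sum_{r\in\mathbb C}w_{(r,i)}z^{-r-1}\log^i z$, such that (1) for all $w\in W$, $u\in U$ and $i$, $w_{(r,i)}u=0$ for $\mathrm{Re}(r)\gg 0$; (2) $\mathcal Y(L(-1)w,z)=\frac{d}{dz}\mathcal Y(w,z)$; (3) $v_n\mathcal Y(w,z)-\mathcal Y(w,z)v_n=\sum_{i\ge 0}\binom ni \mathcal Y(v_iw,z)z^{n-i}$ for $v\in V$, $n\in\mathbb Z$; (4) $\mathcal Y(v_nw,z)=\sum_{i\ge 0}(-1)^i\binom ni\left(v_{n-i}z^{i}\,\mathcal Y(w,z)-(-1)^n\,\mathcal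 Y(w,z)\,v_iz^{n-i}\right)$ for $v\in V$, $n\in\mathbb Z$. It is called surjective if the elements $w_{(r,i)}u$ span $S$. A tensor product $W\boxtimes U$ is a finitely generated $V$-module together with a surjective intertwining operator $\mathcal Y^{W\boxtimes U}$ of type $(W:U\to W\boxtimes U)$ such that for every finitely generated $V$-module $S$ and every surjective intertwining operator $\mathcal Y$ of type $(W:U\to S)$ there is a $V$-homomorphism $f:W\boxtimes U\to S$ with $f\circ\mathcal Y^{W\boxtimes U}=\mathcal Y$. For a $V$-homomorphism $\phi:A\to B$, the induced map $\phi\boxtimes\mathrm{id}_D:A\boxtimes D\to B\boxtimes D$ is the $V$-homomorphism determined by $(\phi\boxtimes\mathrm{id}_D)\big(\mathcal Y^{A\boxtimes D}(a,z)d\big)=\mathcal Y^{B\boxtimes D}(\phi(a),z)d$. Let $\rho:P\to V$ be a principal projective cover, i.e. $P$ is a projective $V$-module and $\rho$ is an epimorphism of $V$-modules whose kernel contains no nonzero direct summand of $P$. Write $\mathrm{rad}(P)=\ker\rho$, so that $$0\to \mathrm{rad}(P)\xrightarrow{\tau}P\xrightarrow{\rho}V\to 0$$ is exact, and let $T$ be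 a finitely generated $V$-module. Then $$0\to \mathrm{rad}(P)\boxtimes T\xrightarrow{\tau\boxtimes \mathrm{id}_T}P\boxtimes T\xrightarrow{\rho\boxtimes\mathrm{id}_T}V\boxtimes T\to 0$$ is exact. -/

import Mathlib

universe u

/-- A vertex operator algebra `V = ⨁_{n ≥ 0} V_n` over `ℂ`.  Here `mode n a b` is `a_n b`, where
`Y(a, z) = ∑ n, a_n z ^ (-n - 1)`, and `L(n) = ω_{n + 1}`.  By `truncation` all the sums `∑ᶠ`
have finite support. -/
class VertexOperatorAlgebra (V : Type u) [AddCommGroup V] [Module ℂ V] where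
  mode : ℤ → V →ₗ[ℂ] V →ₗ[ℂ] V
  vacuum : V
  omega : V
  centralCharge : ℂ
  truncation : ∀ a b : V, ∃ N : ℤ, ∀ n : ℤ, N ≤ n → mode n a b = 0
  vacuum_mode : ∀ (n : ℤ) (a : V), mode n vacuum a = if n = -1 then a else 0
  creation : ∀ a : V, mode (-1) a vacuum = a ∧ ∀ n : ℤ, 0 ≤ n → mode n a vacuum = 0
  derivative : ∀ (n : ℤ) (a b : V), mode n (mode 0 omega a) b = -((n : ℂ) • mode (n - 1) a b)
  commutativity : ∀ (m n : ℤ) (a b c : V),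
    mode m a (mode n b c) - mode n b (mode m a c) =
      ∑ᶠ i : ℕ, ((Ring.choose m i : ℤ) : ℂ) • mode (m + n - i) (mode i a b) c
  associativity : ∀ (m n : ℤ) (a b c : V),
    mode n (mode m a b) c =
      ∑ᶠ i : ℕ, ((-1 : ℂ) ^ i * ((Ring.choose m i : ℤ) : ℂ)) • mode (m - i) a (mode (n + i) b c) -
      ∑ᶠ i : ℕ, ((-1 : ℂ) ^ (m + i) * ((Ring.choose m i : ℤ) : ℂ)) •
        mode (m + n - i) b (mode i a c)
  virasoro : ∀ (m n : ℤ) (a : V),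
    mode (m + 1) omega (mode (n + 1) omega a) - mode (n + 1) omega (mode (m + 1) omega a) =
      ((m : ℂ) - n) • mode (m + n + 1) omega a +
      (if m + n = 0 then ((m : ℂ) ^ 3 - m) / 12 * centralCharge else 0) • a
  grading : DirectSum.IsInternal
    (fun n : ℕ => Module.End.eigenspace (mode 1 omega : Module.End ℂ V) (n : ℂ))
  finiteDimensional_weight : ∀ n : ℕ,
    FiniteDimensional ℂ (Module.End.eigenspace (mode 1 omega : Module.End ℂ V) (n : ℂ))

namespace VertexOperatorAlgebra

/-- The homogeneous subspace `V_n`: the eigenspace of `L(0)` with eigenvalue `n`. -/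
def weightSpace (V : Type u) [AddCommGroup V] [Module ℂ V] [VertexOperatorAlgebra V] (n : ℕ) :
    Submodule ℂ V :=
  Module.End.eigenspace (mode 1 (omega : V) : Module.End ℂ V) (n : ℂ)

/-- `V` is of CFT type: `dim V_0 = 1`. -/
def IsCFTType (V : Type u) [AddCommGroup V] [Module ℂ V] [VertexOperatorAlgebra V] : Prop :=
  Module.finrank ℂ (weightSpace V 0) = 1

/-- `C_2(V)`: the span of all `a_{-2} b` with `a` homogeneous of positive weight. -/
def C2 (V : Type u) [AddCommGroup V] [Module ℂ V] [VertexOperatorAlgebra V] : Submodule ℂ V :=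
  Submodule.span ℂ {x | ∃ n : ℕ, 0 < n ∧ ∃ a ∈ weightSpace V n, ∃ b : V, mode (-2) a b = x}

/-- `V` is `C_2`-cofinite: `dim V / C_2(V) < ∞`. -/
def IsC2Cofinite (V : Type u) [AddCommGroup V] [Module ℂ V] [VertexOperatorAlgebra V] : Prop :=
  FiniteDimensional ℂ (V ⧸ C2 V)

end VertexOperatorAlgebra

open VertexOperatorAlgebra in
/-- A (weak) module `M` over the vertex operator algebra `V`; `act n a x` is `a_n x`. -/
class VOAModule (V : Type u) [AddCommGroup V] [Module ℂ V] [VertexOperatorAlgebra V]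
    (M : Type u) [AddCommGroup M] [Module ℂ M] where
  act : ℤ → V →ₗ[ℂ] M →ₗ[ℂ] M
  truncation : ∀ (a : V) (x : M), ∃ N : ℤ, ∀ n : ℤ, N ≤ n → act n a x = 0
  vacuum_act : ∀ (n : ℤ) (x : M), act n vacuum x = if n = -1 then x else 0
  derivative : ∀ (n : ℤ) (a : V) (x : M),
    act n (mode 0 omega a) x = -((n : ℂ) • act (n - 1) a x)
  commutativity : ∀ (m n : ℤ) (a b : V) (x : M),
    act m a (act n b x) - act n b (act m a x) =
      ∑ᶠ i : ℕ, ((Ring.choose m i : ℤ) : ℂ) • act (m + n - i) (mode i a b) x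
  associativity : ∀ (m n : ℤ) (a b : V) (x : M),
    act n (mode m a b) x =
      ∑ᶠ i : ℕ, ((-1 : ℂ) ^ i * ((Ring.choose m i : ℤ) : ℂ)) • act (m - i) a (act (n + i) b x) -
      ∑ᶠ i : ℕ, ((-1 : ℂ) ^ (m + i) * ((Ring.choose m i : ℤ) : ℂ)) •
        act (m + n - i) b (act i a x)

/-- The vertex operator algebra `V` as a module over itself. -/
instance VOAModule.self (V : Type u) [AddCommGroup V] [Module ℂ V] [VertexOperatorAlgebra V] :
    VOAModule V V where
  act := VertexOperatorAlgebra.mode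
  truncation := VertexOperatorAlgebra.truncation
  vacuum_act := VertexOperatorAlgebra.vacuum_mode
  derivative := VertexOperatorAlgebra.derivative
  commutativity := VertexOperatorAlgebra.commutativity
  associativity := VertexOperatorAlgebra.associativity

namespace VOAModule

/-- `f` is a homomorphism of `V`-modules. -/
def IsHom (V : Type u) [AddCommGroup V] [Module ℂ V] [VertexOperatorAlgebra V]
    {M N : Type u} [AddCommGroup M] [Module ℂ M] [VOAModule V M]
    [AddCommGroup N] [Module ℂ N] [VOAModule V N] (f : M →ₗ[ℂ] N) : Prop :=
  ∀ (n : ℤ) (a : V) (x : M), f (act n a x) = act n a (f x)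

/-- The subspace `N` is a `V`-submodule of `M`. -/
def IsStable (V : Type u) [AddCommGroup V] [Module ℂ V] [VertexOperatorAlgebra V]
    {M : Type u} [AddCommGroup M] [Module ℂ M] [VOAModule V M] (N : Submodule ℂ M) : Prop :=
  ∀ (n : ℤ) (a : V), ∀ x ∈ N, act n a x ∈ N

/-- `M` is finitely generated as a `V`-module. -/
def IsFinGen (V : Type u) [AddCommGroup V] [Module ℂ V] [VertexOperatorAlgebra V]
    (M : Type u) [AddCommGroup M] [Module ℂ M] [VOAModule V M] : Prop :=
  ∃ S : Set M, S.Finite ∧ ∀ N : Submodule ℂ M, IsStable V N → S ⊆ N → N = ⊤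

/-- `P` is projective: every epimorphism of `V`-modules onto `P` splits. -/
def IsProjective (V : Type u) [AddCommGroup V] [Module ℂ V] [VertexOperatorAlgebra V]
    (P : Type u) [AddCommGroup P] [Module ℂ P] [VOAModule V P] : Prop :=
  ∀ (W : Type u) [AddCommGroup W] [Module ℂ W] [VOAModule V W] (f : W →ₗ[ℂ] P),
    IsHom V f → Function.Surjective f → ∃ g : P →ₗ[ℂ] W, IsHom V g ∧ f ∘ₗ g = LinearMap.id

/-- `ρ : P → U` is a projective cover of the `V`-module `U`: an epimorphism from a projective
module whose kernel contains no nonzero direct summand of `P`. -/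
structure IsProjectiveCover (V : Type u) [AddCommGroup V] [Module ℂ V] [VertexOperatorAlgebra V]
    {P U : Type u} [AddCommGroup P] [Module ℂ P] [VOAModule V P]
    [AddCommGroup U] [Module ℂ U] [VOAModule V U] (ρ : P →ₗ[ℂ] U) : Prop where
  projective : IsProjective V P
  isHom : IsHom V ρ
  surjective : Function.Surjective ρ
  minimal : ∀ A B : Submodule ℂ P, IsStable V A → IsStable V B → IsCompl A B →
    A ≤ LinearMap.ker ρ → A = ⊥

end VOAModule

open VertexOperatorAlgebra VOAModule in
/-- A (logarithmic) intertwining operator of type `(W : U → T)`; `coeff r i w u` is `w_{(r,i)} u`,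
where `𝒴(w, z) = ∑ i, ∑ r, w_{(r,i)} z ^ (-r - 1) (log z) ^ i` is, for each `w`, a polynomial in
`log z`.  The conditions are the coefficientwise forms of the lower truncation property, of
`𝒴(L(-1)w, z) = d/dz 𝒴(w, z)`, and of commutativity and associativity with the action of `V`. -/
structure IntertwiningOperator (V : Type u) [AddCommGroup V] [Module ℂ V]
    [VertexOperatorAlgebra V]
    (W U T : Type u) [AddCommGroup W] [Module ℂ W] [VOAModule V W]
    [AddCommGroup U] [Module ℂ U] [VOAModule V U]
    [AddCommGroup T] [Module ℂ T] [VOAModule V T] where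
  coeff : ℂ → ℕ → W →ₗ[ℂ] U →ₗ[ℂ] T
  log_bounded : ∀ w : W, ∃ k : ℕ, ∀ i : ℕ, k < i → ∀ r : ℂ, coeff r i w = 0
  truncation : ∀ (w : W) (u : U) (i : ℕ), ∃ N : ℝ, ∀ r : ℂ, N < r.re → coeff r i w u = 0
  derivative : ∀ (r : ℂ) (i : ℕ) (w : W) (u : U),
    coeff r i (act 0 (omega : V) w) u =
      -(r • coeff (r - 1) i w u) + ((i : ℂ) + 1) • coeff (r - 1) (i + 1) w u
  commutativity : ∀ (m : ℤ) (r : ℂ) (i : ℕ) (a : V) (w : W) (u : U),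
    act m a (coeff r i w u) - coeff r i w (act m a u) =
      ∑ᶠ j : ℕ, ((Ring.choose m j : ℤ) : ℂ) • coeff (m + r - j) i (act j a w) u
  associativity : ∀ (m : ℤ) (r : ℂ) (i : ℕ) (a : V) (w : W) (u : U),
    coeff r i (act m a w) u =
      ∑ᶠ j : ℕ, ((-1 : ℂ) ^ j * ((Ring.choose m j : ℤ) : ℂ)) • act (m - j) a (coeff (r + j) i w u) -
      ∑ᶠ j : ℕ, ((-1 : ℂ) ^ (m + j) * ((Ring.choose m j : ℤ) : ℂ)) •
        coeff (m + r - j) i w (act j a u)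

namespace IntertwiningOperator

/-- `𝒴` is surjective: its coefficients `w_{(r,i)} u` span the target. -/
def IsSurjective {V : Type u} [AddCommGroup V] [Module ℂ V] [VertexOperatorAlgebra V]
    {W U T : Type u} [AddCommGroup W] [Module ℂ W] [VOAModule V W]
    [AddCommGroup U] [Module ℂ U] [VOAModule V U]
    [AddCommGroup T] [Module ℂ T] [VOAModule V T] (𝒴 : IntertwiningOperator V W U T) : Prop :=
  Submodule.span ℂ {x : T | ∃ r i w u, 𝒴.coeff r i w u = x} = ⊤

/-- `(T, 𝒴)` is a tensor product `W ⊠ U`: it is the largest among the pairs of a finitely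
generated `V`-module and a surjective intertwining operator into it. -/
structure IsTensorProduct {V : Type u} [AddCommGroup V] [Module ℂ V] [VertexOperatorAlgebra V]
    {W U T : Type u} [AddCommGroup W] [Module ℂ W] [VOAModule V W]
    [AddCommGroup U] [Module ℂ U] [VOAModule V U]
    [AddCommGroup T] [Module ℂ T] [VOAModule V T] (𝒴 : IntertwiningOperator V W U T) :
    Prop where
  finGen : VOAModule.IsFinGen V T
  surjective : 𝒴.IsSurjective
  universal : ∀ (T' : Type u) [AddCommGroup T'] [Module ℂ T'] [VOAModule V T']
    (𝒴' : IntertwiningOperator V W U T'), VOAModule.IsFinGen V T' → 𝒴'.IsSurjective →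
    ∃ f : T →ₗ[ℂ] T', VOAModule.IsHom V f ∧
      ∀ r i w u, f (𝒴.coeff r i w u) = 𝒴'.coeff r i w u

/-- `F : A ⊠ D → B ⊠ D` is the map `φ ⊠ id_D` induced by `φ : A → B`: the homomorphism with
`F (𝒴(a, z) d) = 𝒴'(φ a, z) d`. -/
structure IsInducedMap {V : Type u} [AddCommGroup V] [Module ℂ V] [VertexOperatorAlgebra V]
    {A B D AD BD : Type u} [AddCommGroup A] [Module ℂ A] [VOAModule V A]
    [AddCommGroup B] [Module ℂ B] [VOAModule V B]
    [AddCommGroup D] [Module ℂ D] [VOAModule V D]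
    [AddCommGroup AD] [Module ℂ AD] [VOAModule V AD]
    [AddCommGroup BD] [Module ℂ BD] [VOAModule V BD]
    (𝒴 : IntertwiningOperator V A D AD) (𝒴' : IntertwiningOperator V B D BD)
    (φ : A →ₗ[ℂ] B) (F : AD →ₗ[ℂ] BD) : Prop where
  isHom : VOAModule.IsHom V F
  map_coeff : ∀ r i a d, F (𝒴.coeff r i a d) = 𝒴'.coeff r i (φ a) d

end IntertwiningOperator

set_option linter.unusedSectionVars false

/-! Right exactness is formal. Coefficients of the operator for `V` span `V ⊠ T` and `ρ` is onto, so
`ρ ⊠ id` is onto. In the middle, the operator for `P`, read modulo the image of `rad(P) ⊠ T`, kills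
`ker ρ`, hence descends to `V`; the universal property of `V ⊠ T` then bounds the kernel
(`IsInducedMap.exact`).

The content is injectivity on the left. Write R = rad(P), S = R ⊠ T, with operator `𝒴`. It suffices
to extend `𝒴`: to find a module structure on S × T, with S as submodule and T as quotient, and an
intertwining operator of type (P : T → S × T) that restricts to `𝒴` on R. The universal property of
P ⊠ T then gives f with f ∘ (τ ⊠ id) equal to the inclusion of S (`injective_inducedMap`).

To build the extension, choose p ∈ P above the vacuum. As a_k 1 = 0 for k ≥ 0, all a_k p with k ≥ 0
lie in R, in particular L(-1)p. So 𝒴(L(-1)p, z) is known; let I(z) be its antiderivative with zero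
constant term, and put 𝒴(p, z)t = (I(z)t, t). The formula [a_n, 𝒴(p, z)] = ∑ C(n,j) 𝒴(a_j p, z)
z^(n-j) dictates the action a_n(s, t) = (a_n s + c_n(a)t, a_n t), where c_n(a) is the constant term
of the right side. With this action the formula does hold, since both sides have the same derivative
and the same constant term (`Primitive.commutator`).

Every element of P has the form y + b_{-1} p with y ∈ R and b ∈ V, and 𝒴(b_{-1} p, z) is defined as
a normally ordered product. The axioms reduce to residue calculus. The key identity is
`finsum_smul_modeProd_sub_eq`, for the bracket of a field with the m-th product of two others: l = 0
gives associativity of the twisted action, l = -1 gives associativity for 𝒴(b_{-1} p, z). -/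

section

open VertexOperatorAlgebra VOAModule

/-! ### Binomial coefficients with integer upper entry -/

/-- The complex number `m choose j`, for an integer `m`. -/
abbrev intChoose (m : ℤ) (j : ℕ) : ℂ := ((Ring.choose m j : ℤ) : ℂ)

namespace intChoose

theorem zero_right (m : ℤ) : intChoose m 0 = 1 := by simp [intChoose]

theorem zero_left_succ (j : ℕ) : intChoose 0 (j + 1) = 0 := by
  simp [intChoose, Ring.choose_zero_succ]

theorem zero_left {j : ℕ} (h : j ≠ 0) : intChoose 0 j = 0 := by
  obtain ⟨k, rfl⟩ := Nat.exists_eq_succ_of_ne_zero h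
  exact zero_left_succ k

theorem natCast (n j : ℕ) : intChoose (n : ℤ) j = (n.choose j : ℂ) := by
  simp [intChoose, Ring.choose_natCast]

theorem succ_succ (m : ℤ) (j : ℕ) :
    intChoose (m + 1) (j + 1) = intChoose m j + intChoose m (j + 1) := by
  simp [intChoose, Ring.choose_succ_succ]

theorem mul_revision (m : ℤ) (q i : ℕ) :
    intChoose m (q + i) * ((q + i).choose q : ℂ) = intChoose m q * intChoose (m - q) i := by
  have h := Ring.choose_smul_choose m (Nat.le_add_right q i)
  rw [Nat.add_sub_cancel_left] at h
  unfold intChoose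
  rw [mul_comm, ← Int.cast_mul, ← h]
  simp

theorem mul_comm_sub (m : ℤ) (q i : ℕ) :
    intChoose m q * intChoose (m - q) i = intChoose m i * intChoose (m - i) q := by
  rw [← mul_revision, ← mul_revision, add_comm q i,
    show (i + q).choose q = (i + q).choose i from Nat.choose_symm_of_eq_add (add_comm i q)]

theorem succ_mul (m : ℤ) (j : ℕ) :
    ((j : ℂ) + 1) * intChoose m (j + 1) = ((m : ℂ) - j) * intChoose m j := by
  have h := mul_revision m j 1
  rw [Nat.choose_succ_self_right] at h
  have h1 : intChoose (m - j) 1 = (m : ℂ) - j := by simp [intChoose]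
  rw [h1] at h
  push_cast at h
  rw [mul_comm, h, mul_comm]

theorem vandermonde (m n : ℤ) (k : ℕ) :
    ∑ x ∈ Finset.HasAntidiagonal.antidiagonal k, intChoose m x.1 * intChoose n x.2 = intChoose (m + n) k := by
  unfold intChoose
  rw [Ring.add_choose_eq k (Commute.all m n)]
  push_cast
  rfl

theorem neg_one (j : ℕ) : intChoose (-1) j = (-1) ^ j := by
  induction j with
  | zero => simp
  | succ k ih =>
    have h := succ_mul (-1) k
    have h0 : ((k : ℂ) + 1) ≠ 0 := Nat.cast_add_one_ne_zero k
    apply mul_left_cancel₀ h0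
    rw [h, ih]
    push_cast
    ring

end intChoose

/-! ### Finitely supported sums over ℕ and ℕ × ℕ -/

section Finsum

variable {X : Type*} [AddCommGroup X]

theorem hasFiniteSupport_of_eventually {f : ℕ → X} {N : ℕ} (h : ∀ n, N ≤ n → f n = 0) :
    f.HasFiniteSupport :=
  (Set.finite_lt_nat N).subset fun n hn => by
    by_contra hN
    exact hn (h n (not_lt.mp hN))

theorem finsum_eq_sum_range {f : ℕ → X} {N : ℕ} (h : ∀ n, N ≤ n → f n = 0) :
    ∑ᶠ n, f n = ∑ n ∈ Finset.range N, f n := by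
  refine finsum_eq_sum_of_support_subset f fun n hn => ?_
  simp only [Finset.coe_range, Set.mem_Iio]
  by_contra hN
  exact hn (h n (not_lt.mp hN))

theorem finsum_eq_zero_add {f : ℕ → X} (h : f.HasFiniteSupport) :
    ∑ᶠ n, f n = f 0 + ∑ᶠ n, f (n + 1) := by
  obtain ⟨N, hN⟩ : ∃ N, ∀ n, N ≤ n → f n = 0 := by
    obtain ⟨N, hN⟩ := h.bddAbove
    refine ⟨N + 1, fun n hn => ?_⟩
    by_contra h0
    have := hN h0
    omega
  rw [finsum_eq_sum_range (N := N + 1) (fun n hn => hN n (by omega)),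
    finsum_eq_sum_range (N := N) (fun n hn => hN (n + 1) (by omega)), Finset.sum_range_succ']
  exact add_comm _ _

theorem finsum_add_shift (f : ℕ → X) (k : ℕ) (h : f.HasFiniteSupport)
    (h0 : ∀ n, n < k → f n = 0) : ∑ᶠ n, f (k + n) = ∑ᶠ n, f n := by
  induction k with
  | zero => simp
  | succ k ih =>
    rw [← ih fun n hn => h0 n (by omega),
      finsum_eq_zero_add (f := fun n => f (k + n))
        (h.fun_comp_of_injective (add_right_injective k)),
      add_zero, h0 k (by omega), zero_add]
    exact finsum_congr fun n => by congr 1; omega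

theorem hasFiniteSupport_prod {F : ℕ × ℕ → X} {N : ℕ} (h : ∀ j, N ≤ j → ∀ i, F (i, j) = 0)
    (h' : ∀ j, ∃ K, ∀ i, K ≤ i → F (i, j) = 0) : F.HasFiniteSupport := by
  choose K hK using h'
  refine ((Set.finite_lt_nat ((Finset.range N).sup K)).prod (Set.finite_lt_nat N)).subset ?_
  rintro ⟨i, j⟩ hij
  have hj : j < N := by
    by_contra hj
    exact hij (h j (not_lt.mp hj) i)
  refine ⟨?_, hj⟩
  by_contra hi
  refine hij (hK j i (le_trans ?_ (not_lt.mp hi)))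
  exact Finset.le_sup (f := K) (Finset.mem_range.mpr hj)

theorem HasFiniteSupport.prod_swap {F : ℕ × ℕ → X} (h : F.HasFiniteSupport) :
    (fun x : ℕ × ℕ => F x.swap).HasFiniteSupport :=
  h.fun_comp_of_injective Prod.swap_injective

theorem hasFiniteSupport_prod' {F : ℕ × ℕ → X} {N : ℕ} (h : ∀ i, N ≤ i → ∀ j, F (i, j) = 0)
    (h' : ∀ i, ∃ K, ∀ j, K ≤ j → F (i, j) = 0) : F.HasFiniteSupport :=
  HasFiniteSupport.prod_swap (F := fun x => F x.swap) (hasFiniteSupport_prod h h')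

theorem finsum_prod_swap (F : ℕ × ℕ → X) : ∑ᶠ x : ℕ × ℕ, F x.swap = ∑ᶠ x, F x :=
  finsum_comp_equiv (Equiv.prodComm ℕ ℕ)

theorem finsum_prod_left {F : ℕ × ℕ → X} (h : F.HasFiniteSupport) :
    ∑ᶠ x, F x = ∑ᶠ i, ∑ᶠ j, F (i, j) := finsum_curry F h

theorem finsum_prod_right {F : ℕ × ℕ → X} (h : F.HasFiniteSupport) :
    ∑ᶠ x, F x = ∑ᶠ j, ∑ᶠ i, F (i, j) := by
  rw [← finsum_prod_swap, finsum_curry _ (HasFiniteSupport.prod_swap h)]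
  rfl

theorem hasFiniteSupport_antidiagonal {F : ℕ × ℕ → X} {N : ℕ}
    (h : ∀ i j, N ≤ i + j → F (i, j) = 0) : F.HasFiniteSupport :=
  hasFiniteSupport_prod (N := N) (fun j hj i => h i j (by omega))
    fun j => ⟨N, fun i hi => h i j (by omega)⟩

theorem finsum_antidiagonal {F : ℕ × ℕ → X} {N : ℕ} (h : ∀ i j, N ≤ i + j → F (i, j) = 0) :
    ∑ᶠ x, F x = ∑ᶠ s, ∑ x ∈ Finset.HasAntidiagonal.antidiagonal s, F x := by
  have h1 : ∑ᶠ x, F x = ∑ x ∈ (Finset.range N).biUnion Finset.HasAntidiagonal.antidiagonal, F x := by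
    refine finsum_eq_sum_of_support_subset F ?_
    rintro ⟨i, j⟩ hij
    have : i + j < N := by
      by_contra hN
      exact hij (h i j (not_lt.mp hN))
    simpa using this
  rw [h1, finsum_eq_sum_range (N := N), Finset.sum_biUnion]
  · intro s _ s' _ hss
    refine Finset.disjoint_left.mpr fun x hx hx' => hss ?_
    rw [← Finset.HasAntidiagonal.mem_antidiagonal.mp hx, ← Finset.HasAntidiagonal.mem_antidiagonal.mp hx']
  · intro s hs
    refine Finset.sum_eq_zero fun x hx => h x.1 x.2 ?_
    rw [Finset.HasAntidiagonal.mem_antidiagonal.mp hx]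
    exact hs

end Finsum

/-! ### Truncated mode sequences, residue brackets and the Jacobi identity -/

/-- A sequence of maps vanishing pointwise in high degrees. -/
def IsTruncated {X Y : Type*} [Zero Y] (a : ℤ → X → Y) : Prop :=
  ∀ x, ∃ N : ℤ, ∀ n, N ≤ n → a n x = 0

namespace IsTruncated

variable {X Y : Type*} [Zero Y] {a : ℤ → X → Y}

theorem exists_add (h : IsTruncated a) (x : X) (k : ℤ) :
    ∃ N : ℕ, ∀ n : ℕ, N ≤ n → a (k + n) x = 0 := by
  obtain ⟨N, hN⟩ := h x
  exact ⟨(N - k).toNat, fun n hn => hN _ (by omega)⟩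

end IsTruncated

section Bracket

variable {T M : Type*} [AddCommGroup T] [Module ℂ T] [AddCommGroup M] [Module ℂ M]

/-- The coefficients of `Res_x x ^ m (x - z) ^ l (a(x) φ(z) - φ(z) a(x))`, each product being
expanded in its own domain. -/
noncomputable def fieldBracket (aM : ℤ → M →ₗ[ℂ] M) (aT : ℤ → T →ₗ[ℂ] T) (l m : ℤ) (φ : ℤ → T → M) (r : ℤ)
    (t : T) : M :=
  ∑ᶠ j : ℕ, ((-1 : ℂ) ^ j * intChoose l j) • aM (m + l - j) (φ (r + j) t) -
    ∑ᶠ j : ℕ, ((-1 : ℂ) ^ (l + j) * intChoose l j) • φ (l + r - j) (aT (m + j) t)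

/-- The action of the modes `a` on a field. -/
noncomputable abbrev fieldAct (aM : ℤ → M →ₗ[ℂ] M) (aT : ℤ → T →ₗ[ℂ] T) (l : ℤ) (φ : ℤ → T → M) : ℤ → T → M :=
  fieldBracket aM aT l 0 φ

variable {aM : ℤ → M →ₗ[ℂ] M} {aT : ℤ → T →ₗ[ℂ] T} {φ : ℤ → T → M}

theorem hasFiniteSupport_left (c : ℕ → ℂ) (hφ : IsTruncated φ) (k : ℕ → ℤ) (r : ℤ) (t : T) :
    (fun j : ℕ => c j • aM (k j) (φ (r + j) t)).HasFiniteSupport := by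
  obtain ⟨N, hN⟩ := hφ.exists_add t r
  exact hasFiniteSupport_of_eventually (N := N) fun n hn => by rw [hN n hn, map_zero, smul_zero]

theorem hasFiniteSupport_right (c : ℕ → ℂ) (haT : IsTruncated fun n x => aT n x)
    (h0 : ∀ n, φ n 0 = 0) (k : ℕ → ℤ) (m : ℤ) (t : T) :
    (fun j : ℕ => c j • φ (k j) (aT (m + j) t)).HasFiniteSupport := by
  obtain ⟨N, hN⟩ := haT.exists_add t m
  exact hasFiniteSupport_of_eventually (N := N) fun n hn => by rw [hN n hn, h0, smul_zero]

theorem neg_one_zpow_add_natCast (m : ℤ) (j : ℕ) : (-1 : ℂ) ^ (m + j) = (-1) ^ m * (-1) ^ j := by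
  rw [zpow_add₀ (by norm_num), zpow_natCast]

theorem neg_one_zpow_add_one (m : ℤ) : (-1 : ℂ) ^ (m + 1) = -(-1) ^ m := by
  rw [zpow_add₀ (by norm_num)]
  simp

theorem neg_one_zpow_sub_natCast (m : ℤ) (j : ℕ) : (-1 : ℂ) ^ (m - j) = (-1) ^ m * (-1) ^ j := by
  rw [zpow_sub₀ (by norm_num), zpow_natCast, div_eq_mul_inv]
  congr 1
  rcases neg_one_pow_eq_or ℂ j with h | h <;> rw [h] <;> norm_num

theorem fieldBracket_zero_left (m : ℤ) (r : ℤ) (t : T) :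
    fieldBracket aM aT 0 m φ r t = aM m (φ r t) - φ r (aT m t) := by
  unfold fieldBracket
  rw [finsum_eq_single _ 0 fun j hj => by rw [intChoose.zero_left hj, mul_zero, zero_smul],
    finsum_eq_single _ 0 fun j hj => by rw [intChoose.zero_left hj, mul_zero, zero_smul]]
  simp [intChoose.zero_right]

theorem finsum_choose_succ {X : Type*} [AddCommGroup X] [Module ℂ X] (l : ℤ) (g : ℕ → X)
    (h : g.HasFiniteSupport) :
    ∑ᶠ j : ℕ, intChoose (l + 1) j • g j =
      ∑ᶠ j : ℕ, intChoose l j • g j + ∑ᶠ j : ℕ, intChoose l j • g (j + 1) := by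
  have hs : ∀ c : ℕ → ℂ, (fun j => c j • g j).HasFiniteSupport := fun c =>
    h.subset (Function.support_smul_subset_right c g)
  have hs' : (fun j => g (j + 1)).HasFiniteSupport :=
    h.fun_comp_of_injective (add_left_injective 1)
  have hs2 : ∀ c : ℕ → ℂ, (fun j => c j • g (j + 1)).HasFiniteSupport := fun c =>
    hs'.subset (Function.support_smul_subset_right c fun j => g (j + 1))
  rw [finsum_eq_zero_add (hs _), finsum_eq_zero_add (hs _), add_assoc,
    ← finsum_add_distrib (hs2 _) (hs2 _), intChoose.zero_right, intChoose.zero_right]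
  congr 1
  refine finsum_congr fun j => ?_
  rw [intChoose.succ_succ, add_smul, add_comm]

/-- This is x^(m+1) = z x^m + x^m (x - z) under the residue; multiplication of the field by z shifts
r by one. -/
theorem fieldBracket_succ (haT : IsTruncated fun n x => aT n x) (hφ : IsTruncated φ)
    (h0 : ∀ n, φ n 0 = 0) (l m r : ℤ) (t : T) :
    fieldBracket aM aT l (m + 1) φ r t =
      fieldBracket aM aT l m φ (r + 1) t + fieldBracket aM aT (l + 1) m φ r t := by
  have hL := fun (g : ℕ → ℤ) (r' : ℤ) (c : ℕ → ℂ) =>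
    hasFiniteSupport_left (aM := aM) c hφ g r' t
  have hR := fun (g : ℕ → ℤ) (m' : ℤ) (c : ℕ → ℂ) => hasFiniteSupport_right c haT h0 g m' t
  have e1 := finsum_choose_succ l
    (fun j : ℕ => (-1 : ℂ) ^ j • aM (m + (l + 1) - j) (φ (r + j) t)) (hL _ _ _)
  have e2 := finsum_choose_succ l
    (fun j : ℕ => (-1 : ℂ) ^ (l + 1 + j) • φ (l + 1 + r - j) (aT (m + j) t)) (hR _ _ _)
  unfold fieldBracket
  simp only [smul_smul] at e1 e2
  simp only [mul_comm (intChoose _ _)] at e1 e2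
  rw [e1, e2]
  have a1 : ∀ j : ℕ, ((-1 : ℂ) ^ j * intChoose l j) • aM (m + (l + 1) - j) (φ (r + j) t) =
      ((-1 : ℂ) ^ j * intChoose l j) • aM (m + 1 + l - j) (φ (r + j) t) := fun j => by
    congr 3; ring
  have a2 : ∀ j : ℕ, ((-1 : ℂ) ^ (j + 1) * intChoose l j) •
      aM (m + (l + 1) - (j + 1 : ℕ)) (φ (r + (j + 1 : ℕ)) t) =
      -(((-1 : ℂ) ^ j * intChoose l j) • aM (m + l - j) (φ (r + 1 + j) t)) := fun j => by
    rw [← neg_smul]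
    congr 2
    · ring
    · congr 1; push_cast; ring
    · congr 1; push_cast; ring
  have a3 : ∀ j : ℕ, ((-1 : ℂ) ^ (l + 1 + j) * intChoose l j) • φ (l + 1 + r - j) (aT (m + j) t) =
      -(((-1 : ℂ) ^ (l + j) * intChoose l j) • φ (l + (r + 1) - j) (aT (m + j) t)) := fun j => by
    rw [← neg_smul]
    congr 2
    · rw [add_right_comm, neg_one_zpow_add_one]; ring
    · ring
  have a4 : ∀ j : ℕ, ((-1 : ℂ) ^ (l + 1 + (j + 1 : ℕ)) * intChoose l j) •
      φ (l + 1 + r - (j + 1 : ℕ)) (aT (m + (j + 1 : ℕ)) t) =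
      ((-1 : ℂ) ^ (l + j) * intChoose l j) • φ (l + r - j) (aT (m + 1 + j) t) := fun j => by
    congr 2
    · push_cast
      rw [show l + 1 + ((j : ℤ) + 1) = (l + j + 1) + 1 by ring, neg_one_zpow_add_one,
        neg_one_zpow_add_one, neg_neg]
    · push_cast; ring
    · congr 1; push_cast; ring_nf
  simp only [a1, a2, a3, a4, finsum_neg_distrib]
  abel

/-- The line l = 0 propagates to all l > 0. Together with the values at m = 0 this gives m ≥ 0 by
induction upwards, and m < 0 by induction downwards. -/
theorem eq_zero_of_jacobi_recursion {D : ℤ → ℤ → ℤ → M}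
    (hD : ∀ l m r, D l (m + 1) r = D l m (r + 1) + D (l + 1) m r)
    (h0 : ∀ m r, D 0 m r = 0) (hneg : ∀ l, l < 0 → ∀ r, D l 0 r = 0) (l m r : ℤ) :
    D l m r = 0 := by
  have hpos : ∀ k : ℕ, ∀ m r, D k m r = 0 := by
    intro k
    induction k with
    | zero => exact fun m r => h0 m r
    | succ k ih =>
      intro m r
      have := hD k m r
      rw [ih, ih, zero_add] at this
      push_cast
      exact this.symm
  have h00 : ∀ l r, D l 0 r = 0 := by
    intro l r
    rcases lt_or_ge l 0 with h | h
    · exact hneg l h r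
    · lift l to ℕ using h
      exact hpos l 0 r
  have hup : ∀ k : ℕ, ∀ l r, D l k r = 0 := by
    intro k
    induction k with
    | zero => exact h00
    | succ k ih =>
      intro l r
      push_cast
      rw [hD, ih, ih, add_zero]
  have hdown : ∀ k : ℕ, ∀ l r, D l (-k) r = 0 := by
    intro k
    induction k with
    | zero => simpa using h00
    | succ k ih =>
      -- For l ≤ 0 the recursion is solved for its middle term, which has the smaller m and the same
      -- l; this needs an inner induction on -l starting from the line l = 0.
      have hl : ∀ j : ℕ, ∀ r, D (-j) (-(k + 1 : ℕ)) r = 0 := by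
        intro j
        induction j with
        | zero => exact fun r => by simpa using h0 _ r
        | succ j ihj =>
          intro r
          have h := hD (-(j + 1 : ℕ)) (-(k + 1 : ℕ)) (r - 1)
          rw [show -((k + 1 : ℕ) : ℤ) + 1 = -k by push_cast; ring, ih,
            show -((j + 1 : ℕ) : ℤ) + 1 = -j by push_cast; ring, ihj, add_zero,
            sub_add_cancel] at h
          exact h.symm
      intro l r
      rcases le_or_gt 0 l with h | h
      · lift l to ℕ using h
        exact hpos l _ r
      · have := hl (-l).toNat r
        rwa [Int.toNat_of_nonneg (by omega), neg_neg] at this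
  rcases le_or_gt 0 m with h | h
  · lift m to ℕ using h
    exact hup m l r
  · have := hdown (-m).toNat l r
    rwa [Int.toNat_of_nonneg (by omega), neg_neg] at this

/-- The full Jacobi identity follows from the commutator formula (l = 0) and the definition of the
products with l < 0 (at m = 0): both sides obey the recursion of `fieldBracket_succ`, so their
difference vanishes. In the applications `ψ k` is the field of a_k w. -/
theorem fieldBracket_eq (haT : IsTruncated fun n x => aT n x) (hφ : IsTruncated φ)
    (h0 : ∀ n, φ n 0 = 0) {ψ : ℤ → ℤ → T → M} {N : ℤ} (hψ : ∀ k, N ≤ k → ψ k = 0)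
    (hcomm : ∀ m r t, fieldBracket aM aT 0 m φ r t =
      ∑ᶠ i : ℕ, intChoose m i • ψ i (r + m - i) t)
    (hneg : ∀ l, l < 0 → ∀ r t, fieldAct aM aT l φ r t = ψ l r t) (l m r : ℤ) (t : T) :
    fieldBracket aM aT l m φ r t = ∑ᶠ i : ℕ, intChoose m i • ψ (l + i) (r + m - i) t := by
  rw [← sub_eq_zero]
  refine eq_zero_of_jacobi_recursion (D := fun l m r => fieldBracket aM aT l m φ r t -
    ∑ᶠ i : ℕ, intChoose m i • ψ (l + i) (r + m - i) t) ?_ ?_ ?_ l m r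
  · intro l m r
    have e := finsum_choose_succ m (fun i : ℕ => ψ (l + i) (r + (m + 1) - i) t)
      (hasFiniteSupport_of_eventually (N := (N - l).toNat) fun i hi => by
        rw [hψ _ (by omega)]; rfl)
    have e1 : ∀ i : ℕ, ψ (l + (i + 1 : ℕ)) (r + (m + 1) - (i + 1 : ℕ)) t =
        ψ (l + 1 + i) (r + m - i) t := fun i => by
      rw [show l + ((i + 1 : ℕ) : ℤ) = l + 1 + i by push_cast; ring,
        show r + (m + 1) - ((i + 1 : ℕ) : ℤ) = r + m - i by push_cast; ring]
    have e2 : ∀ i : ℕ, r + 1 + m - (i : ℤ) = r + (m + 1) - i := fun i => by ring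
    simp only [e1] at e
    simp only [e2]
    rw [e, fieldBracket_succ haT hφ h0]
    abel
  · intro m r
    simp only [hcomm, zero_add, sub_self]
  · intro l hl r
    have := hneg l hl r t
    rw [fieldAct] at this
    simp only [this]
    rw [finsum_eq_single _ 0 fun j hj => by rw [intChoose.zero_left hj, zero_smul]]
    simp [intChoose.zero_right]

end Bracket

/-! ### Binomial convolution identities -/

section Convolution

variable {X : Type*} [AddCommGroup X] [Module ℂ X]

theorem HasFiniteSupport.smul_fun {ι : Type*} {g : ι → X} (hg : g.HasFiniteSupport) (c : ι → ℂ) :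
    (fun i => c i • g i).HasFiniteSupport :=
  hg.subset (Function.support_smul_subset_right c g)

/-- Vandermonde splits C(n+i, q) into products C(n, x.1) C(i, x.2); then C(m, i) C(i, x.2) = C(m,
x.2) C(m - x.2, i - x.2), and the sum over i starts at x.2. -/
theorem finsum_convolution_left (m n : ℤ) (q : ℕ) {g : ℕ → X} (hg : g.HasFiniteSupport) :
    ∑ᶠ i : ℕ, ((-1 : ℂ) ^ i * intChoose m i * intChoose (n + i) q) • g i =
      ∑ x ∈ Finset.HasAntidiagonal.antidiagonal q,
        (intChoose n x.1 * ((-1 : ℂ) ^ x.2 * intChoose m x.2)) •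
          ∑ᶠ i : ℕ, ((-1 : ℂ) ^ i * intChoose (m - x.2) i) • g (x.2 + i) := by
  have h1 : ∀ x : ℕ × ℕ, (intChoose n x.1 * ((-1 : ℂ) ^ x.2 * intChoose m x.2)) •
      ∑ᶠ i : ℕ, ((-1 : ℂ) ^ i * intChoose (m - x.2) i) • g (x.2 + i) =
      ∑ᶠ i : ℕ, ((-1 : ℂ) ^ i * intChoose m i * (intChoose n x.1 * intChoose (i : ℤ) x.2)) •
        g i := by
    intro x
    rw [smul_finsum, ← finsum_add_shift _ x.2 (HasFiniteSupport.smul_fun hg _) fun i hi => by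
      rw [intChoose.natCast, Nat.choose_eq_zero_of_lt hi, Nat.cast_zero, mul_zero, mul_zero,
        zero_smul]]
    refine finsum_congr fun i => ?_
    rw [smul_smul]
    congr 1
    rw [intChoose.natCast, pow_add]
    linear_combination -(intChoose n x.1 * (-1) ^ x.2 * (-1) ^ i) * intChoose.mul_revision m x.2 i
  simp only [h1]
  rw [sum_finsum_comm _ _ fun x _ => HasFiniteSupport.smul_fun hg _]
  refine finsum_congr fun i => ?_
  rw [← Finset.sum_smul, ← Finset.mul_sum, intChoose.vandermonde]

theorem finsum_convolution_right (m n : ℤ) (q : ℕ) {g : ℕ → X} (hg : g.HasFiniteSupport) :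
    ∑ᶠ i : ℕ, ((-1 : ℂ) ^ (m + i) * intChoose m i * intChoose (m + n - i) q) • g i =
      ∑ x ∈ Finset.HasAntidiagonal.antidiagonal q,
        (intChoose n x.1 * ((-1 : ℂ) ^ x.2 * intChoose m x.2)) •
          ∑ᶠ i : ℕ, ((-1 : ℂ) ^ (m - x.2 + i) * intChoose (m - x.2) i) • g i := by
  have h1 : ∀ x : ℕ × ℕ, (intChoose n x.1 * ((-1 : ℂ) ^ x.2 * intChoose m x.2)) •
      ∑ᶠ i : ℕ, ((-1 : ℂ) ^ (m - x.2 + i) * intChoose (m - x.2) i) • g i =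
      ∑ᶠ i : ℕ, ((-1 : ℂ) ^ (m + i) * intChoose m i *
        (intChoose n x.1 * intChoose (m - i) x.2)) • g i := by
    intro x
    rw [smul_finsum]
    refine finsum_congr fun i => ?_
    rw [smul_smul]
    congr 1
    rw [neg_one_zpow_add_natCast, neg_one_zpow_sub_natCast, neg_one_zpow_add_natCast]
    have h2 : ((-1 : ℂ) ^ x.2) * (-1) ^ x.2 = 1 := by rw [← mul_pow]; norm_num
    linear_combination (intChoose n x.1 * (-1) ^ m * (-1) ^ i) *
      intChoose.mul_comm_sub m x.2 i + (intChoose n x.1 * intChoose m x.2 * (-1) ^ m * (-1) ^ i *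
      intChoose (m - x.2) i) * h2
  simp only [h1]
  rw [sum_finsum_comm _ _ fun x _ => HasFiniteSupport.smul_fun hg _]
  refine finsum_congr fun i => ?_
  rw [← Finset.sum_smul, ← Finset.mul_sum, intChoose.vandermonde]
  congr 4
  ring

theorem finsum_prod_smul_add {F : ℕ × ℕ → ℂ} {g : ℕ → X} (hg : g.HasFiniteSupport) :
    ∑ᶠ x : ℕ × ℕ, F x • g (x.1 + x.2) =
      ∑ᶠ s, (∑ x ∈ Finset.HasAntidiagonal.antidiagonal s, F x) • g s := by
  obtain ⟨N, hN⟩ := hg.bddAbove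
  rw [finsum_antidiagonal (N := N + 1)]
  · refine finsum_congr fun s => ?_
    rw [Finset.sum_smul]
    refine Finset.sum_congr rfl fun x hx => ?_
    rw [Finset.HasAntidiagonal.mem_antidiagonal.mp hx]
  · intro i j hij
    by_contra h0
    have := hN (a := i + j) fun h => h0 (by rw [h, smul_zero])
    omega

theorem finsum_convolution_prod_right (l m : ℤ) (q : ℕ) {g : ℕ → X} (hg : g.HasFiniteSupport) :
    ∑ᶠ x : ℕ × ℕ, ((-1 : ℂ) ^ (l + x.2) * intChoose l x.2 * ((-1 : ℂ) ^ x.1 * intChoose m x.1) *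
        intChoose (m - x.1) q) • g (x.1 + x.2) =
      ((-1 : ℂ) ^ (m + q) * intChoose m q) •
        ∑ᶠ s : ℕ, ((-1 : ℂ) ^ (l + m - q + s) * intChoose (l + m - q) s) • g s := by
  rw [finsum_prod_smul_add hg, smul_finsum]
  refine finsum_congr fun s => ?_
  rw [smul_smul]
  congr 1
  rw [show l + m - q = (m - q) + l by ring, ← intChoose.vandermonde, Finset.mul_sum,
    Finset.mul_sum]
  refine Finset.sum_congr rfl fun x hx => ?_
  rw [← Finset.HasAntidiagonal.mem_antidiagonal.mp hx]
  have h2 : ((-1 : ℂ) ^ q) * (-1) ^ q = 1 := by rw [← mul_pow]; norm_num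
  have h3 : ((-1 : ℂ) ^ m) * (-1) ^ m = 1 := by rw [← mul_zpow]; norm_num
  rw [neg_one_zpow_add_natCast, neg_one_zpow_add_natCast, neg_one_zpow_add_natCast, pow_add,
    zpow_add₀ (by norm_num), neg_one_zpow_sub_natCast]
  linear_combination (-(intChoose l x.2 * (-1) ^ l * (-1) ^ x.1 * (-1) ^ x.2)) *
      intChoose.mul_comm_sub m q x.1 - (intChoose l x.2 * (-1) ^ l * (-1) ^ x.1 * (-1) ^ x.2 *
      intChoose m q * intChoose (m - q) x.1) * ((-1) ^ m * (-1) ^ m * h2 + h3)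

theorem finsum_convolution_prod_left (l m : ℤ) (q : ℕ) {g : ℕ → X} (hg : g.HasFiniteSupport) :
    ∑ᶠ x : ℕ × ℕ, ((-1 : ℂ) ^ x.2 * intChoose l x.2 * ((-1 : ℂ) ^ (m + x.1) * intChoose m x.1) *
        intChoose x.1 q) • g (x.1 + x.2) =
      ((-1 : ℂ) ^ (m + q) * intChoose m q) •
        ∑ᶠ s : ℕ, ((-1 : ℂ) ^ s * intChoose (l + m - q) s) • g (q + s) := by
  have h1 : ∀ s : ℕ, ∑ x ∈ Finset.HasAntidiagonal.antidiagonal (q + s),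
      ((-1 : ℂ) ^ x.2 * intChoose l x.2 * ((-1 : ℂ) ^ (m + x.1) * intChoose m x.1) *
        intChoose x.1 q) =
      ((-1 : ℂ) ^ (m + q) * intChoose m q) * ((-1 : ℂ) ^ s * intChoose (l + m - q) s) := by
    intro s
    rw [show l + m - q = (m - q) + l by ring, ← intChoose.vandermonde, Finset.mul_sum,
      Finset.mul_sum, Finset.Nat.sum_antidiagonal_eq_sum_range_succ_mk,
      Finset.Nat.sum_antidiagonal_eq_sum_range_succ_mk,
      -- The first q terms of the antidiagonal vanish because of the factor C(x.1, q); what remains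
      -- is a Vandermonde sum for (m - q) + l.
      show (q + s).succ = q + s.succ from rfl, Finset.sum_range_add,
      Finset.sum_eq_zero, zero_add]
    · refine Finset.sum_congr rfl fun i hi => ?_
      have hi' : i ≤ s := Nat.lt_succ_iff.mp (Finset.mem_range.mp hi)
      obtain ⟨k, rfl⟩ := Nat.exists_eq_add_of_le hi'
      have e1 : q + (i + k) - (q + i) = k := by omega
      have e2 : i + k - i = k := by omega
      simp only [e1, e2]
      rw [neg_one_zpow_add_natCast, neg_one_zpow_add_natCast, pow_add, pow_add,
        intChoose.natCast]
      linear_combination ((-1) ^ m * (-1) ^ q * (-1) ^ i * (-1) ^ k * intChoose l k) *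
        intChoose.mul_revision m q i
    · intro i hi
      simp only
      rw [intChoose.natCast, Nat.choose_eq_zero_of_lt (Finset.mem_range.mp hi), Nat.cast_zero,
        mul_zero]
  rw [finsum_prod_smul_add hg, smul_finsum,
    ← finsum_add_shift _ q (HasFiniteSupport.smul_fun hg _)]
  · refine finsum_congr fun s => ?_
    rw [h1, smul_smul]
  · intro s hs
    rw [Finset.sum_eq_zero, zero_smul]
    intro x hx
    have := Finset.HasAntidiagonal.mem_antidiagonal.mp hx
    rw [intChoose.natCast, Nat.choose_eq_zero_of_lt (by omega), Nat.cast_zero, mul_zero]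

end Convolution

/-! ### Bracket of a field with the product of two fields -/

section Composite

variable {T M : Type*} [AddCommGroup T] [Module ℂ T] [AddCommGroup M] [Module ℂ M]

/-- The modes of the `m`-th product of two fields. -/
noncomputable def modeProd (aM bM : ℤ → M →ₗ[ℂ] M) (m s : ℤ) (x : M) : M :=
  ∑ᶠ i : ℕ, ((-1 : ℂ) ^ i * intChoose m i) • aM (m - i) (bM (s + i) x) -
    ∑ᶠ i : ℕ, ((-1 : ℂ) ^ (m + i) * intChoose m i) • bM (m + s - i) (aM i x)

variable {aM bM : ℤ → M →ₗ[ℂ] M} {aT bT : ℤ → T →ₗ[ℂ] T} {φ : ℤ → T →ₗ[ℂ] M}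

theorem hasFiniteSupport_fst {X : Type*} [AddCommGroup X] {F : ℕ × ℕ → X}
    (h : F.HasFiniteSupport) (i : ℕ) : (fun j => F (i, j)).HasFiniteSupport :=
  h.fun_comp_of_injective (Prod.mk_right_injective i)

theorem hasFiniteSupport_snd {X : Type*} [AddCommGroup X] {F : ℕ × ℕ → X}
    (h : F.HasFiniteSupport) (j : ℕ) : (fun i => F (i, j)).HasFiniteSupport :=
  h.fun_comp_of_injective (Prod.mk_left_injective j)

/-- Moving the product a(x)b(y) past φ(z) one factor at a time produces six double sums. Each of the
six expressions in the statement is a difference of two of them: the left side is (X1 - X3) - (Y1 -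
Y2), the right side (X1 - U1) - (U2 - Y2) + (U1 - Y1) - (X3 - U2). The work lies in the finiteness
of supports, which permits the rearrangement. -/
theorem finsum_smul_modeProd_sub (haM : IsTruncated fun n x => aM n x)
    (hbM : IsTruncated fun n x => bM n x) (haT : IsTruncated fun n x => aT n x)
    (hbT : IsTruncated fun n x => bT n x) (hφ : IsTruncated fun n x => φ n x)
    (l m n r : ℤ) (t : T) :
    ∑ᶠ j : ℕ, ((-1 : ℂ) ^ j * intChoose l j) • modeProd aM bM m (n + l - j) (φ (r + j) t) -
      ∑ᶠ j : ℕ, ((-1 : ℂ) ^ (l + j) * intChoose l j) • φ (l + r - j) (modeProd aT bT m (n + j) t) =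
    ∑ᶠ i : ℕ, ((-1 : ℂ) ^ i * intChoose m i) •
        aM (m - i) (fieldBracket bM bT l (n + i) (fun k x => φ k x) r t) -
      ∑ᶠ i : ℕ, ((-1 : ℂ) ^ (m + i) * intChoose m i) •
        fieldBracket bM bT l (m + n - i) (fun k x => φ k x) r (aT i t) +
      ∑ᶠ x : ℕ × ℕ, ((-1 : ℂ) ^ (l + x.2) * intChoose l x.2 *
        ((-1 : ℂ) ^ x.1 * intChoose m x.1)) •
          fieldBracket aM aT 0 (m - x.1) (fun k x => φ k x) (l + r - x.2)
            (bT (n + (x.1 + x.2 : ℕ)) t) -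
      ∑ᶠ x : ℕ × ℕ, ((-1 : ℂ) ^ x.2 * intChoose l x.2 *
        ((-1 : ℂ) ^ (m + x.1) * intChoose m x.1)) •
          bM (m + n + l - (x.1 + x.2 : ℕ))
            (fieldBracket aM aT 0 x.1 (fun k x => φ k x) (r + x.2) t) := by
  have hX1 : (fun x : ℕ × ℕ => ((-1 : ℂ) ^ x.2 * intChoose l x.2 *
      ((-1 : ℂ) ^ x.1 * intChoose m x.1)) •
      aM (m - x.1) (bM (n + l - x.2 + x.1) (φ (r + x.2) t))).HasFiniteSupport := by
    obtain ⟨N, hN⟩ := hφ.exists_add t r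
    refine hasFiniteSupport_prod (N := N) (fun j hj i => ?_) fun j => ?_
    · simp only [hN j hj, map_zero, smul_zero]
    · obtain ⟨K, hK⟩ := hbM.exists_add (φ (r + j) t) (n + l - j)
      exact ⟨K, fun i hi => by simp only [hK i hi, map_zero, smul_zero]⟩
  have hX3 : (fun x : ℕ × ℕ => ((-1 : ℂ) ^ x.2 * intChoose l x.2 *
      ((-1 : ℂ) ^ (m + x.1) * intChoose m x.1)) •
      bM (m + (n + l - x.2) - x.1) (aM x.1 (φ (r + x.2) t))).HasFiniteSupport := by
    obtain ⟨N, hN⟩ := hφ.exists_add t r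
    refine hasFiniteSupport_prod (N := N) (fun j hj i => ?_) fun j => ?_
    · simp only [hN j hj, map_zero, smul_zero]
    · obtain ⟨K, hK⟩ := haM.exists_add (φ (r + j) t) 0
      simp only [zero_add] at hK
      exact ⟨K, fun i hi => by simp only [hK i hi, map_zero, smul_zero]⟩
  have hY1 : (fun x : ℕ × ℕ => ((-1 : ℂ) ^ (l + x.2) * intChoose l x.2 *
      ((-1 : ℂ) ^ x.1 * intChoose m x.1)) •
      φ (l + r - x.2) (aT (m - x.1) (bT (n + x.2 + x.1) t))).HasFiniteSupport := by
    obtain ⟨N, hN⟩ := hbT.exists_add t n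
    refine hasFiniteSupport_antidiagonal (N := N) fun i j hij => ?_
    have := hN (i + j) hij
    simp only [show n + (j : ℤ) + (i : ℤ) = n + (i + j : ℕ) by push_cast; ring, this, map_zero,
      smul_zero]
  have hY2 : (fun x : ℕ × ℕ => ((-1 : ℂ) ^ (l + x.2) * intChoose l x.2 *
      ((-1 : ℂ) ^ (m + x.1) * intChoose m x.1)) •
      φ (l + r - x.2) (bT (m + (n + x.2) - x.1) (aT x.1 t))).HasFiniteSupport := by
    obtain ⟨N, hN⟩ := haT.exists_add t 0
    simp only [zero_add] at hN
    refine hasFiniteSupport_prod' (N := N) (fun i hi j => ?_) fun i => ?_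
    · simp only [hN i hi, map_zero, smul_zero]
    · obtain ⟨K, hK⟩ := hbT.exists_add (aT i t) (m + n - i)
      refine ⟨K, fun j hj => ?_⟩
      simp only [show m + (n + (j : ℤ)) - i = m + n - i + j by ring, hK j hj, map_zero, smul_zero]
  have hU1 : (fun x : ℕ × ℕ => ((-1 : ℂ) ^ (l + x.2) * intChoose l x.2 *
      ((-1 : ℂ) ^ x.1 * intChoose m x.1)) •
      aM (m - x.1) (φ (l + r - x.2) (bT (n + x.1 + x.2) t))).HasFiniteSupport := by
    obtain ⟨N, hN⟩ := hbT.exists_add t n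
    refine hasFiniteSupport_antidiagonal (N := N) fun i j hij => ?_
    have := hN (i + j) hij
    simp only [show n + (i : ℤ) + (j : ℤ) = n + (i + j : ℕ) by push_cast; ring, this, map_zero,
      smul_zero]
  have hU2 : (fun x : ℕ × ℕ => ((-1 : ℂ) ^ x.2 * intChoose l x.2 *
      ((-1 : ℂ) ^ (m + x.1) * intChoose m x.1)) •
      bM (m + n - x.1 + l - x.2) (φ (r + x.2) (aT x.1 t))).HasFiniteSupport := by
    obtain ⟨N, hN⟩ := haT.exists_add t 0
    simp only [zero_add] at hN
    refine hasFiniteSupport_prod' (N := N) (fun i hi j => ?_) fun i => ?_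
    · simp only [hN i hi, map_zero, smul_zero]
    · obtain ⟨K, hK⟩ := hφ.exists_add (aT i t) r
      exact ⟨K, fun j hj => by simp only [hK j hj, map_zero, smul_zero]⟩
  have p1 : ∑ᶠ j : ℕ, ((-1 : ℂ) ^ j * intChoose l j) •
      modeProd aM bM m (n + l - j) (φ (r + j) t) = _ :=
    (Eq.trans (finsum_congr fun j => ?_) (finsum_prod_right (hX1.sub hX3)).symm).trans
      (finsum_sub_distrib hX1 hX3)
  swap
  · simp only [Pi.sub_apply]
    rw [finsum_sub_distrib (hasFiniteSupport_snd hX1 j) (hasFiniteSupport_snd hX3 j), modeProd,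
      smul_sub, smul_finsum, smul_finsum]
    simp only [smul_smul]
  have p2 : ∑ᶠ j : ℕ, ((-1 : ℂ) ^ (l + j) * intChoose l j) •
      φ (l + r - j) (modeProd aT bT m (n + j) t) = _ :=
    (Eq.trans (finsum_congr fun j => ?_) (finsum_prod_right (hY1.sub hY2)).symm).trans
      (finsum_sub_distrib hY1 hY2)
  swap
  · simp only [Pi.sub_apply]
    obtain ⟨N, hN⟩ := hbT.exists_add t (n + j)
    obtain ⟨K, hK⟩ := haT.exists_add t 0
    simp only [zero_add] at hK
    rw [finsum_sub_distrib (hasFiniteSupport_snd hY1 j) (hasFiniteSupport_snd hY2 j), modeProd,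
      map_sub, smul_sub, map_finsum _ (hasFiniteSupport_of_eventually (N := N) fun i hi => by
        rw [hN i hi, map_zero, smul_zero]),
      map_finsum _ (hasFiniteSupport_of_eventually (N := K) fun i hi => by
        rw [hK i hi, map_zero, smul_zero]), smul_finsum, smul_finsum]
    simp only [smul_smul, map_smul]
  have p3 : ∑ᶠ i : ℕ, ((-1 : ℂ) ^ i * intChoose m i) •
      aM (m - i) (fieldBracket bM bT l (n + i) (fun k x => φ k x) r t) = _ :=
    (Eq.trans (finsum_congr fun i => ?_) (finsum_prod_left (hX1.sub hU1)).symm).trans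
      (finsum_sub_distrib hX1 hU1)
  swap
  · simp only [Pi.sub_apply]
    rw [finsum_sub_distrib (hasFiniteSupport_fst hX1 i) (hasFiniteSupport_fst hU1 i),
      fieldBracket, map_sub, smul_sub,
      map_finsum _ (hasFiniteSupport_left _ hφ _ _ _),
      map_finsum _ (hasFiniteSupport_right (φ := fun k x => φ k x) _ hbT
        (fun n => map_zero _) _ _ _), smul_finsum, smul_finsum]
    simp only [smul_smul, map_smul]
    congr 1
    · refine finsum_congr fun j => ?_
      congr 1
      · ring
      · congr 2; ring_nf
    · refine finsum_congr fun j => ?_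
      congr 1
      ring
  have p4 : ∑ᶠ i : ℕ, ((-1 : ℂ) ^ (m + i) * intChoose m i) •
      fieldBracket bM bT l (m + n - i) (fun k x => φ k x) r (aT i t) = _ :=
    (Eq.trans (finsum_congr fun i => ?_) (finsum_prod_left (hU2.sub hY2)).symm).trans
      (finsum_sub_distrib hU2 hY2)
  swap
  · simp only [Pi.sub_apply]
    rw [finsum_sub_distrib (hasFiniteSupport_fst hU2 i) (hasFiniteSupport_fst hY2 i),
      fieldBracket, smul_sub, smul_finsum, smul_finsum]
    simp only [smul_smul]
    congr 1
    · refine finsum_congr fun j => ?_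
      congr 1
      ring
    · refine finsum_congr fun j => ?_
      congr 1
      · ring
      · congr 2; ring_nf
  have p5 : ∑ᶠ x : ℕ × ℕ, ((-1 : ℂ) ^ (l + x.2) * intChoose l x.2 *
      ((-1 : ℂ) ^ x.1 * intChoose m x.1)) •
      fieldBracket aM aT 0 (m - x.1) (fun k x => φ k x) (l + r - x.2)
        (bT (n + (x.1 + x.2 : ℕ)) t) = _ :=
    (finsum_congr fun x => ?_).trans (finsum_sub_distrib hU1 hY1)
  swap
  · rw [fieldBracket_zero_left, smul_sub]
    congr 6
    · push_cast; ring
    · push_cast; ring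
  have p6 : ∑ᶠ x : ℕ × ℕ, ((-1 : ℂ) ^ x.2 * intChoose l x.2 *
      ((-1 : ℂ) ^ (m + x.1) * intChoose m x.1)) •
      bM (m + n + l - (x.1 + x.2 : ℕ))
        (fieldBracket aM aT 0 x.1 (fun k x => φ k x) (r + x.2) t) = _ :=
    (finsum_congr fun x => ?_).trans (finsum_sub_distrib hX3 hU2)
  swap
  · rw [fieldBracket_zero_left, map_sub, smul_sub]
    congr 4
    · push_cast; ring
    · push_cast; ring
  rw [p1, p2, p3, p4, p5, p6]
  abel

end Composite

section CompositeFormula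

variable {T M : Type*} [AddCommGroup T] [Module ℂ T] [AddCommGroup M] [Module ℂ M]
variable {aM bM : ℤ → M →ₗ[ℂ] M} {aT bT : ℤ → T →ₗ[ℂ] T} {φ : ℤ → T →ₗ[ℂ] M}

/-- Here the commutators of a with φ are expanded in fields `χ`, and the l-brackets of b with φ in
fields `ψ`. The convolution identities resum the four sums over modes into products of a with `ψ q`
and brackets of b with `χ q`, so that only first-order data about φ enter. -/
theorem finsum_smul_modeProd_sub_eq (haM : IsTruncated fun n x => aM n x)
    (hbM : IsTruncated fun n x => bM n x) (haT : IsTruncated fun n x => aT n x)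
    (hbT : IsTruncated fun n x => bT n x) (hφ : IsTruncated fun n x => φ n x)
    {l : ℤ} {N : ℕ} {χ ψ : ℕ → ℤ → T → M} (hχ : ∀ q, IsTruncated (χ q))
    (hχ0 : ∀ q n, χ q n 0 = 0) (hψ : ∀ q, IsTruncated (ψ q)) (hψ0 : ∀ q n, ψ q n 0 = 0)
    (ha : ∀ m r t, fieldBracket aM aT 0 m (fun k x => φ k x) r t =
      ∑ q ∈ Finset.range N, intChoose m q • χ q (r + m - q) t)
    (hb : ∀ n r t, fieldBracket bM bT l n (fun k x => φ k x) r t =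
      ∑ q ∈ Finset.range N, intChoose n q • ψ q (r + n - q) t) (m n r : ℤ) (t : T) :
    ∑ᶠ j : ℕ, ((-1 : ℂ) ^ j * intChoose l j) • modeProd aM bM m (n + l - j) (φ (r + j) t) -
      ∑ᶠ j : ℕ, ((-1 : ℂ) ^ (l + j) * intChoose l j) • φ (l + r - j) (modeProd aT bT m (n + j) t) =
    ∑ q ∈ Finset.range N, ∑ x ∈ Finset.HasAntidiagonal.antidiagonal q,
        (intChoose n x.1 * ((-1 : ℂ) ^ x.2 * intChoose m x.2)) •
          fieldAct aM aT (m - x.2) (ψ q) (r + n - x.1) t -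
      ∑ q ∈ Finset.range N, ((-1 : ℂ) ^ (m + q) * intChoose m q) •
        fieldBracket bM bT (l + m - q) n (χ q) r t := by
  rw [finsum_smul_modeProd_sub haM hbM haT hbT hφ]
  simp only [ha, hb]
  have e1 : ∑ᶠ i : ℕ, ((-1 : ℂ) ^ i * intChoose m i) • aM (m - i)
      (∑ q ∈ Finset.range N, intChoose (n + i) q • ψ q (r + (n + i) - q) t) =
      ∑ q ∈ Finset.range N, ∑ x ∈ Finset.HasAntidiagonal.antidiagonal q,
        (intChoose n x.1 * ((-1 : ℂ) ^ x.2 * intChoose m x.2)) •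
        ∑ᶠ j : ℕ, ((-1 : ℂ) ^ j * intChoose (m - x.2) j) •
          aM (0 + (m - x.2) - j) (ψ q (r + n - x.1 + j) t) := by
    have hg : ∀ q : ℕ, (fun i : ℕ => aM (m - i) (ψ q (r + n - q + i) t)).HasFiniteSupport := by
      intro q
      obtain ⟨K, hK⟩ := (hψ q).exists_add t (r + n - q)
      exact hasFiniteSupport_of_eventually (N := K) fun i hi => by rw [hK i hi, map_zero]
    calc _ = ∑ᶠ i : ℕ, ∑ q ∈ Finset.range N,
          ((-1 : ℂ) ^ i * intChoose m i * intChoose (n + i) q) •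
            aM (m - i) (ψ q (r + n - q + i) t) := by
          refine finsum_congr fun i => ?_
          rw [map_sum, Finset.smul_sum]
          refine Finset.sum_congr rfl fun q _ => ?_
          rw [map_smul, smul_smul, show r + (n + (i : ℤ)) - q = r + n - q + i by ring]
      _ = _ := by
          rw [← sum_finsum_comm _ _ fun q _ => HasFiniteSupport.smul_fun (hg q) _]
          refine Finset.sum_congr rfl fun q _ => ?_
          rw [finsum_convolution_left m n q (hg q)]
          refine Finset.sum_congr rfl fun x hx => ?_
          congr 1
          refine finsum_congr fun i => ?_
          rw [← Finset.HasAntidiagonal.mem_antidiagonal.mp hx]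
          push_cast
          rw [show m - ((x.2 : ℤ) + i) = 0 + (m - x.2) - i by ring,
            show r + n - ((x.1 : ℤ) + x.2) + (x.2 + i) = r + n - x.1 + i by ring]
  have e2 : ∑ᶠ i : ℕ, ((-1 : ℂ) ^ (m + i) * intChoose m i) •
      (∑ q ∈ Finset.range N, intChoose (m + n - i) q • ψ q (r + (m + n - i) - q) (aT i t)) =
      ∑ q ∈ Finset.range N, ∑ x ∈ Finset.HasAntidiagonal.antidiagonal q,
        (intChoose n x.1 * ((-1 : ℂ) ^ x.2 * intChoose m x.2)) •
        ∑ᶠ j : ℕ, ((-1 : ℂ) ^ (m - x.2 + j) * intChoose (m - x.2) j) •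
          ψ q (m - x.2 + (r + n - x.1) - j) (aT (0 + j) t) := by
    obtain ⟨K, hK⟩ := haT.exists_add t 0
    have hg : ∀ q : ℕ, (fun i : ℕ => ψ q (r + (m + n - i) - q) (aT i t)).HasFiniteSupport :=
      fun q => hasFiniteSupport_of_eventually (N := K) fun i hi => by
        rw [← zero_add (i : ℤ), hK i hi, hψ0]
    calc _ = ∑ᶠ i : ℕ, ∑ q ∈ Finset.range N,
          ((-1 : ℂ) ^ (m + i) * intChoose m i * intChoose (m + n - i) q) •
            ψ q (r + (m + n - i) - q) (aT i t) := by
          refine finsum_congr fun i => ?_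
          rw [Finset.smul_sum]
          exact Finset.sum_congr rfl fun q _ => smul_smul _ _ _
      _ = _ := by
          rw [← sum_finsum_comm _ _ fun q _ => HasFiniteSupport.smul_fun (hg q) _]
          refine Finset.sum_congr rfl fun q _ => ?_
          rw [finsum_convolution_right m n q (hg q)]
          refine Finset.sum_congr rfl fun x hx => ?_
          congr 1
          refine finsum_congr fun i => ?_
          rw [← Finset.HasAntidiagonal.mem_antidiagonal.mp hx]
          push_cast
          rw [zero_add, show r + (m + n - (i : ℤ)) - ((x.1 : ℤ) + x.2) =
            m - x.2 + (r + n - x.1) - i by ring]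
  have e5 : ∑ᶠ x : ℕ × ℕ, ((-1 : ℂ) ^ (l + x.2) * intChoose l x.2 *
      ((-1 : ℂ) ^ x.1 * intChoose m x.1)) • (∑ q ∈ Finset.range N,
        intChoose (m - x.1) q • χ q (l + r - x.2 + (m - x.1) - q) (bT (n + (x.1 + x.2 : ℕ)) t)) =
      ∑ q ∈ Finset.range N, ((-1 : ℂ) ^ (m + q) * intChoose m q) •
        ∑ᶠ j : ℕ, ((-1 : ℂ) ^ (l + m - q + j) * intChoose (l + m - q) j) •
          χ q (l + m - q + r - j) (bT (n + j) t) := by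
    obtain ⟨K, hK⟩ := hbT.exists_add t n
    have hg : ∀ q : ℕ, (fun s : ℕ => χ q (l + m - q + r - s) (bT (n + s) t)).HasFiniteSupport :=
      fun q => hasFiniteSupport_of_eventually (N := K) fun i hi => by rw [hK i hi, hχ0]
    calc _ = ∑ᶠ x : ℕ × ℕ, ∑ q ∈ Finset.range N,
          ((-1 : ℂ) ^ (l + x.2) * intChoose l x.2 * ((-1 : ℂ) ^ x.1 * intChoose m x.1) *
            intChoose (m - x.1) q) •
            χ q (l + m - q + r - (x.1 + x.2 : ℕ)) (bT (n + (x.1 + x.2 : ℕ)) t) := by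
          refine finsum_congr fun x => ?_
          rw [Finset.smul_sum]
          refine Finset.sum_congr rfl fun q _ => ?_
          rw [smul_smul, show l + r - (x.2 : ℤ) + (m - x.1) - q =
            l + m - q + r - (x.1 + x.2 : ℕ) by push_cast; ring]
      _ = _ := by
          rw [← sum_finsum_comm]
          · exact Finset.sum_congr rfl fun q _ => finsum_convolution_prod_right l m q (hg q)
          · exact fun q _ => hasFiniteSupport_antidiagonal (N := K) fun i j hij => by
              simp only [hK _ hij, hχ0, smul_zero]
  have e6 : ∑ᶠ x : ℕ × ℕ, ((-1 : ℂ) ^ x.2 * intChoose l x.2 *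
      ((-1 : ℂ) ^ (m + x.1) * intChoose m x.1)) • bM (m + n + l - (x.1 + x.2 : ℕ))
        (∑ q ∈ Finset.range N, intChoose x.1 q • χ q (r + x.2 + x.1 - q) t) =
      ∑ q ∈ Finset.range N, ((-1 : ℂ) ^ (m + q) * intChoose m q) •
        ∑ᶠ j : ℕ, ((-1 : ℂ) ^ j * intChoose (l + m - q) j) •
          bM (n + (l + m - q) - j) (χ q (r + j) t) := by
    have hK : ∀ q : ℕ, ∃ K : ℕ, ∀ s : ℕ, K ≤ s → χ q (r + s - q) t = 0 := by
      intro q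
      obtain ⟨K, hK⟩ := (hχ q).exists_add t (r - q)
      exact ⟨K, fun s hs => by rw [show r + (s : ℤ) - q = r - q + s by ring, hK s hs]⟩
    have hg : ∀ q : ℕ,
        (fun s : ℕ => bM (m + n + l - s) (χ q (r + s - q) t)).HasFiniteSupport := fun q => by
      obtain ⟨K, hK⟩ := hK q
      exact hasFiniteSupport_of_eventually (N := K) fun i hi => by rw [hK i hi, map_zero]
    calc _ = ∑ᶠ x : ℕ × ℕ, ∑ q ∈ Finset.range N,
          ((-1 : ℂ) ^ x.2 * intChoose l x.2 * ((-1 : ℂ) ^ (m + x.1) * intChoose m x.1) *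
            intChoose x.1 q) •
            bM (m + n + l - (x.1 + x.2 : ℕ)) (χ q (r + (x.1 + x.2 : ℕ) - q) t) := by
          refine finsum_congr fun x => ?_
          rw [map_sum, Finset.smul_sum]
          refine Finset.sum_congr rfl fun q _ => ?_
          rw [map_smul, smul_smul, show r + (x.2 : ℤ) + x.1 - q =
            r + (x.1 + x.2 : ℕ) - q by push_cast; ring]
      _ = _ := by
          rw [← sum_finsum_comm]
          · refine Finset.sum_congr rfl fun q _ => ?_
            rw [finsum_convolution_prod_left l m q (hg q)]
            congr 1
            refine finsum_congr fun s => ?_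
            push_cast
            rw [show m + n + l - ((q : ℤ) + s) = n + (l + m - q) - s by ring,
              show r + ((q : ℤ) + s) - q = r + s by ring]
          · intro q _
            obtain ⟨K, hK⟩ := hK q
            exact hasFiniteSupport_antidiagonal (N := K) fun i j hij => by
              simp only [hK _ hij, map_zero, smul_zero]
  rw [e1, e2, e5, e6]
  simp only [fieldAct, fieldBracket, smul_sub, Finset.sum_sub_distrib]
  abel

end CompositeFormula

/-! ### Modules and intertwining operators as truncated fields -/

section Interface

variable {V : Type u} [AddCommGroup V] [Module ℂ V] [VertexOperatorAlgebra V]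
variable {M : Type u} [AddCommGroup M] [Module ℂ M] [VOAModule V M]

theorem VOAModule.isTruncated_act (a : V) : IsTruncated fun n (x : M) => act n a x :=
  fun x => VOAModule.truncation a x

theorem VOAModule.act_mode (m n : ℤ) (a b : V) (x : M) :
    act n (mode m a b) x = modeProd (fun k => act k a) (fun k => act k b) m n x :=
  VOAModule.associativity m n a b x

theorem VOAModule.mode_hasFiniteSupport {X : Type*} [AddCommGroup X] (a : V) (x : M) (k : ℤ)
    (f : ℕ → M → X) (hf : ∀ j, f j 0 = 0) :
    (fun j : ℕ => f j (act (k + j) a x)).HasFiniteSupport := by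
  obtain ⟨N, hN⟩ := (VOAModule.isTruncated_act (M := M) a).exists_add x k
  exact hasFiniteSupport_of_eventually (N := N) fun j hj => by rw [hN j hj, hf]

theorem VOAModule.act_zero_omega_commute (n : ℤ) (a : V) (x : M) :
    act 0 (omega : V) (act n a x) =
      act n a (act 0 (omega : V) x) - (n : ℂ) • act (n - 1) a x := by
  have h := VOAModule.commutativity 0 n (omega : V) a x
  rw [finsum_eq_single _ 0 fun j hj => by
    rw [show ((Ring.choose (0 : ℤ) j : ℤ) : ℂ) = 0 from intChoose.zero_left hj, zero_smul]] at h
  simp only [Ring.choose_zero_right, Int.cast_one, one_smul, zero_add, Nat.cast_zero,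
    sub_zero] at h
  have h2 := VOAModule.derivative n a x
  rw [h2] at h
  rw [sub_eq_iff_eq_add.mp h]
  abel

variable {W U T : Type u} [AddCommGroup W] [Module ℂ W] [VOAModule V W]
    [AddCommGroup U] [Module ℂ U] [VOAModule V U] [AddCommGroup T] [Module ℂ T] [VOAModule V T]

namespace IntertwiningOperator

/-- The coefficients of `𝒴(w, z)` of a fixed logarithmic degree, along a coset of `ℤ` in `ℂ`. -/
def field (𝒴 : IntertwiningOperator V W U T) (s : ℂ) (i : ℕ) (w : W) (n : ℤ) : U →ₗ[ℂ] T :=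
  𝒴.coeff (s + n) i w

variable (𝒴 : IntertwiningOperator V W U T) (s : ℂ) (i : ℕ)

/-- Exponents are complex, but the axioms shift them by integers only; on a coset s + ℤ the bound on
real parts becomes ordinary truncation. -/
theorem isTruncated_of_re {X : Type*} [Zero X] {Y : Type*} {F : ℂ → Y → X} {y : Y} {N : ℝ} (s : ℂ)
    (h : ∀ r : ℂ, N < r.re → F r y = 0) : ∃ K : ℤ, ∀ n : ℤ, K ≤ n → F (s + n) y = 0 := by
  obtain ⟨K, hK⟩ := exists_int_gt (N - s.re)
  refine ⟨K, fun n hn => h _ ?_⟩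
  have : (K : ℝ) ≤ n := by exact_mod_cast hn
  simp only [Complex.add_re, Complex.intCast_re]
  linarith

theorem isTruncated_field (w : W) : IsTruncated fun n u => 𝒴.field s i w n u := by
  intro u
  obtain ⟨N, hN⟩ := 𝒴.truncation w u i
  exact isTruncated_of_re (F := fun r u => 𝒴.coeff r i w u) s hN

theorem field_act (m : ℤ) (a : V) (w : W) (r : ℤ) (u : U) :
    𝒴.field s i (act m a w) r u =
      fieldAct (fun n => act n a) (fun n => act n a) m (fun n x => 𝒴.field s i w n x) r u := by
  unfold field fieldAct fieldBracket
  rw [𝒴.associativity]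
  simp only [zero_add]
  congr 1
  · refine finsum_congr fun j => ?_
    congr 4
    push_cast; ring_nf
  · refine finsum_congr fun j => ?_
    congr 4
    push_cast; ring

theorem field_commutator (m : ℤ) (a : V) (w : W) (r : ℤ) (u : U) :
    fieldBracket (fun n => act n a) (fun n => act n a) 0 m (fun n x => 𝒴.field s i w n x) r u =
      ∑ᶠ j : ℕ, intChoose m j • 𝒴.field s i (act (j : ℤ) a w) (r + m - j) u := by
  rw [fieldBracket_zero_left]
  unfold field
  rw [𝒴.commutativity]
  refine finsum_congr fun j => ?_
  congr 4
  push_cast; ring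

theorem fieldBracket_field (l m : ℤ) (a : V) (w : W) (r : ℤ) (u : U) :
    fieldBracket (fun n => act n a) (fun n => act n a) l m (fun n x => 𝒴.field s i w n x) r u =
      ∑ᶠ j : ℕ, intChoose m j • 𝒴.field s i (act (l + j) a w) (r + m - j) u := by
  obtain ⟨N, hN⟩ := VOAModule.truncation a w
  exact fieldBracket_eq (VOAModule.isTruncated_act a) (𝒴.isTruncated_field s i w)
    (fun n => map_zero _) (ψ := fun k n x => 𝒴.field s i (act k a w) n x) (N := N)
    (fun k hk => by
      funext n x
      simp only [hN k hk, field, map_zero, LinearMap.zero_apply, Pi.zero_apply])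
    (fun m r t => 𝒴.field_commutator s i m a w r t)
    (fun l _ r t => (𝒴.field_act s i l a w r t).symm) l m r u

end IntertwiningOperator

end Interface

/-! ### Extensions of `V` by a module, with a chosen lift of the vacuum -/

/-- An extension of the vertex operator algebra `V` by a `V`-module `R`, with a chosen lift
`generator` of the vacuum and the resulting linear retraction `P → R`. -/
structure UnitExtension (V : Type u) [AddCommGroup V] [Module ℂ V] [VertexOperatorAlgebra V]
    (R P : Type u) [AddCommGroup R] [Module ℂ R] [VOAModule V R]
    [AddCommGroup P] [Module ℂ P] [VOAModule V P] where
  incl : R →ₗ[ℂ] P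
  proj : P →ₗ[ℂ] V
  isHom_incl : IsHom V incl
  isHom_proj : IsHom V proj
  injective : Function.Injective incl
  proj_incl : ∀ x, proj (incl x) = 0
  generator : P
  proj_generator : proj generator = vacuum
  retract : P →ₗ[ℂ] R
  incl_retract : ∀ x, incl (retract x) = x - act (-1) (proj x) generator

namespace UnitExtension

variable {V : Type u} [AddCommGroup V] [Module ℂ V] [VertexOperatorAlgebra V]
    {R P : Type u} [AddCommGroup R] [Module ℂ R] [VOAModule V R]
    [AddCommGroup P] [Module ℂ P] [VOAModule V P]

theorem exists_of_exact (τ : R →ₗ[ℂ] P) (ρ : P →ₗ[ℂ] V) (hτ : IsHom V τ) (hρ : IsHom V ρ)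
    (hinj : Function.Injective τ) (hex : Function.Exact τ ρ) (hsurj : Function.Surjective ρ) :
    ∃ E : UnitExtension V R P, E.incl = τ ∧ E.proj = ρ := by
  obtain ⟨p, hp⟩ := hsurj vacuum
  have hex' : ∀ x, ∃ y, τ y = x - act (-1) (ρ x) p := by
    intro x
    refine (hex _).mp ?_
    -- The creation property a_{-1} 1 = a makes a ↦ a_{-1} p a linear section of `ρ`, whence the
    -- retraction onto R.
    have h : ρ (act (-1) (ρ x) p) = ρ x := by
      rw [hρ, hp]
      exact (VertexOperatorAlgebra.creation (ρ x)).1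
    rw [map_sub, h, sub_self]
  choose σ hσ using hex'
  refine ⟨⟨τ, ρ, hτ, hρ, hinj, fun x => hex.apply_apply_eq_zero x, p, hp,
    { toFun := σ, map_add' := ?_, map_smul' := ?_ }, hσ⟩, rfl, rfl⟩
  · intro x y
    apply hinj
    simp only [hσ, map_add, LinearMap.add_apply]
    abel
  · intro c x
    apply hinj
    simp only [hσ, map_smul, LinearMap.smul_apply, RingHom.id_apply, smul_sub]

variable (E : UnitExtension V R P)

theorem retract_incl (x : R) : E.retract (E.incl x) = x := by
  apply E.injective
  rw [E.incl_retract, E.proj_incl, map_zero, LinearMap.zero_apply, sub_zero]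

/-- The elements `a_k p`, with `p` the generator, projected to `R`. -/
def residue (k : ℤ) : V →ₗ[ℂ] R := E.retract ∘ₗ (act k : V →ₗ[ℂ] P →ₗ[ℂ] P).flip E.generator

theorem residue_apply (k : ℤ) (a : V) : E.residue k a = E.retract (act k a E.generator) := rfl

theorem proj_act (k : ℤ) (a : V) (x : P) : E.proj (act k a x) = mode k a (E.proj x) :=
  E.isHom_proj k a x

theorem incl_act (k : ℤ) (a : V) (x : R) : E.incl (act k a x) = act k a (E.incl x) :=
  E.isHom_incl k a x

/-- For k ≥ 0 one has a_k 1 = 0, so a_k p already lies in R and the retraction does not change it.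
For k < 0 a correction term is present, which is why the identities below take nonnegative indices.
-/
theorem incl_residue {k : ℤ} (hk : 0 ≤ k) (a : V) :
    E.incl (E.residue k a) = act k a E.generator := by
  rw [residue_apply, E.incl_retract, proj_act, E.proj_generator,
    (VertexOperatorAlgebra.creation a).2 k hk, map_zero, LinearMap.zero_apply, sub_zero]

theorem retract_neg_one (a : V) : E.retract (act (-1) a E.generator) = 0 := by
  apply E.injective
  rw [E.incl_retract, proj_act, E.proj_generator, (VertexOperatorAlgebra.creation a).1, sub_self,
    map_zero]

theorem retract_generator : E.retract E.generator = 0 := by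
  have := E.retract_neg_one vacuum
  rwa [VOAModule.vacuum_act, if_pos rfl] at this

theorem exists_residue_eq_zero (a : V) : ∃ N : ℕ, ∀ k : ℤ, N ≤ k → E.residue k a = 0 := by
  obtain ⟨N, hN⟩ := VOAModule.truncation a E.generator
  exact ⟨N.toNat, fun k hk => by rw [residue_apply, hN k (by omega), map_zero]⟩

theorem residue_vacuum {k : ℤ} (hk : 0 ≤ k) : E.residue k (vacuum : V) = 0 := by
  rw [residue_apply, VOAModule.vacuum_act, if_neg (by omega), map_zero]

theorem residue_derivative (k : ℤ) (a : V) :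
    E.residue k (mode 0 omega a) = -((k : ℂ) • E.residue (k - 1) a) := by
  rw [residue_apply, VOAModule.derivative, map_neg, map_smul, residue_apply]

theorem act_residue_omega (k : ℕ) (a : V) :
    act k a (E.residue 0 omega) =
      act 0 (omega : V) (E.residue k a) + (k : ℂ) • E.residue (k - 1) a := by
  apply E.injective
  rw [map_add, map_smul, incl_act, incl_act, E.incl_residue le_rfl,
    E.incl_residue (Int.natCast_nonneg k), VOAModule.act_zero_omega_commute]
  rcases Nat.eq_zero_or_pos k with rfl | hk
  · simp
  · rw [E.incl_residue (by omega)]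
    push_cast
    abel

theorem residue_commutator (m n : ℕ) (a b : V) :
    act (m : ℤ) a (E.residue n b) - act (n : ℤ) b (E.residue m a) =
      ∑ᶠ j : ℕ, intChoose m j • E.residue (m + n - j) (mode j a b) := by
  apply E.injective
  have h := VOAModule.commutativity m n a b E.generator
  rw [map_sub, incl_act, incl_act, E.incl_residue (Int.natCast_nonneg n),
    E.incl_residue (Int.natCast_nonneg m), h]
  refine Eq.symm ((E.incl.toAddMonoidHom.map_finsum_of_injective E.injective _).trans
    (finsum_congr fun j => ?_))
  rcases le_or_gt j m with hj | hj
  · simp only [LinearMap.toAddMonoidHom_coe, map_smul]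
    rw [E.incl_residue (by omega)]
  -- For j > m the index m + n - j may be negative, where `incl_residue` does not apply; the
  -- binomial coefficient removes these terms.
  · have : intChoose m j = 0 := by rw [intChoose.natCast, Nat.choose_eq_zero_of_lt hj, Nat.cast_zero]
    rw [this, zero_smul, map_zero]
    exact (by rw [show ((Ring.choose (m : ℤ) j : ℤ) : ℂ) = 0 from this, zero_smul])

theorem residue_mode (m : ℤ) (n : ℕ) (a b : V) :
    E.residue n (mode m a b) =
      ∑ᶠ j : ℕ, ((-1 : ℂ) ^ j * intChoose m j) • act (m - j) a (E.residue (n + j) b) -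
      ∑ᶠ j : ℕ, ((-1 : ℂ) ^ (m + j) * intChoose m j) • act (m + n - j) b (E.residue j a) := by
  apply E.injective
  rw [map_sub, E.incl_residue (Int.natCast_nonneg n), VOAModule.associativity]
  congr 1
  · refine Eq.symm ((E.incl.toAddMonoidHom.map_finsum_of_injective E.injective _).trans
      (finsum_congr fun j => ?_))
    simp only [LinearMap.toAddMonoidHom_coe, map_smul, incl_act]
    rw [E.incl_residue (by omega)]
  · refine Eq.symm ((E.incl.toAddMonoidHom.map_finsum_of_injective E.injective _).trans
      (finsum_congr fun j => ?_))
    simp only [LinearMap.toAddMonoidHom_coe, map_smul, incl_act]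
    rw [E.incl_residue (by omega)]

/-- The projection of a_m b_{-1} p is a_m b, so the retraction subtracts (a_m b)_{-1} p. In the
associativity expansion of that vector the term j = 0 is a_m b_{-1} p itself, and all others involve
modes of p of index at least 0, hence lie in R. -/
theorem retract_act_neg_one (m : ℤ) (a b : V) :
    E.retract (act m a (act (-1) b E.generator)) =
      ∑ᶠ j : ℕ, ((-1 : ℂ) ^ (m + j) * intChoose m j) • act (m - 1 - j) b (E.residue j a) -
      ∑ᶠ j : ℕ, ((-1 : ℂ) ^ (j + 1) * intChoose m (j + 1)) •
        act (m - (j + 1 : ℕ)) a (E.residue j b) := by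
  apply E.injective
  have h := VOAModule.associativity m (-1) a b E.generator
  rw [finsum_eq_zero_add] at h
  swap
  · exact VOAModule.mode_hasFiniteSupport b E.generator (-1)
      (fun j x => ((-1 : ℂ) ^ j * ((Ring.choose m j : ℤ) : ℂ)) • act (m - j) a x)
      fun j => by rw [map_zero, smul_zero]
  rw [E.incl_retract, proj_act, proj_act, E.proj_generator, (VertexOperatorAlgebra.creation b).1,
    h, map_sub]
  have e1 : E.incl (∑ᶠ j : ℕ, ((-1 : ℂ) ^ (m + j) * intChoose m j) •
      act (m - 1 - j) b (E.residue j a)) = ∑ᶠ j : ℕ, ((-1 : ℂ) ^ (m + j) * intChoose m j) •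
      act (m - 1 - j) b (act (j : ℤ) a E.generator) :=
    (E.incl.toAddMonoidHom.map_finsum_of_injective E.injective _).trans
      (finsum_congr fun j => by
        simp only [LinearMap.toAddMonoidHom_coe, map_smul, incl_act]
        rw [E.incl_residue (by omega)])
  have e2 : E.incl (∑ᶠ j : ℕ, ((-1 : ℂ) ^ (j + 1) * intChoose m (j + 1)) •
      act (m - (j + 1 : ℕ)) a (E.residue j b)) =
      ∑ᶠ j : ℕ, ((-1 : ℂ) ^ (j + 1) * intChoose m (j + 1)) •
      act (m - (j + 1 : ℕ)) a (act (-1 + (j + 1 : ℕ)) b E.generator) :=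
    (E.incl.toAddMonoidHom.map_finsum_of_injective E.injective _).trans
      (finsum_congr fun j => by
        simp only [LinearMap.toAddMonoidHom_coe, map_smul, incl_act]
        rw [E.incl_residue (by omega)]
        congr 4
        push_cast; ring)
  rw [e1, e2]
  simp only [pow_zero, Ring.choose_zero_right, Int.cast_one, mul_one, one_smul, Nat.cast_zero,
    sub_zero, add_zero, ← sub_eq_add_neg m 1]
  abel

end UnitExtension

/-! ### Differentiation and integration of logarithmic series -/

section Logarithmic

variable {T S : Type*} [AddCommGroup T] [Module ℂ T] [AddCommGroup S] [Module ℂ S]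

/-- Logarithmic series with polynomial dependence on `log z` have antiderivatives, normalized by a
vanishing constant term. -/
theorem exists_log_antiderivative (G : ℂ → ℕ → T →ₗ[ℂ] S) (k : ℕ)
    (hk : ∀ i, k < i → ∀ r, G r i = 0)
    (ht : ∀ t i, ∃ N : ℝ, ∀ r : ℂ, N < r.re → G r i t = 0) :
    ∃ I : ℂ → ℕ → T →ₗ[ℂ] S,
      (∀ r i t, G r i t = -(r • I (r - 1) i t) + ((i : ℂ) + 1) • I (r - 1) (i + 1) t) ∧
      I (-1) 0 = 0 ∧ (∀ i, k + 1 < i → ∀ r, I r i = 0) ∧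
      ∀ t i, ∃ N : ℝ, ∀ r : ℂ, N < r.re → I r i t = 0 := by
  classical
  -- At s = -1 this integrates z⁻¹ log^(i-1) z to log^i z / i, and the free constant of integration
  -- is set to 0. At s ≠ -1 it is repeated integration by parts, solving the recursion in i from the
  -- top logarithmic degree downwards.
  let I : ℂ → ℕ → T →ₗ[ℂ] S := fun s i =>
    if s = -1 then (if i = 0 then 0 else (i : ℂ)⁻¹ • G 0 (i - 1))
    else -∑ d ∈ Finset.range (k + 1),
      (((i + 1).ascFactorial d : ℂ) / (s + 1) ^ (d + 1)) • G (s + 1) (i + d)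
  refine ⟨I, ?_, by simp [I], ?_, ?_⟩
  · intro r i t
    by_cases hr : r = 0
    · subst hr
      have hi : ((i : ℂ) + 1) ≠ 0 := Nat.cast_add_one_ne_zero i
      simp only [I, zero_sub, if_true, Nat.add_eq_zero_iff, one_ne_zero, and_false, if_false,
        Nat.add_sub_cancel, zero_smul, neg_zero, zero_add, LinearMap.smul_apply, smul_smul]
      push_cast
      rw [mul_inv_cancel₀ hi, one_smul]
    · have h1 : r - 1 ≠ -1 := fun h => hr (by linear_combination h)
      simp only [I, if_neg h1, sub_add_cancel, LinearMap.neg_apply, LinearMap.sum_apply,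
        LinearMap.smul_apply, smul_neg, neg_neg, Finset.smul_sum, smul_smul]
      rw [Finset.sum_range_succ', Finset.sum_range_succ _ k, hk (i + 1 + k) (by omega),
        LinearMap.zero_apply, smul_zero, add_zero]
      have h2 : ∀ d : ℕ, r * (((i + 1).ascFactorial (d + 1) : ℂ) / r ^ (d + 1 + 1)) =
          ((i : ℂ) + 1) * (((i + 1 + 1).ascFactorial d : ℂ) / r ^ (d + 1)) := by
        intro d
        have h3 : ((i : ℂ) + 1) * ((i + 1 + 1).ascFactorial d : ℂ) =
            ((i + 1).ascFactorial (d + 1) : ℂ) := by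
          have := Nat.succ_ascFactorial (i + 1) d
          rw [Nat.ascFactorial_succ, ← this]
          push_cast
          ring
        rw [← mul_div_assoc, ← mul_div_assoc, h3, div_eq_div_iff (pow_ne_zero _ hr) (pow_ne_zero _ hr)]
        ring
      have h4 : ∀ d : ℕ, i + 1 + d = i + (d + 1) := fun d => by omega
      simp only [h2, h4, Nat.ascFactorial_zero, add_zero, zero_add, pow_one, Nat.cast_one]
      rw [mul_one_div_cancel hr, one_smul]
      abel
  · intro i hi r
    simp only [I]
    split_ifs with h h'
    · rfl
    · rw [hk _ (by omega), smul_zero]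
    · rw [neg_eq_zero]
      exact Finset.sum_eq_zero fun d _ => by rw [hk _ (by omega), smul_zero]
  · intro t i
    choose N hN using ht t
    obtain ⟨K, hK⟩ : ∃ K : ℝ, ∀ d, d < k + 1 → N (i + d) ≤ K := by
      refine ⟨∑ d ∈ Finset.range (k + 1), |N (i + d)|, fun d hd => (le_abs_self _).trans ?_⟩
      exact Finset.single_le_sum (f := fun d => |N (i + d)|) (fun d _ => abs_nonneg _)
        (Finset.mem_range.mpr hd)
    refine ⟨max K 0, fun r hr => ?_⟩
    have h0 := (le_max_right K 0).trans_lt hr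
    have h1 := (le_max_left K 0).trans_lt hr
    have hr1 : r ≠ -1 := by
      rintro rfl
      norm_num at h0
    simp only [I, if_neg hr1, LinearMap.neg_apply, LinearMap.sum_apply, LinearMap.smul_apply,
      neg_eq_zero]
    refine Finset.sum_eq_zero fun d hd => ?_
    rw [hN (i + d) (r + 1), smul_zero]
    simp only [Complex.add_re, Complex.one_re]
    have := hK d (Finset.mem_range.mp hd)
    linarith

/-- The kernel of d/dz on series polynomial in log z consists of the constants, located at r = -1, i
= 0. -/
theorem eq_zero_of_log_derivative_eq_zero {X : ℂ → ℕ → S} (k : ℕ) (hk : ∀ i, k < i → ∀ r, X r i = 0)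
    (h0 : X (-1) 0 = 0)
    (hX : ∀ r i, -(r • X (r - 1) i) + ((i : ℂ) + 1) • X (r - 1) (i + 1) = 0) (r : ℂ) (i : ℕ) :
    X r i = 0 := by
  have hneg : ∀ i, X (-1) i = 0 := by
    intro i
    rcases i with _ | i
    · exact h0
    · have := hX 0 i
      rw [zero_smul, neg_zero, zero_add, zero_sub] at this
      exact (smul_eq_zero.mp this).resolve_left (Nat.cast_add_one_ne_zero i)
  by_cases hr : r = -1
  · rw [hr, hneg]
  · have hr' : r + 1 ≠ 0 := fun h => hr (by linear_combination h)
    -- Away from the exponent 0 of z, the vanishing in logarithmic degree i + 1 forces it in degree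
    -- i, so one descends from the bound `k`.
    have hd : ∀ d i, k < i + d → X r i = 0 := by
      intro d
      induction d with
      | zero => exact fun i hi => hk i hi r
      | succ d ih =>
        intro i hi
        have := hX (r + 1) i
        rw [add_sub_cancel_right, ih (i + 1) (by omega), smul_zero, add_zero, neg_eq_zero] at this
        exact (smul_eq_zero.mp this).resolve_left hr'
    exact hd (k + 1) i (by omega)

end Logarithmic

/-! ### The cocycle and the antiderivative of 𝒴(L(-1)p, z) -/

namespace UnitExtension

variable {V : Type u} [AddCommGroup V] [Module ℂ V] [VertexOperatorAlgebra V]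
    {R P : Type u} [AddCommGroup R] [Module ℂ R] [VOAModule V R]
    [AddCommGroup P] [Module ℂ P] [VOAModule V P]
    {T S : Type u} [AddCommGroup T] [Module ℂ T] [VOAModule V T]
    [AddCommGroup S] [Module ℂ S] [VOAModule V S]
    (E : UnitExtension V R P) (𝒴 : IntertwiningOperator V R T S)

/-- The coefficients of `∑ j, (n choose j) 𝒴(a_j p, z) z ^ (n - j)`. -/
noncomputable def singular (n : ℤ) (a : V) (r : ℂ) (i : ℕ) (t : T) : S :=
  ∑ᶠ j : ℕ, intChoose n j • 𝒴.coeff (n + r - j) i (E.residue j a) t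

theorem singular_eq_sum {N : ℕ} {a : V} (hN : ∀ k : ℤ, N ≤ k → E.residue k a = 0) (n : ℤ) (r : ℂ)
    (i : ℕ) (t : T) : E.singular 𝒴 n a r i t =
      ∑ j ∈ Finset.range N, intChoose n j • 𝒴.coeff (n + r - j) i (E.residue j a) t :=
  finsum_eq_sum_range fun j hj => by
    rw [hN j (by omega), map_zero, LinearMap.zero_apply, smul_zero]

/-- Both sides expand [a_n, 𝒴(L(-1)p, z)]. By a_j L(-1)p = L(-1)a_j p + j a_{j-1} p, the first term
differentiates 𝒴(a_j p, z). The second, after the shift j ↦ j + 1 and (j+1) C(n, j+1) = (n-j) C(n,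
j), differentiates the power z^(n-j). -/
theorem singular_derivative (n : ℤ) (a : V) (r : ℂ) (i : ℕ) (t : T) :
    act n a (𝒴.coeff r i (E.residue 0 omega) t) - 𝒴.coeff r i (E.residue 0 omega) (act n a t) =
      -(r • E.singular 𝒴 n a (r - 1) i t) +
        ((i : ℂ) + 1) • E.singular 𝒴 n a (r - 1) (i + 1) t := by
  obtain ⟨N, hN⟩ := E.exists_residue_eq_zero a
  rw [𝒴.commutativity, E.singular_eq_sum 𝒴 hN, E.singular_eq_sum 𝒴 hN]
  have e1 : ∀ j : ℕ, ((Ring.choose n j : ℤ) : ℂ) •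
      𝒴.coeff (n + r - j) i (act (j : ℤ) a (E.residue 0 omega)) t =
      intChoose n j • (-((n + r - j) • 𝒴.coeff (n + (r - 1) - j) i (E.residue j a) t) +
        ((i : ℂ) + 1) • 𝒴.coeff (n + (r - 1) - j) (i + 1) (E.residue j a) t) +
      ((j : ℂ) * intChoose n j) • 𝒴.coeff (n + r - j) i (E.residue (j - 1) a) t := by
    intro j
    rw [act_residue_omega, map_add, LinearMap.add_apply, 𝒴.derivative, map_smul,
      LinearMap.smul_apply, smul_add, smul_smul, mul_comm (intChoose n j) (j : ℂ),
      show (n : ℂ) + r - j - 1 = n + (r - 1) - j by ring]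
  have e2 : ∑ j ∈ Finset.range (N + 1),
      ((j : ℂ) * intChoose n j) • 𝒴.coeff (n + r - j) i (E.residue (j - 1) a) t =
      ∑ j ∈ Finset.range N, (((n : ℂ) - j) * intChoose n j) •
        𝒴.coeff (n + (r - 1) - j) i (E.residue j a) t := by
    rw [Finset.sum_range_succ']
    simp only [Nat.cast_zero, zero_mul, zero_smul, add_zero]
    refine Finset.sum_congr rfl fun j _ => ?_
    push_cast
    rw [intChoose.succ_mul, add_sub_cancel_right,
      show (n : ℂ) + r - (j + 1) = n + (r - 1) - j by ring]
  simp only [e1]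
  rw [finsum_eq_sum_range (N := N + 1), Finset.sum_add_distrib, e2, Finset.sum_range_succ,
    hN N le_rfl]
  · simp only [map_zero, LinearMap.zero_apply, smul_zero, neg_zero, add_zero]
    rw [Finset.smul_sum, Finset.smul_sum, ← Finset.sum_neg_distrib, ← Finset.sum_add_distrib,
      ← Finset.sum_add_distrib]
    refine Finset.sum_congr rfl fun j _ => ?_
    module
  · intro j hj
    rw [hN j (by omega), hN (j - 1) (by omega)]
    simp

/-- The constant term of `singular`. -/
noncomputable def cocycle (n : ℤ) : V →ₗ[ℂ] T →ₗ[ℂ] S :=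
  -- The index r stands for z^(-r-1), so r = -1, i = 0 is the term free of z and log z.
  LinearMap.mk₂ ℂ (fun a t => E.singular 𝒴 n a (-1) 0 t)
    (fun a b t => by
      obtain ⟨N, hN⟩ := E.exists_residue_eq_zero a
      obtain ⟨K, hK⟩ := E.exists_residue_eq_zero b
      have h1 : ∀ k : ℤ, (N + K : ℕ) ≤ k → E.residue k a = 0 := fun k hk => hN k (by omega)
      have h2 : ∀ k : ℤ, (N + K : ℕ) ≤ k → E.residue k b = 0 := fun k hk => hK k (by omega)
      rw [E.singular_eq_sum 𝒴 h1, E.singular_eq_sum 𝒴 h2,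
        E.singular_eq_sum 𝒴 (N := N + K) fun k hk => by rw [map_add, h1 k hk, h2 k hk, add_zero],
        ← Finset.sum_add_distrib]
      simp only [map_add, LinearMap.add_apply, smul_add])
    (fun c a t => by
      obtain ⟨N, hN⟩ := E.exists_residue_eq_zero a
      rw [E.singular_eq_sum 𝒴 hN,
        E.singular_eq_sum 𝒴 (N := N) fun k hk => by rw [map_smul, hN k hk, smul_zero],
        Finset.smul_sum]
      simp only [map_smul, LinearMap.smul_apply, smul_comm c])
    (fun a t t' => by
      obtain ⟨N, hN⟩ := E.exists_residue_eq_zero a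
      simp only [E.singular_eq_sum 𝒴 hN, ← Finset.sum_add_distrib, map_add, smul_add])
    (fun c a t => by
      obtain ⟨N, hN⟩ := E.exists_residue_eq_zero a
      simp only [E.singular_eq_sum 𝒴 hN, Finset.smul_sum, map_smul, smul_comm c])

theorem cocycle_apply (n : ℤ) (a : V) (t : T) :
    E.cocycle 𝒴 n a t = E.singular 𝒴 n a (-1) 0 t := rfl

/-- A normalized antiderivative of `𝒴(L(-1) p, z)`. -/
structure Primitive where
  coeff : ℂ → ℕ → T →ₗ[ℂ] S
  derivative : ∀ r i t, 𝒴.coeff r i (E.residue 0 omega) t =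
    -(r • coeff (r - 1) i t) + ((i : ℂ) + 1) • coeff (r - 1) (i + 1) t
  constant : coeff (-1) 0 = 0
  log_bounded : ∃ k : ℕ, ∀ i, k < i → ∀ r, coeff r i = 0
  truncation : ∀ t i, ∃ N : ℝ, ∀ r : ℂ, N < r.re → coeff r i t = 0

theorem nonempty_primitive : Nonempty (E.Primitive 𝒴) := by
  obtain ⟨k, hk⟩ := 𝒴.log_bounded (E.residue 0 omega)
  obtain ⟨I, h1, h2, h3, h4⟩ := exists_log_antiderivative
    (fun r i => 𝒴.coeff r i (E.residue 0 omega)) k hk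
    fun t i => 𝒴.truncation (E.residue 0 omega) t i
  exact ⟨⟨I, h1, h2, ⟨k + 1, h3⟩, h4⟩⟩

variable {E 𝒴} (I : E.Primitive 𝒴)

/-- Both sides have the same derivative by `singular_derivative`, and the same constant term because
I has none and the cocycle is by definition that of the right side. Hence they agree. -/
theorem Primitive.commutator (n : ℤ) (a : V) (r : ℂ) (i : ℕ) (t : T) :
    act n a (I.coeff r i t) + (if r = -1 ∧ i = 0 then E.cocycle 𝒴 n a t else 0) -
      I.coeff r i (act n a t) = E.singular 𝒴 n a r i t := by
  obtain ⟨N, hN⟩ := E.exists_residue_eq_zero a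
  obtain ⟨k, hk⟩ := I.log_bounded
  have hlog : ∃ k' : ℕ, ∀ j, j < N → ∀ i, k' < i → ∀ r, 𝒴.coeff r i (E.residue j a) = 0 := by
    choose f hf using fun j : ℕ => 𝒴.log_bounded (E.residue j a)
    refine ⟨∑ j ∈ Finset.range N, f j, fun j hj i hi r => hf j i (lt_of_le_of_lt ?_ hi) r⟩
    exact Finset.single_le_sum (f := f) (fun _ _ => Nat.zero_le _) (Finset.mem_range.mpr hj)
  obtain ⟨k', hk'⟩ := hlog
  rw [← sub_eq_zero]
  refine eq_zero_of_log_derivative_eq_zero (X := fun r i => act n a (I.coeff r i t) +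
    (if r = -1 ∧ i = 0 then E.cocycle 𝒴 n a t else 0) - I.coeff r i (act n a t) -
    E.singular 𝒴 n a r i t) (k + k') ?_ ?_ ?_ r i
  · intro i hi r
    rw [hk i (by omega), if_neg (by omega), E.singular_eq_sum 𝒴 hN, Finset.sum_eq_zero]
    · simp
    · intro j hj
      rw [hk' j (Finset.mem_range.mp hj) i (by omega), LinearMap.zero_apply, smul_zero]
  · simp [I.constant, cocycle_apply]
  · intro r i
    have h1 := E.singular_derivative 𝒴 n a r i t
    rw [I.derivative, I.derivative, map_add, map_neg, map_smul, map_smul] at h1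
    -- The cocycle term sits at the exponent 0 of z and has zero derivative.
    have h2 : r • (if r - 1 = -1 ∧ i = 0 then E.cocycle 𝒴 n a t else 0) = 0 := by
      by_cases hr : r = 0
      · rw [hr, zero_smul]
      · rw [if_neg fun h => hr (by linear_combination h.1), smul_zero]
    simp only [Nat.add_eq_zero_iff, one_ne_zero, and_false, if_false, add_zero]
    rw [← sub_eq_zero] at h1
    refine Eq.trans ?_ h1
    simp only [smul_sub, smul_add, h2]
    abel

end UnitExtension

/-! ### Compatibility of brackets and products with injective maps -/

section Naturality

variable {T M M' : Type*} [AddCommGroup T] [Module ℂ T] [AddCommGroup M] [Module ℂ M]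
  [AddCommGroup M'] [Module ℂ M']

/-- Injectivity preserves supports, so no finiteness hypothesis is needed; the map in view is the
inclusion of S into S × T. -/
theorem finsum_smul_map {f : M →ₗ[ℂ] M'} (hf : Function.Injective f) {ι : Type*} (c : ι → ℂ)
    (g : ι → M) : ∑ᶠ i, c i • f (g i) = f (∑ᶠ i, c i • g i) := by
  refine Eq.symm ((f.toAddMonoidHom.map_finsum_of_injective hf _).trans (finsum_congr fun i => ?_))
  exact map_smul f _ _

variable {aM bM : ℤ → M →ₗ[ℂ] M} {aM' bM' : ℤ → M' →ₗ[ℂ] M'} {aT : ℤ → T →ₗ[ℂ] T}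

theorem fieldBracket_map {f : M →ₗ[ℂ] M'} (hf : Function.Injective f)
    (ha : ∀ n x, aM' n (f x) = f (aM n x)) (l m : ℤ) (φ : ℤ → T → M) (r : ℤ) (t : T) :
    fieldBracket aM' aT l m (fun n x => f (φ n x)) r t = f (fieldBracket aM aT l m φ r t) := by
  simp only [fieldBracket, ha, finsum_smul_map hf, map_sub]

theorem modeProd_map {f : M →ₗ[ℂ] M'} (hf : Function.Injective f)
    (ha : ∀ n x, aM' n (f x) = f (aM n x)) (hb : ∀ n x, bM' n (f x) = f (bM n x)) (m s : ℤ)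
    (x : M) : modeProd aM' bM' m s (f x) = f (modeProd aM bM m s x) := by
  simp only [modeProd, ha, hb, finsum_smul_map hf, map_sub]

theorem modeProd_add (haM : IsTruncated fun n x => aM n x) (hbM : IsTruncated fun n x => bM n x)
    (m s : ℤ) (x y : M) :
    modeProd aM bM m s (x + y) = modeProd aM bM m s x + modeProd aM bM m s y := by
  have h1 : ∀ z, (fun i : ℕ => ((-1 : ℂ) ^ i * intChoose m i) •
      aM (m - i) (bM (s + i) z)).HasFiniteSupport := fun z => by
    obtain ⟨N, hN⟩ := hbM.exists_add z s
    exact hasFiniteSupport_of_eventually (N := N) fun i hi => by rw [hN i hi, map_zero, smul_zero]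
  have h2 : ∀ z, (fun i : ℕ => ((-1 : ℂ) ^ (m + i) * intChoose m i) •
      bM (m + s - i) (aM i z)).HasFiniteSupport := fun z => by
    obtain ⟨N, hN⟩ := haM.exists_add z 0
    simp only [zero_add] at hN
    exact hasFiniteSupport_of_eventually (N := N) fun i hi => by rw [hN i hi, map_zero, smul_zero]
  simp only [modeProd, map_add, smul_add]
  rw [finsum_add_distrib (h1 x) (h1 y), finsum_add_distrib (h2 x) (h2 y)]
  abel

theorem finsum_convolution_prod (m n : ℤ) (q : ℕ) {g : ℕ → M} (hg : g.HasFiniteSupport) :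
    ∑ᶠ x : ℕ × ℕ, (intChoose n x.2 * intChoose m x.1 * intChoose x.1 q) • g (x.1 + x.2) =
      intChoose m q • ∑ᶠ s : ℕ, intChoose (n + m - q) s • g (q + s) := by
  have h := finsum_convolution_prod_left n m q
    (HasFiniteSupport.smul_fun hg fun s => (-1 : ℂ) ^ (m + s))
  have h2 : ∀ k : ℕ, ((-1 : ℂ) ^ k) * (-1) ^ k = 1 := fun k => by rw [← mul_pow]; norm_num
  have h3 : ((-1 : ℂ) ^ m) * (-1) ^ m = 1 := by rw [← mul_zpow]; norm_num
  refine (finsum_congr fun x => ?_).trans (h.trans ?_)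
  · rw [smul_smul]
    congr 1
    rw [neg_one_zpow_add_natCast, neg_one_zpow_add_natCast, pow_add]
    linear_combination (-(intChoose n x.2 * intChoose m x.1 * intChoose x.1 q)) *
      ((-1) ^ x.1 * (-1) ^ x.1 * (-1) ^ x.2 * (-1) ^ x.2 * h3 +
        (-1) ^ x.1 * (-1) ^ x.1 * h2 x.2 + h2 x.1)
  · rw [smul_finsum, smul_finsum]
    refine finsum_congr fun s => ?_
    simp only [smul_smul]
    congr 1
    rw [neg_one_zpow_add_natCast, neg_one_zpow_add_natCast, pow_add]
    linear_combination (intChoose m q * intChoose (n + m - q) s) *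
      ((-1) ^ q * (-1) ^ q * (-1) ^ s * (-1) ^ s * h3 +
        (-1) ^ q * (-1) ^ q * h2 s + h2 q)

end Naturality

/-! ### The twisted action on S × T and the field of the generator -/

namespace UnitExtension

variable {V : Type u} [AddCommGroup V] [Module ℂ V] [VertexOperatorAlgebra V]
    {R P : Type u} [AddCommGroup R] [Module ℂ R] [VOAModule V R]
    [AddCommGroup P] [Module ℂ P] [VOAModule V P]
    {T S : Type u} [AddCommGroup T] [Module ℂ T] [VOAModule V T]
    [AddCommGroup S] [Module ℂ S] [VOAModule V S]
    (E : UnitExtension V R P) (𝒴 : IntertwiningOperator V R T S)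

/-- The action of `V` on `S × T` twisted by the cocycle. -/
noncomputable def extAct (n : ℤ) : V →ₗ[ℂ] (S × T) →ₗ[ℂ] (S × T) :=
  LinearMap.mk₂ ℂ (fun a x => (act n a x.1 + E.cocycle 𝒴 n a x.2, act n a x.2))
    (fun a b x => by
      simp only [map_add, LinearMap.add_apply, Prod.mk_add_mk]
      rw [add_add_add_comm])
    (fun c a x => by simp only [map_smul, LinearMap.smul_apply, Prod.smul_mk, smul_add])
    (fun a x y => by
      simp only [Prod.fst_add, Prod.snd_add, map_add, Prod.mk_add_mk]
      rw [add_add_add_comm])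
    (fun c a x => by
      simp only [Prod.smul_fst, Prod.smul_snd, map_smul, Prod.smul_mk, smul_add])

theorem extAct_apply (n : ℤ) (a : V) (x : S × T) :
    E.extAct 𝒴 n a x = (act n a x.1 + E.cocycle 𝒴 n a x.2, act n a x.2) := rfl

theorem extAct_inl (n : ℤ) (a : V) (x : S) :
    E.extAct 𝒴 n a (LinearMap.inl ℂ S T x) = LinearMap.inl ℂ S T (act n a x) := by
  simp [extAct_apply]

/-- The exponents of the terms in `singular` depend on m and r only through m + r, so the bound is
uniform in m. At m = n it truncates the cocycle, where r stays fixed and n varies. -/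
theorem exists_singular_eq_zero (a : V) (s : ℂ) (i : ℕ) (t : T) :
    ∃ K : ℤ, ∀ n : ℤ, K ≤ n → ∀ m : ℤ, E.singular 𝒴 m a (s + (n - m : ℤ)) i t = 0 := by
  obtain ⟨N, hN⟩ := E.exists_residue_eq_zero a
  choose f hf using fun j : ℕ => 𝒴.isTruncated_field s i (E.residue j a) t
  refine ⟨∑ j ∈ Finset.range N, |f j| + N, fun n hn m => ?_⟩
  rw [E.singular_eq_sum 𝒴 hN]
  refine Finset.sum_eq_zero fun j hj => ?_
  have h1 : |f j| ≤ ∑ j ∈ Finset.range N, |f j| :=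
    Finset.single_le_sum (f := fun j => |f j|) (fun _ _ => abs_nonneg _) hj
  have h2 := le_abs_self (f j)
  have h3 := Finset.mem_range.mp hj
  have := hf j (n - j) (by omega)
  simp only [IntertwiningOperator.field] at this
  rw [show (m : ℂ) + (s + (n - m : ℤ)) - j = s + (n - j : ℤ) by push_cast; ring, this, smul_zero]

theorem isTruncated_extAct (a : V) : IsTruncated fun n x => E.extAct 𝒴 n a x := by
  rintro ⟨s, t⟩
  obtain ⟨N, hN⟩ := VOAModule.truncation a s
  obtain ⟨N', hN'⟩ := VOAModule.truncation a t
  obtain ⟨K, hK⟩ := E.exists_singular_eq_zero 𝒴 a (-1) 0 t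
  refine ⟨max N (max N' K), fun n hn => ?_⟩
  have h := hK n (by omega) n
  rw [sub_self, Int.cast_zero, add_zero] at h
  simp only [extAct_apply]
  rw [hN n (by omega), hN' n (by omega), cocycle_apply, h]
  simp

theorem singular_vacuum (n : ℤ) (r : ℂ) (i : ℕ) (t : T) :
    E.singular 𝒴 n vacuum r i t = 0 := by
  rw [E.singular_eq_sum 𝒴 (N := 0) fun k hk => E.residue_vacuum (by simpa using hk)]
  simp

theorem singular_mode_omega (n : ℤ) (a : V) (r : ℂ) (i : ℕ) (t : T) :
    E.singular 𝒴 n (mode 0 omega a) r i t = -((n : ℂ) • E.singular 𝒴 (n - 1) a r i t) := by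
  obtain ⟨N, hN⟩ := E.exists_residue_eq_zero a
  rw [E.singular_eq_sum 𝒴 hN, E.singular_eq_sum 𝒴 (N := N + 1) fun k hk => by
    rw [residue_derivative, hN (k - 1) (by push_cast at hk; omega), smul_zero, neg_zero],
    Finset.sum_range_succ', Finset.smul_sum, ← Finset.sum_neg_distrib]
  simp only [residue_derivative, Nat.cast_zero, Int.cast_zero, zero_smul, neg_zero, map_zero,
    LinearMap.zero_apply, smul_zero, add_zero]
  refine Finset.sum_congr rfl fun j _ => ?_
  have h := intChoose.mul_comm_sub n 1 j
  have h1 : ∀ k : ℤ, intChoose k 1 = k := fun k => by simp [intChoose]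
  rw [h1, h1] at h
  have h2 := intChoose.succ_mul n j
  push_cast at h h2 ⊢
  rw [map_neg, map_smul, LinearMap.neg_apply, LinearMap.smul_apply, smul_neg, smul_smul,
    smul_smul, add_sub_cancel_right, show (n : ℂ) + r - (j + 1) = n - 1 + r - j by ring]
  congr 2
  linear_combination h2 - h

/-- The cocycle identity for commutators. The left side is a double sum of 𝒴(a_k b_j p - b_j a_k p,
z) with binomial weights. The commutator formula in R turns it into modes (a_l b)_{j+k-l} p, and
`finsum_convolution_prod` sums over j and k. -/
theorem singular_commutator (m n : ℤ) (a b : V) (r : ℂ) (i : ℕ) (t : T) :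
    (act m a (E.singular 𝒴 n b r i t) - E.singular 𝒴 n b r i (act m a t)) -
      (act n b (E.singular 𝒴 m a r i t) - E.singular 𝒴 m a r i (act n b t)) =
    ∑ᶠ l : ℕ, intChoose m l • E.singular 𝒴 (m + n - l) (mode l a b) r i t := by
  have key : ∀ (m n : ℤ) (a b : V),
      act m a (E.singular 𝒴 n b r i t) - E.singular 𝒴 n b r i (act m a t) =
      ∑ᶠ j : ℕ, ∑ᶠ k : ℕ, (intChoose n j * intChoose m k) •
        𝒴.coeff (m + n + r - (k + j : ℕ)) i (act (k : ℤ) a (E.residue j b)) t := by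
    intro m n a b
    obtain ⟨N, hN⟩ := E.exists_residue_eq_zero b
    rw [E.singular_eq_sum 𝒴 hN, E.singular_eq_sum 𝒴 hN, map_sum, ← Finset.sum_sub_distrib,
      finsum_eq_sum_range (N := N)]
    · refine Finset.sum_congr rfl fun j _ => ?_
      rw [map_smul, ← smul_sub, 𝒴.commutativity, smul_finsum]
      refine finsum_congr fun k => ?_
      rw [smul_smul]
      congr 4
      push_cast; ring
    · intro j hj
      rw [hN j (by omega)]
      simp
  have hfs : ∀ (m n : ℤ) (a b : V), (fun x : ℕ × ℕ => (intChoose n x.2 * intChoose m x.1) •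
      𝒴.coeff (m + n + r - (x.1 + x.2 : ℕ)) i
        (act (x.1 : ℤ) a (E.residue x.2 b)) t).HasFiniteSupport := by
    intro m n a b
    obtain ⟨N, hN⟩ := E.exists_residue_eq_zero b
    refine hasFiniteSupport_prod (N := N) (fun j hj k => ?_) fun j => ?_
    · simp only [hN j (by omega), map_zero, LinearMap.zero_apply, smul_zero]
    · obtain ⟨K, hK⟩ := (VOAModule.isTruncated_act a).exists_add (E.residue j b) 0
      simp only [zero_add] at hK
      exact ⟨K, fun k hk => by simp only [hK k hk, map_zero, LinearMap.zero_apply, smul_zero]⟩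
  have hfs' : (fun x : ℕ × ℕ => (intChoose m x.1 * intChoose n x.2) •
      𝒴.coeff (n + m + r - (x.2 + x.1 : ℕ)) i
        (act (x.2 : ℤ) b (E.residue x.1 a)) t).HasFiniteSupport :=
    HasFiniteSupport.prod_swap (hfs n m b a)
  obtain ⟨L, hL⟩ := (VOAModule.isTruncated_act (M := V) a).exists_add b 0
  simp only [zero_add] at hL
  have hL' : ∀ l : ℕ, L ≤ l → mode (l : ℤ) a b = 0 := hL
  rw [key, key, ← finsum_prod_right (hfs m n a b), ← finsum_prod_left
    (F := fun x : ℕ × ℕ => (intChoose m x.1 * intChoose n x.2) •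
      𝒴.coeff (n + m + r - (x.2 + x.1 : ℕ)) i (act (x.2 : ℤ) b (E.residue x.1 a)) t) hfs',
    ← finsum_sub_distrib (hfs m n a b) hfs', finsum_eq_sum_range (N := L) (fun l hl => by
      rw [hL' l hl, E.singular_eq_sum 𝒴 (N := 0) (fun k _ => map_zero _)]; simp)]
  -- The summand depends on j and k only through s = j + k, as the convolution identity requires.
  let g : ℕ → ℕ → S := fun l s =>
    𝒴.coeff (m + n + r - s) i (E.residue (s - l) (mode l a b)) t
  have hg : ∀ l, ∃ K, ∀ s, K ≤ s → g l s = 0 := by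
    intro l
    obtain ⟨N, hN⟩ := E.exists_residue_eq_zero (mode l a b)
    exact ⟨N + l, fun s hs => by
      simp only [g]
      rw [hN _ (by omega), map_zero, LinearMap.zero_apply]⟩
  calc _ = ∑ᶠ x : ℕ × ℕ, ∑ l ∈ Finset.range L,
        (intChoose n x.2 * intChoose m x.1 * intChoose x.1 l) • g l (x.1 + x.2) := by
        refine finsum_congr fun x => ?_
        have h := E.residue_commutator x.1 x.2 a b
        rw [finsum_eq_sum_range (N := L) fun l hl => by rw [hL' l hl, map_zero, smul_zero]] at h
        rw [mul_comm (intChoose m x.1), add_comm (n : ℂ), add_comm x.2, ← smul_sub,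
          ← LinearMap.sub_apply, ← map_sub, h, map_sum, LinearMap.sum_apply, Finset.smul_sum]
        refine Finset.sum_congr rfl fun l _ => ?_
        rw [map_smul, LinearMap.smul_apply, smul_smul]
        simp only [g]
        push_cast
        rfl
    _ = _ := by
        rw [← sum_finsum_comm]
        · refine Finset.sum_congr rfl fun l _ => ?_
          obtain ⟨K, hK⟩ := hg l
          rw [finsum_convolution_prod m n l (hasFiniteSupport_of_eventually hK), singular]
          congr 1
          refine finsum_congr fun q => ?_
          simp only [g]
          push_cast
          rw [add_comm n m, add_sub_cancel_left,
            show (m : ℂ) + n + r - (l + q) = m + n - l + r - q by ring]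
        · intro l _
          obtain ⟨K, hK⟩ := hg l
          exact hasFiniteSupport_antidiagonal (N := K) fun j k hjk => by
            simp only [hK _ hjk, smul_zero]

variable {E 𝒴} (I : E.Primitive 𝒴)

/-- The coefficients of `𝒴(p, z)` for the generator `p`. -/
noncomputable def Primitive.lift (r : ℂ) (i : ℕ) : T →ₗ[ℂ] S × T :=
  (I.coeff r i).prod (if r = -1 ∧ i = 0 then LinearMap.id else 0)

theorem Primitive.lift_apply (r : ℂ) (i : ℕ) (t : T) :
    I.lift r i t = (I.coeff r i t, if r = -1 ∧ i = 0 then t else 0) := by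
  unfold lift
  split_ifs <;> rfl

theorem Primitive.lift_constant (t : T) : I.lift (-1) 0 t = (0, t) := by
  simp [lift_apply, I.constant]

theorem Primitive.lift_commutator (n : ℤ) (a : V) (r : ℂ) (i : ℕ) (t : T) :
    E.extAct 𝒴 n a (I.lift r i t) =
      I.lift r i (act n a t) + LinearMap.inl ℂ S T (E.singular 𝒴 n a r i t) := by
  rw [extAct_apply, lift_apply, lift_apply, ← I.commutator]
  ext
  · split_ifs <;> simp
  · split_ifs <;> simp

/-- The coefficients of `𝒴(p, z)` along a coset of `ℤ`. -/
noncomputable def Primitive.field (s : ℂ) (i : ℕ) (n : ℤ) : T →ₗ[ℂ] S × T := I.lift (s + n) i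

theorem Primitive.exists_lift_eq_zero (i : ℕ) (t : T) :
    ∃ N : ℝ, ∀ r : ℂ, N < r.re → I.lift r i t = 0 := by
  obtain ⟨N, hN⟩ := I.truncation t i
  refine ⟨max N 0, fun r hr => ?_⟩
  have h1 := (le_max_left N 0).trans_lt hr
  have h2 := (le_max_right N 0).trans_lt hr
  rw [lift_apply, hN r h1, if_neg]
  · rfl
  · rintro ⟨rfl, -⟩
    norm_num at h2

theorem Primitive.isTruncated_field (s : ℂ) (i : ℕ) : IsTruncated fun n t => I.field s i n t := by
  intro t
  obtain ⟨N, hN⟩ := I.exists_lift_eq_zero i t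
  exact IntertwiningOperator.isTruncated_of_re (F := fun r t => I.lift r i t) s hN

theorem Primitive.field_commutator (s : ℂ) (i : ℕ) (m : ℤ) (a : V) (r : ℤ) (t : T) :
    fieldBracket (fun n => E.extAct 𝒴 n a) (fun n => act n a) 0 m (fun n x => I.field s i n x) r t =
      ∑ᶠ q : ℕ, intChoose m q •
        LinearMap.inl ℂ S T (𝒴.field s i (E.residue q a) (r + m - q) t) := by
  rw [fieldBracket_zero_left, finsum_smul_map LinearMap.inl_injective]
  simp only [field]
  rw [I.lift_commutator, add_sub_cancel_left]
  congr 1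
  refine finsum_congr fun q => ?_
  simp only [IntertwiningOperator.field]
  congr 4
  push_cast; ring

end UnitExtension

/-! ### Associativity of the twisted action -/

namespace UnitExtension

variable {V : Type u} [AddCommGroup V] [Module ℂ V] [VertexOperatorAlgebra V]
    {R P : Type u} [AddCommGroup R] [Module ℂ R] [VOAModule V R]
    [AddCommGroup P] [Module ℂ P] [VOAModule V P]
    {T S : Type u} [AddCommGroup T] [Module ℂ T] [VOAModule V T]
    [AddCommGroup S] [Module ℂ S] [VOAModule V S]
    (E : UnitExtension V R P) (𝒴 : IntertwiningOperator V R T S)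

/-- The cocycle identity for products: (a_m b)_l p is expanded by associativity. The first half
involves b_{l+k} p and is therefore grouped by q = l + k; the second involves a_q p with q
independent of l. -/
theorem singular_mode (m n : ℤ) {a b : V} {N : ℕ} (ha : ∀ k : ℤ, N ≤ k → E.residue k a = 0)
    (hb : ∀ k : ℤ, N ≤ k → E.residue k b = 0) (r : ℂ) (i : ℕ) (t : T) :
    E.singular 𝒴 n (mode m a b) r i t =
      ∑ q ∈ Finset.range N, ∑ x ∈ Finset.HasAntidiagonal.antidiagonal q,
        (intChoose n x.1 * ((-1 : ℂ) ^ x.2 * intChoose m x.2)) •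
          𝒴.coeff (n + r - x.1) i (act (m - x.2) a (E.residue q b)) t -
      ∑ q ∈ Finset.range N, ((-1 : ℂ) ^ (m + q) * intChoose m q) •
        ∑ᶠ j : ℕ, intChoose n j • 𝒴.coeff (n + r - j) i (act (m - q + j) b (E.residue q a)) t := by
  have h1 : ∀ l : ℕ, intChoose n l • 𝒴.coeff (n + r - l) i (E.residue l (mode m a b)) t =
      ∑ k ∈ Finset.range N, (intChoose n l * ((-1 : ℂ) ^ k * intChoose m k)) •
          𝒴.coeff (n + r - l) i (act (m - k) a (E.residue (l + k : ℕ) b)) t -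
      ∑ q ∈ Finset.range N, ((-1 : ℂ) ^ (m + q) * intChoose m q) • intChoose n l •
          𝒴.coeff (n + r - l) i (act (m - q + l) b (E.residue q a)) t := by
    intro l
    rw [E.residue_mode, finsum_eq_sum_range (N := N) fun k hk => by
        rw [hb _ (by omega), map_zero, smul_zero],
      finsum_eq_sum_range (N := N) fun k hk => by rw [ha _ (by omega), map_zero, smul_zero]]
    simp only [map_sub, map_sum, LinearMap.sub_apply, LinearMap.sum_apply, map_smul,
      LinearMap.smul_apply, smul_sub, Finset.smul_sum]
    congr 1
    · refine Finset.sum_congr rfl fun k _ => ?_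
      rw [smul_smul]
      push_cast
      rfl
    · refine Finset.sum_congr rfl fun k _ => ?_
      rw [smul_comm, show m + (l : ℤ) - k = m - k + l by ring]
  have hF : ∀ l k : ℕ, N ≤ l + k → (intChoose n l * ((-1 : ℂ) ^ k * intChoose m k)) •
      𝒴.coeff (n + r - l) i (act (m - k) a (E.residue (l + k : ℕ) b)) t = 0 := fun l k hlk => by
    rw [hb _ (by exact_mod_cast hlk)]
    simp
  have hB : ∀ q : ℕ, (fun l : ℕ => intChoose n l •
      𝒴.coeff (n + r - l) i (act (m - q + l) b (E.residue q a)) t).HasFiniteSupport := by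
    intro q
    exact VOAModule.mode_hasFiniteSupport b (E.residue q a) (m - q)
      (fun l x => intChoose n l • 𝒴.coeff (n + r - l) i x t) fun l => by simp
  have hFs : (fun x : ℕ × ℕ => (intChoose n x.1 * ((-1 : ℂ) ^ x.2 * intChoose m x.2)) •
      𝒴.coeff (n + r - x.1) i
        (act (m - x.2) a (E.residue (x.1 + x.2 : ℕ) b)) t).HasFiniteSupport :=
    hasFiniteSupport_antidiagonal (N := N) hF
  rw [singular]
  simp only [h1]
  rw [finsum_sub_distrib]
  · congr 1
    · have h2 := finsum_antidiagonal (F := fun x : ℕ × ℕ =>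
        (intChoose n x.1 * ((-1 : ℂ) ^ x.2 * intChoose m x.2)) •
          𝒴.coeff (n + r - x.1) i (act (m - x.2) a (E.residue (x.1 + x.2 : ℕ) b)) t) hF
      rw [finsum_prod_left hFs, finsum_eq_sum_range (N := N)] at h2
      · have h3 : ∀ l : ℕ, ∑ k ∈ Finset.range N,
            (intChoose n l * ((-1 : ℂ) ^ k * intChoose m k)) •
            𝒴.coeff (n + r - l) i (act (m - k) a (E.residue (l + k : ℕ) b)) t =
            ∑ᶠ k : ℕ, (intChoose n l * ((-1 : ℂ) ^ k * intChoose m k)) •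
            𝒴.coeff (n + r - l) i (act (m - k) a (E.residue (l + k : ℕ) b)) t := fun l =>
          (finsum_eq_sum_range fun k hk => hF l k (by omega)).symm
        simp only [h3]
        rw [finsum_eq_sum_range (N := N), h2, finsum_eq_sum_range (N := N)]
        · refine Finset.sum_congr rfl fun q _ => Finset.sum_congr rfl fun x hx => ?_
          rw [Finset.HasAntidiagonal.mem_antidiagonal.mp hx]
        · intro q hq
          refine Finset.sum_eq_zero fun x hx => hF x.1 x.2 ?_
          rwa [Finset.HasAntidiagonal.mem_antidiagonal.mp hx]
        · intro l hl
          rw [finsum_congr fun k => hF l k (by omega), finsum_zero]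
      · intro l hl
        rw [finsum_congr fun k => hF l k (by omega), finsum_zero]
    · rw [← sum_finsum_comm _ _ fun q _ => HasFiniteSupport.smul_fun (hB q) _]
      exact Finset.sum_congr rfl fun q _ => (smul_finsum _ _).symm
  · exact hasFiniteSupport_of_eventually (N := N) fun l hl =>
      Finset.sum_eq_zero fun k _ => hF l k (by omega)
  · exact Function.HasFiniteSupport.sum (fun q => HasFiniteSupport.smul_fun (hB q)
      fun _ => (-1 : ℂ) ^ (m + q) * intChoose m q) _

variable {E 𝒴} (I : E.Primitive 𝒴)

theorem Primitive.field_commutator_eq_sum {a : V} {N : ℕ}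
    (ha : ∀ k : ℤ, N ≤ k → E.residue k a = 0) (s : ℂ) (i : ℕ) (m r : ℤ) (t : T) :
    fieldBracket (fun n => E.extAct 𝒴 n a) (fun n => act n a) 0 m (fun n x => I.field s i n x) r t =
      ∑ q ∈ Finset.range N, intChoose m q •
        LinearMap.inl ℂ S T (𝒴.field s i (E.residue q a) (r + m - q) t) := by
  rw [I.field_commutator, finsum_eq_sum_range]
  intro j hj
  rw [ha j (by omega), IntertwiningOperator.field]
  simp

theorem fieldAct_inl (s : ℂ) (i : ℕ) (m : ℤ) (a : V) (y : R) (r : ℤ) (t : T) :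
    fieldAct (fun n => E.extAct 𝒴 n a) (fun n => act n a) m
      (fun n x => LinearMap.inl ℂ S T (𝒴.field s i y n x)) r t =
    LinearMap.inl ℂ S T (𝒴.field s i (act m a y) r t) := by
  rw [𝒴.field_act]
  exact fieldBracket_map LinearMap.inl_injective (fun n x => E.extAct_inl 𝒴 n a x) _ _ _ _ _

theorem fieldBracket_inl (s : ℂ) (i : ℕ) (l m : ℤ) (a : V) (y : R) (r : ℤ) (t : T) :
    fieldBracket (fun n => E.extAct 𝒴 n a) (fun n => act n a) l m
      (fun n x => LinearMap.inl ℂ S T (𝒴.field s i y n x)) r t =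
    LinearMap.inl ℂ S T
      (∑ᶠ j : ℕ, intChoose m j • 𝒴.field s i (act (l + j) a y) (r + m - j) t) := by
  rw [← 𝒴.fieldBracket_field]
  exact fieldBracket_map LinearMap.inl_injective (fun n x => E.extAct_inl 𝒴 n a x) _ _ _ _ _

theorem isTruncated_inl_field (s : ℂ) (i : ℕ) (y : R) :
    IsTruncated fun n (t : T) => LinearMap.inl ℂ S T (𝒴.field s i y n t) := by
  intro t
  obtain ⟨N, hN⟩ := 𝒴.isTruncated_field s i y t
  exact ⟨N, fun n hn => by simp only [hN n hn, map_zero]⟩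

/-- The case l = 0 of the composite formula computes the commutator of the product of the modes of a
and b with 𝒴(p, z). By `singular_mode` it equals the commutator of the modes of a_m b. Associativity
on T is known, so it follows on the coefficients of 𝒴(p, z)t. -/
theorem Primitive.modeProd_lift (m n : ℤ) (a b : V) (r : ℂ) (i : ℕ) (t : T) :
    modeProd (fun k => E.extAct 𝒴 k a) (fun k => E.extAct 𝒴 k b) m n (I.lift r i t) =
      E.extAct 𝒴 n (mode m a b) (I.lift r i t) := by
  obtain ⟨N₁, hN₁⟩ := E.exists_residue_eq_zero a
  obtain ⟨N₂, hN₂⟩ := E.exists_residue_eq_zero b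
  have ha : ∀ k : ℤ, (N₁ + N₂ : ℕ) ≤ k → E.residue k a = 0 := fun k hk => hN₁ k (by omega)
  have hb : ∀ k : ℤ, (N₁ + N₂ : ℕ) ≤ k → E.residue k b = 0 := fun k hk => hN₂ k (by omega)
  have h := finsum_smul_modeProd_sub_eq (l := 0) (N := N₁ + N₂)
    (φ := I.field r i)
    (E.isTruncated_extAct 𝒴 a) (E.isTruncated_extAct 𝒴 b)
    (VOAModule.isTruncated_act (M := T) a) (VOAModule.isTruncated_act (M := T) b)
    (I.isTruncated_field r i)
    (χ := fun q n t => LinearMap.inl ℂ S T (𝒴.field r i (E.residue q a) n t))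
    (ψ := fun q n t => LinearMap.inl ℂ S T (𝒴.field r i (E.residue q b) n t))
    (fun q => isTruncated_inl_field r i _) (fun q n => by simp)
    (fun q => isTruncated_inl_field r i _) (fun q n => by simp)
    (fun m r' t => I.field_commutator_eq_sum ha r i m r' t)
    (fun m r' t => I.field_commutator_eq_sum hb r i m r' t) m n 0 t
  rw [finsum_eq_single _ 0 fun j hj => by rw [intChoose.zero_left hj, mul_zero, zero_smul],
    finsum_eq_single _ 0 fun j hj => by rw [intChoose.zero_left hj, mul_zero, zero_smul]] at h
  simp only [fieldAct_inl] at h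
  simp only [fieldBracket_inl] at h
  have hs := congrArg (LinearMap.inl ℂ S T) (E.singular_mode 𝒴 m n ha hb r i t)
  simp only [map_sub, map_sum, map_smul] at hs
  have e1 : ∀ j : ℕ, r + ((0 + n - j : ℤ) : ℂ) = n + r - j := fun j => by push_cast; ring
  have e2 : ∀ q : ℕ, (0 : ℤ) + m - q = m - q := fun q => by ring
  simp only [IntertwiningOperator.field, e1, e2] at h
  rw [← hs, Primitive.field, Primitive.field] at h
  simp only [pow_zero, intChoose.zero_right, mul_one, one_smul, add_zero, Nat.cast_zero, sub_zero,
    Int.cast_zero, zpow_zero] at h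
  rw [I.lift_commutator, ← h, VOAModule.act_mode]
  abel

/-- The extension of `T` by `S` on `S × T` through which `𝒴(p, z)` is defined. -/
noncomputable abbrev Primitive.extModule : VOAModule V (S × T) where
  act := E.extAct 𝒴
  truncation a x := E.isTruncated_extAct 𝒴 a x
  vacuum_act n x := by
    rw [extAct_apply, cocycle_apply, singular_vacuum, add_zero, VOAModule.vacuum_act,
      VOAModule.vacuum_act]
    split_ifs <;> rfl
  derivative n a x := by
    simp only [extAct_apply, cocycle_apply, singular_mode_omega, VOAModule.derivative]
    ext <;> simp
    abel
  commutativity m n a b x := by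
    obtain ⟨L, hL⟩ := (VOAModule.isTruncated_act (M := V) a).exists_add b 0
    simp only [zero_add] at hL
    have hL' : ∀ l : ℕ, L ≤ l → mode (l : ℤ) a b = 0 := hL
    rw [finsum_eq_sum_range (N := L) fun l hl => by
      rw [hL' l hl, map_zero, LinearMap.zero_apply, smul_zero]]
    have h1 := VOAModule.commutativity m n a b x.1
    have h2 := VOAModule.commutativity m n a b x.2
    have h3 := E.singular_commutator 𝒴 m n a b (-1) 0 x.2
    rw [finsum_eq_sum_range (N := L) fun l hl => by
      rw [hL' l hl, map_zero, LinearMap.zero_apply, smul_zero]] at h1 h2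
    rw [finsum_eq_sum_range (N := L) fun l hl => by
      rw [hL' l hl, E.singular_eq_sum 𝒴 (N := 0) (fun k _ => map_zero _)]; simp] at h3
    simp only [extAct_apply, cocycle_apply]
    ext
    · simp only [Prod.fst_sub, Prod.fst_sum, Prod.smul_fst, map_add, smul_add,
        Finset.sum_add_distrib]
      rw [← h1, ← h3]
      abel
    · simp only [Prod.snd_sub, Prod.snd_sum, Prod.smul_snd]
      exact h2
  associativity m n a b x := by
    change _ = modeProd (fun k => E.extAct 𝒴 k a) (fun k => E.extAct 𝒴 k b) m n x
    -- The vector (0, t) is the constant coefficient of 𝒴(p, z)t, so S and these coefficients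
    -- exhaust S × T; on S the twisted action is the given one.
    have hx : x = LinearMap.inl ℂ S T x.1 + I.lift (-1) 0 x.2 := by
      rw [I.lift_constant]
      ext <;> simp
    rw [hx, modeProd_add (E.isTruncated_extAct 𝒴 a) (E.isTruncated_extAct 𝒴 b),
      I.modeProd_lift, map_add, extAct_inl, VOAModule.act_mode,
      modeProd_map LinearMap.inl_injective (fun k y => E.extAct_inl 𝒴 k a y)
        (fun k y => E.extAct_inl 𝒴 k b y)]

end UnitExtension

/-! ### Linearity, shifts and the Leibniz rule for brackets -/

section BracketLinear

variable {T M : Type*} [AddCommGroup T] [Module ℂ T] [AddCommGroup M] [Module ℂ M]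
variable {aM : ℤ → M →ₗ[ℂ] M} {aT : ℤ → T →ₗ[ℂ] T}

theorem fieldBracket_shift_field (l m k : ℤ) (φ : ℤ → T → M) (r : ℤ) (t : T) :
    fieldBracket aM aT l m (fun n => φ (n + k)) r t = fieldBracket aM aT l m φ (r + k) t := by
  simp only [fieldBracket]
  congr 1
  · exact finsum_congr fun j => by rw [add_right_comm]
  · exact finsum_congr fun j => by rw [show l + r - (j : ℤ) + k = l + (r + k) - j by ring]

theorem fieldBracket_shift_modes (l m k : ℤ) (φ : ℤ → T → M) (r : ℤ) (t : T) :
    fieldBracket (fun n => aM (n + k)) (fun n => aT (n + k)) l m φ r t =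
      fieldBracket aM aT l (m + k) φ r t := by
  simp only [fieldBracket]
  congr 1
  · exact finsum_congr fun j => by rw [show m + l - (j : ℤ) + k = m + k + l - j by ring]
  · exact finsum_congr fun j => by rw [add_right_comm]

theorem fieldBracket_sum_field {ι : Type*} (s : Finset ι) (c : ι → ℂ) {φ : ι → ℤ → T → M}
    (haT : IsTruncated fun n x => aT n x) (hφ : ∀ i, IsTruncated (φ i))
    (h0 : ∀ i n, φ i n 0 = 0) (l m r : ℤ) (t : T) :
    fieldBracket aM aT l m (fun n x => ∑ i ∈ s, c i • φ i n x) r t =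
      ∑ i ∈ s, c i • fieldBracket aM aT l m (φ i) r t := by
  simp only [fieldBracket, map_sum, map_smul, Finset.smul_sum, smul_sub, Finset.sum_sub_distrib]
  congr 1
  · rw [← sum_finsum_comm]
    · refine Finset.sum_congr rfl fun i _ => ?_
      rw [smul_finsum]
      exact finsum_congr fun j => smul_comm _ _ _
    · intro i _
      simp only [smul_smul]
      exact hasFiniteSupport_left _ (hφ i) _ _ _
  · rw [← sum_finsum_comm]
    · refine Finset.sum_congr rfl fun i _ => ?_
      rw [smul_finsum]
      exact finsum_congr fun j => smul_comm _ _ _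
    · intro i _
      simp only [smul_smul]
      exact hasFiniteSupport_right _ haT (h0 i) _ _ _

theorem fieldBracket_add_field {φ φ' : ℤ → T → M} (haT : IsTruncated fun n x => aT n x)
    (hφ : IsTruncated φ) (h0 : ∀ n, φ n 0 = 0) (hφ' : IsTruncated φ') (h0' : ∀ n, φ' n 0 = 0)
    (l m r : ℤ) (t : T) :
    fieldBracket aM aT l m (fun n x => φ n x + φ' n x) r t =
      fieldBracket aM aT l m φ r t + fieldBracket aM aT l m φ' r t := by
  have h := fieldBracket_sum_field (aM := aM) (aT := aT) (Finset.range 2) (fun _ => 1)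
    (φ := fun i => if i = 0 then φ else φ') haT
    (fun i => by by_cases hi : i = 0 <;> simp [hi, hφ, hφ'])
    (fun i n => by by_cases hi : i = 0 <;> simp [hi, h0, h0']) l m r t
  simpa [Finset.sum_range_succ] using h

theorem fieldBracket_sum_modes {ι : Type*} (s : Finset ι) (c : ι → ℂ)
    {dM : ι → ℤ → M →ₗ[ℂ] M} {dT : ι → ℤ → T →ₗ[ℂ] T} {φ : ℤ → T →ₗ[ℂ] M}
    (hdT : ∀ i, IsTruncated fun n x => dT i n x) (hφ : IsTruncated fun n x => φ n x)
    (l m r : ℤ) (t : T) :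
    fieldBracket (fun n => ∑ i ∈ s, c i • dM i n) (fun n => ∑ i ∈ s, c i • dT i n) l m
      (fun n x => φ n x) r t =
      ∑ i ∈ s, c i • fieldBracket (dM i) (dT i) l m (fun n x => φ n x) r t := by
  simp only [fieldBracket, LinearMap.sum_apply, LinearMap.smul_apply, map_sum, map_smul,
    Finset.smul_sum, smul_sub, Finset.sum_sub_distrib]
  congr 1
  · rw [← sum_finsum_comm]
    · refine Finset.sum_congr rfl fun i _ => ?_
      rw [smul_finsum]
      exact finsum_congr fun j => smul_comm _ _ _
    · intro i _
      simp only [smul_smul]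
      exact hasFiniteSupport_left _ hφ _ _ _
  · rw [← sum_finsum_comm]
    · refine Finset.sum_congr rfl fun i _ => ?_
      rw [smul_finsum]
      exact finsum_congr fun j => smul_comm _ _ _
    · intro i _
      simp only [smul_smul]
      exact hasFiniteSupport_right (φ := fun n x => φ n x) _ (hdT i) (fun n => map_zero _) _ _ _

/-- Commutation with f is a derivation of the bracket. It will be applied with f a mode a_m, where
the commutator with the modes of b is again a sum of modes. -/
theorem fieldBracket_leibniz {fM : M →ₗ[ℂ] M} {fT : T →ₗ[ℂ] T} {cM : ℤ → M →ₗ[ℂ] M}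
    {cT : ℤ → T →ₗ[ℂ] T} {φ : ℤ → T →ₗ[ℂ] M} (haT : IsTruncated fun n x => aT n x)
    (hcT : IsTruncated fun n x => cT n x) (hφ : IsTruncated fun n x => φ n x)
    (hcM : ∀ n x, cM n x = fM (aM n x) - aM n (fM x))
    (hcT' : ∀ n x, cT n x = fT (aT n x) - aT n (fT x)) (l m r : ℤ) (t : T) :
    fM (fieldBracket aM aT l m (fun n x => φ n x) r t) -
      fieldBracket aM aT l m (fun n x => φ n x) r (fT t) =
      fieldBracket aM aT l m (fun n x => fM (φ n x) - φ n (fT x)) r t +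
        fieldBracket cM cT l m (fun n x => φ n x) r t := by
  have hφf : IsTruncated fun n x => fM (φ n x) - φ n (fT x) := fun x => by
    obtain ⟨N, hN⟩ := hφ x
    obtain ⟨K, hK⟩ := hφ (fT x)
    exact ⟨max N K, fun n hn => by
      simp only at hN hK ⊢
      rw [hN n (by omega), hK n (by omega), map_zero, sub_zero]⟩
  have z : ∀ n, (fun n x => φ n x) n 0 = 0 := fun n => map_zero _
  have zf : ∀ n, (fun n x => fM (φ n x) - φ n (fT x)) n 0 = 0 := fun n => by simp
  simp only [fieldBracket]
  rw [map_sub, map_finsum _ (hasFiniteSupport_left _ hφ _ _ _),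
    map_finsum _ (hasFiniteSupport_right (φ := fun n x => φ n x) _ haT z _ _ _)]
  have e1 := finsum_sub_distrib
    (hasFiniteSupport_left (aM := fun n => fM ∘ₗ aM n)
      (fun j : ℕ => (-1 : ℂ) ^ j * intChoose l j) hφ (fun j => m + l - j) r t)
    (hasFiniteSupport_left (aM := aM)
      (fun j : ℕ => (-1 : ℂ) ^ j * intChoose l j) hφ (fun j => m + l - j) r (fT t))
  have e2 := finsum_add_distrib
    (hasFiniteSupport_left (aM := aM)
      (fun j : ℕ => (-1 : ℂ) ^ j * intChoose l j) hφf (fun j => m + l - j) r t)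
    (hasFiniteSupport_left (aM := cM)
      (fun j : ℕ => (-1 : ℂ) ^ j * intChoose l j) hφ (fun j => m + l - j) r t)
  obtain ⟨N, hN⟩ := haT.exists_add t m
  obtain ⟨K, hK⟩ := haT.exists_add (fT t) m
  have f1 : (fun j : ℕ => ((-1 : ℂ) ^ (l + j) * intChoose l j) •
      fM (φ (l + r - j) (aT (m + j) t))).HasFiniteSupport :=
    hasFiniteSupport_of_eventually (N := N) fun j hj => by rw [hN j hj]; simp
  have e3 := finsum_sub_distrib f1
    (hasFiniteSupport_right (φ := fun n x => φ n x)
      (fun j : ℕ => (-1 : ℂ) ^ (l + j) * intChoose l j) haT z (fun j => l + r - j) m (fT t))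
  have e4 := finsum_add_distrib
    (hasFiniteSupport_right (φ := fun n x => fM (φ n x) - φ n (fT x))
      (fun j : ℕ => (-1 : ℂ) ^ (l + j) * intChoose l j) haT zf (fun j => l + r - j) m t)
    (hasFiniteSupport_right (φ := fun n x => φ n x)
      (fun j : ℕ => (-1 : ℂ) ^ (l + j) * intChoose l j) hcT z (fun j => l + r - j) m t)
  simp only [map_smul]
  have e5 := e1.symm.trans ((finsum_congr fun j => ?_).trans e2)
  have e6 := e3.symm.trans ((finsum_congr fun j => ?_).trans e4)
  · simp only [LinearMap.coe_comp, Function.comp_apply] at e5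
    rw [sub_sub_sub_comm, e5, e6]
    abel
  · simp only [hcT', map_sub, smul_sub]
    abel
  · simp only [LinearMap.coe_comp, Function.comp_apply, hcM, map_sub, smul_sub]
    abel

end BracketLinear

/-! ### The extended operator on P: definition and truncation -/

namespace UnitExtension

variable {V : Type u} [AddCommGroup V] [Module ℂ V] [VertexOperatorAlgebra V]
    {R P : Type u} [AddCommGroup R] [Module ℂ R] [VOAModule V R]
    [AddCommGroup P] [Module ℂ P] [VOAModule V P]
    {T S : Type u} [AddCommGroup T] [Module ℂ T] [VOAModule V T]
    [AddCommGroup S] [Module ℂ S] [VOAModule V S]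
    {E : UnitExtension V R P} {𝒴 : IntertwiningOperator V R T S} (I : E.Primitive 𝒴)

namespace Primitive

theorem hasFiniteSupport_lift_left (k : ℕ → ℤ) (b : V) (r : ℂ) (i : ℕ) (t : T) :
    (fun j : ℕ => E.extAct 𝒴 (k j) b (I.lift (r + j) i t)).HasFiniteSupport := by
  obtain ⟨N, hN⟩ := (I.isTruncated_field r i).exists_add t 0
  refine hasFiniteSupport_of_eventually (N := N) fun j hj => ?_
  have := hN j hj
  simp only [field, zero_add, Int.cast_natCast] at this
  rw [this, map_zero]

theorem hasFiniteSupport_lift_right (k : ℕ → ℂ) (b : V) (i : ℕ) (t : T) :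
    (fun j : ℕ => I.lift (k j) i (act (j : ℤ) b t)).HasFiniteSupport := by
  obtain ⟨N, hN⟩ := (VOAModule.isTruncated_act b).exists_add t 0
  refine hasFiniteSupport_of_eventually (N := N) fun j hj => ?_
  have := hN j hj
  simp only [zero_add] at this
  rw [this, map_zero]

/-- The coefficients of `𝒴(b_{-1} p, z)` for the generator `p`. -/
noncomputable def ofMode (r : ℂ) (i : ℕ) : V →ₗ[ℂ] T →ₗ[ℂ] S × T :=
  LinearMap.mk₂ ℂ (fun b t => ∑ᶠ j : ℕ, E.extAct 𝒴 (-1 - j) b (I.lift (r + j) i t) +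
      ∑ᶠ j : ℕ, I.lift (r - 1 - j) i (act (j : ℤ) b t))
    (fun b b' t => by
      simp only [map_add, LinearMap.add_apply]
      rw [finsum_add_distrib (I.hasFiniteSupport_lift_left _ _ _ _ _)
        (I.hasFiniteSupport_lift_left _ _ _ _ _),
        finsum_add_distrib (I.hasFiniteSupport_lift_right _ _ _ _)
        (I.hasFiniteSupport_lift_right _ _ _ _), add_add_add_comm])
    (fun c b t => by simp only [map_smul, LinearMap.smul_apply, ← smul_finsum, ← smul_add])
    (fun b t t' => by
      simp only [map_add]
      rw [finsum_add_distrib (I.hasFiniteSupport_lift_left _ _ _ _ _)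
        (I.hasFiniteSupport_lift_left _ _ _ _ _),
        finsum_add_distrib (I.hasFiniteSupport_lift_right _ _ _ _)
        (I.hasFiniteSupport_lift_right _ _ _ _), add_add_add_comm])
    (fun c b t => by simp only [map_smul, ← smul_finsum, ← smul_add])

theorem ofMode_apply (r : ℂ) (i : ℕ) (b : V) (t : T) :
    I.ofMode r i b t = ∑ᶠ j : ℕ, E.extAct 𝒴 (-1 - j) b (I.lift (r + j) i t) +
      ∑ᶠ j : ℕ, I.lift (r - 1 - j) i (act (j : ℤ) b t) := rfl

/-- Since C(-1, j) = (-1)^j all signs cancel, and the product of index -1 is the normally ordered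
product that defines `ofMode`. -/
theorem fieldAct_neg_one {M : Type*} [AddCommGroup M] [Module ℂ M] (aM : ℤ → M →ₗ[ℂ] M)
    (aT : ℤ → T →ₗ[ℂ] T) (φ : ℤ → T → M) (r : ℤ) (t : T) :
    fieldAct aM aT (-1) φ r t = ∑ᶠ j : ℕ, aM (-1 - j) (φ (r + j) t) +
      ∑ᶠ j : ℕ, φ (-1 + r - j) (aT j t) := by
  have h : ∀ j : ℕ, ((-1 : ℂ) ^ j) * (-1) ^ j = 1 := fun j => by rw [← mul_pow]; norm_num
  simp only [fieldAct, fieldBracket, neg_one_zpow_add_natCast, intChoose.neg_one, mul_assoc, h,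
    zero_add, one_smul, mul_one]
  rw [sub_eq_add_neg, ← finsum_neg_distrib]
  congr 1
  refine finsum_congr fun j => ?_
  norm_num

theorem fieldAct_field (s : ℂ) (i : ℕ) (b : V) (r : ℤ) (t : T) :
    fieldAct (fun n => E.extAct 𝒴 n b) (fun n => act n b) (-1) (fun n x => I.field s i n x) r t =
      I.ofMode (s + r) i b t := by
  rw [fieldAct_neg_one, ofMode_apply]
  simp only [field]
  congr 1
  · refine finsum_congr fun j => ?_
    congr 3
    push_cast; ring
  · refine finsum_congr fun j => ?_
    congr 2
    push_cast; ring

/-- The coefficients of the extension of `𝒴` to `P`. -/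
noncomputable def extCoeff (r : ℂ) (i : ℕ) : P →ₗ[ℂ] T →ₗ[ℂ] S × T :=
  (𝒴.coeff r i ∘ₗ E.retract).compr₂ (LinearMap.inl ℂ S T) + I.ofMode r i ∘ₗ E.proj

theorem extCoeff_apply (r : ℂ) (i : ℕ) (x : P) (t : T) :
    I.extCoeff r i x t =
      LinearMap.inl ℂ S T (𝒴.coeff r i (E.retract x) t) + I.ofMode r i (E.proj x) t := rfl

theorem extCoeff_incl (r : ℂ) (i : ℕ) (y : R) (t : T) :
    I.extCoeff r i (E.incl y) t = LinearMap.inl ℂ S T (𝒴.coeff r i y t) := by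
  rw [extCoeff_apply, E.retract_incl, E.proj_incl, map_zero, LinearMap.zero_apply, add_zero]

theorem extCoeff_mode (r : ℂ) (i : ℕ) (b : V) (t : T) :
    I.extCoeff r i (act (-1) b E.generator) t = I.ofMode r i b t := by
  rw [extCoeff_apply, E.retract_neg_one, E.proj_act, E.proj_generator,
    (VertexOperatorAlgebra.creation b).1, map_zero, LinearMap.zero_apply, map_zero, zero_add]

theorem extCoeff_act_generator (r : ℂ) (i : ℕ) {k : ℤ} (hk : 0 ≤ k) (b : V) (t : T) :
    I.extCoeff r i (act k b E.generator) t =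
      LinearMap.inl ℂ S T (𝒴.coeff r i (E.residue k b) t) := by
  rw [← E.incl_residue hk, extCoeff_incl]

theorem eq_incl_add (x : P) : x = E.incl (E.retract x) + act (-1) (E.proj x) E.generator := by
  rw [E.incl_retract, sub_add_cancel]

theorem extCoeff_generator (r : ℂ) (i : ℕ) (t : T) :
    I.extCoeff r i E.generator t = I.lift r i t := by
  rw [extCoeff_apply, E.retract_generator, E.proj_generator, map_zero, LinearMap.zero_apply,
    map_zero, zero_add, ofMode_apply, finsum_eq_single _ 0, finsum_eq_zero_of_forall_eq_zero,
    add_zero]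
  · rw [extAct_apply, cocycle_apply, E.singular_vacuum, VOAModule.vacuum_act, VOAModule.vacuum_act]
    simp
  · intro j
    rw [VOAModule.vacuum_act, if_neg (by omega), map_zero]
  · intro j hj
    rw [extAct_apply, cocycle_apply, E.singular_vacuum, VOAModule.vacuum_act, VOAModule.vacuum_act,
      if_neg (by omega), if_neg (by omega), add_zero]
    rfl

theorem exists_extCoeff_eq_zero (x : P) (t : T) (i : ℕ) :
    ∃ N : ℝ, ∀ r : ℂ, N < r.re → I.extCoeff r i x t = 0 := by
  obtain ⟨N₁, h₁⟩ := 𝒴.truncation (E.retract x) t i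
  obtain ⟨N₂, h₂⟩ := I.exists_lift_eq_zero i t
  obtain ⟨K, hK⟩ := (VOAModule.isTruncated_act (E.proj x)).exists_add t 0
  choose N₃ h₃ using fun j : ℕ => I.exists_lift_eq_zero i (act (j : ℤ) (E.proj x) t)
  -- Only the modes b_j t with j < K survive, and their exponents are lowered by 1 + j ≤ 1 + K; the
  -- sum of absolute values dominates every threshold.
  let N := |N₁| + |N₂| + ∑ j ∈ Finset.range K, |N₃ j| + 1 + K
  have hs : 0 ≤ ∑ j ∈ Finset.range K, |N₃ j| := Finset.sum_nonneg fun _ _ => abs_nonneg _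
  have hK0 : (0 : ℝ) ≤ K := Nat.cast_nonneg K
  refine ⟨N, fun r hr => ?_⟩
  have hr' : |N₁| + |N₂| + ∑ j ∈ Finset.range K, |N₃ j| + 1 + K < r.re := hr
  have g1 := le_abs_self N₁
  have g2 := le_abs_self N₂
  have g3 := abs_nonneg N₁
  have g4 := abs_nonneg N₂
  rw [extCoeff_apply, ofMode_apply, h₁ r (by linarith), map_zero, zero_add,
    finsum_eq_zero_of_forall_eq_zero, finsum_eq_zero_of_forall_eq_zero, add_zero]
  · intro j
    rcases lt_or_ge j K with hj | hj
    · refine h₃ j _ ?_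
      have g5 : |N₃ j| ≤ ∑ j ∈ Finset.range K, |N₃ j| :=
        Finset.single_le_sum (f := fun j => |N₃ j|) (fun _ _ => abs_nonneg _)
          (Finset.mem_range.mpr hj)
      have g6 := le_abs_self (N₃ j)
      have g7 : (j : ℝ) ≤ K := by exact_mod_cast hj.le
      simp only [Complex.sub_re, Complex.one_re, Complex.natCast_re]
      linarith
    · have := hK j hj
      simp only [zero_add] at this
      rw [this, map_zero]
  · intro j
    rw [h₂, map_zero]
    have g8 : (0 : ℝ) ≤ j := Nat.cast_nonneg j
    simp only [Complex.add_re, Complex.natCast_re]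
    linarith

/-- The coefficients of the extension of `𝒴` to `P` along a coset of `ℤ`. -/
noncomputable def extField (s : ℂ) (i : ℕ) (x : P) (n : ℤ) : T →ₗ[ℂ] S × T := I.extCoeff (s + n) i x

theorem isTruncated_extField (s : ℂ) (i : ℕ) (x : P) :
    IsTruncated fun n t => I.extField s i x n t := by
  intro t
  obtain ⟨N, hN⟩ := I.exists_extCoeff_eq_zero x t i
  exact IntertwiningOperator.isTruncated_of_re (F := fun r t => I.extCoeff r i x t) s hN

end Primitive

end UnitExtension

/-! ### Associativity and commutator formula for the extended operator -/

namespace UnitExtension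

variable {V : Type u} [AddCommGroup V] [Module ℂ V] [VertexOperatorAlgebra V]
    {R P : Type u} [AddCommGroup R] [Module ℂ R] [VOAModule V R]
    [AddCommGroup P] [Module ℂ P] [VOAModule V P]
    {T S : Type u} [AddCommGroup T] [Module ℂ T] [VOAModule V T]
    [AddCommGroup S] [Module ℂ S] [VOAModule V S]
    {E : UnitExtension V R P} {𝒴 : IntertwiningOperator V R T S} (I : E.Primitive 𝒴)

namespace Primitive

theorem extField_act_generator (s : ℂ) (i : ℕ) {k : ℤ} (hk : 0 ≤ k) (b : V) (n : ℤ) (t : T) :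
    I.extField s i (act k b E.generator) n t =
      LinearMap.inl ℂ S T (𝒴.field s i (E.residue k b) n t) :=
  I.extCoeff_act_generator _ i hk b t

theorem extField_incl (s : ℂ) (i : ℕ) (y : R) (n : ℤ) (t : T) :
    I.extField s i (E.incl y) n t = LinearMap.inl ℂ S T (𝒴.field s i y n t) :=
  I.extCoeff_incl _ i y t

theorem fieldBracket_field (s : ℂ) (i : ℕ) (n : ℤ) (b : V) (r : ℤ) (t : T) :
    fieldBracket (fun n => E.extAct 𝒴 n b) (fun n => act n b) (-1) n (fun n x => I.field s i n x)
      r t = ∑ᶠ j : ℕ, intChoose n j • I.extField s i (act (-1 + j) b E.generator) (r + n - j) t := by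
  obtain ⟨N, hN⟩ := VOAModule.truncation b E.generator
  have h := fieldBracket_eq (aM := fun n => E.extAct 𝒴 n b) (φ := fun n x => I.field s i n x)
    (VOAModule.isTruncated_act (M := T) b) (I.isTruncated_field s i)
    (fun n => map_zero _) (N := max N 0)
    -- The Jacobi identity at l = -1 involves only the indices -1 + j, for which the field of b_k p
    -- is available. Below -1 the product itself is used, making that hypothesis true by definition.
    (ψ := fun k n x => if k < -1 then
        fieldAct (fun n => E.extAct 𝒴 n b) (fun n => act n b) k (fun n x => I.field s i n x) n x
      else I.extField s i (act k b E.generator) n x)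
    (fun k hk => by
      funext n x
      rw [if_neg (by omega), hN k (by omega), extField, map_zero]
      rfl)
    (fun m r t => by
      rw [I.field_commutator]
      refine finsum_congr fun q => ?_
      rw [if_neg (by omega), I.extField_act_generator s i (Int.natCast_nonneg q)])
    (fun l hl r t => by
      split_ifs with h
      · rfl
      · obtain rfl : l = -1 := by omega
        rw [fieldAct_field, extField, extCoeff_mode]) (-1) n r t
  rw [h]
  refine finsum_congr fun j => ?_
  rw [if_neg (by omega)]

/-- The composite formula with l = -1 and outer index 0 expresses the field of (a_m b)_{-1} p. Its
term q = 0 is the product of a with 𝒴(b_{-1} p, z), which is wanted; the others cancel against the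
R-component of a_m b_{-1} p given by `retract_act_neg_one`. -/
theorem extField_act_act_neg_one (s : ℂ) (i : ℕ) (m : ℤ) (a b : V) (r : ℤ) (t : T) :
    I.extField s i (act m a (act (-1) b E.generator)) r t =
      fieldAct (fun n => E.extAct 𝒴 n a) (fun n => act n a) m
        (fun n x => I.extField s i (act (-1) b E.generator) n x) r t := by
  obtain ⟨N₁, hN₁⟩ := E.exists_residue_eq_zero a
  obtain ⟨N₂, hN₂⟩ := E.exists_residue_eq_zero b
  obtain ⟨N₃, hN₃⟩ := (VOAModule.isTruncated_act b).exists_add E.generator (-1)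
  let N := N₁ + N₂ + N₃
  have ha : ∀ k : ℤ, N ≤ k → E.residue k a = 0 := fun k hk => hN₁ k (by omega)
  have hb : ∀ k : ℤ, N ≤ k → E.residue k b = 0 := fun k hk => hN₂ k (by omega)
  have hc : ∀ k : ℕ, N ≤ k → act (-1 + k) b E.generator = 0 := fun k hk => hN₃ k (by omega)
  -- The fields `ψ q` belong to b_{q-1} p and start one index below the residues, hence N + 1.
  have h := finsum_smul_modeProd_sub_eq (l := -1) (N := N + 1)
    (φ := I.field s i)
    (E.isTruncated_extAct 𝒴 a) (E.isTruncated_extAct 𝒴 b)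
    (VOAModule.isTruncated_act (M := T) a) (VOAModule.isTruncated_act (M := T) b)
    (I.isTruncated_field s i)
    (χ := fun q n t => LinearMap.inl ℂ S T (𝒴.field s i (E.residue q a) n t))
    (ψ := fun q n t => I.extField s i (act (-1 + q) b E.generator) n t)
    (fun q => isTruncated_inl_field s i _) (fun q n => by simp)
    (fun q => I.isTruncated_extField s i _) (fun q n => map_zero _)
    (fun m r t => I.field_commutator_eq_sum (fun k hk => ha k (by push_cast at hk; omega)) s i m r t)
    (fun m r t => by
      rw [I.fieldBracket_field, finsum_eq_sum_range]
      intro j hj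
      rw [hc j (by omega), extField, map_zero, LinearMap.zero_apply, smul_zero]) m 0 r t
  have e1 : ∀ (q : ℕ) (F : ℕ × ℕ → S × T),
      ∑ x ∈ Finset.HasAntidiagonal.antidiagonal q,
        (intChoose 0 x.1 * ((-1 : ℂ) ^ x.2 * intChoose m x.2)) • F x =
        ((-1 : ℂ) ^ q * intChoose m q) • F (0, q) := by
    intro q F
    rw [Finset.sum_eq_single (0, q)]
    · rw [intChoose.zero_right, one_mul]
    · rintro ⟨x, y⟩ hx hne
      have := Finset.HasAntidiagonal.mem_antidiagonal.mp hx
      have hx0 : x ≠ 0 := by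
        rintro rfl
        exact hne (by simpa using this)
      simp only [intChoose.zero_left hx0, zero_mul, zero_smul]
    · intro hx
      exact absurd (Finset.HasAntidiagonal.mem_antidiagonal.mpr (zero_add q)) hx
  have e2 : ∑ᶠ j : ℕ, ((-1 : ℂ) ^ j * intChoose (-1) j) •
      modeProd (fun n => E.extAct 𝒴 n a) (fun n => E.extAct 𝒴 n b) m (0 + -1 - j)
        (I.field s i (r + j) t) - ∑ᶠ j : ℕ, ((-1 : ℂ) ^ (-1 + j : ℤ) * intChoose (-1) j) •
      I.field s i (-1 + r - j)
        (modeProd (fun n => act n a) (fun n => act n b) m (0 + j) t) =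
      I.ofMode (s + r) i (mode m a b) t := by
    rw [← fieldAct_field, fieldAct, fieldBracket]
    congr 1
    · refine finsum_congr fun j => ?_
      simp only [field, I.modeProd_lift]
    · refine finsum_congr fun j => ?_
      rw [VOAModule.act_mode]
  rw [e2] at h
  simp only [e1] at h
  rw [Finset.sum_range_succ', Finset.sum_range_succ, ha N le_rfl] at h
  have e3 : ∀ j : ℕ, (fun n (t : T) => I.extField s i (act (-1 + (j + 1 : ℕ)) b E.generator) n t) =
      fun n t => LinearMap.inl ℂ S T (𝒴.field s i (E.residue j b) n t) := by
    intro j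
    funext n t
    rw [show (-1 : ℤ) + (j + 1 : ℕ) = j by push_cast; ring,
      I.extField_act_generator s i (Int.natCast_nonneg j)]
  simp only [e3] at h
  have e4 : ∀ (k : ℤ) (b : V) (y : R), fieldBracket (fun n => E.extAct 𝒴 n b) (fun n => act n b) k 0
      (fun n x => LinearMap.inl ℂ S T (𝒴.field s i y n x)) r t =
      LinearMap.inl ℂ S T (𝒴.field s i (act k b y) r t) := fun k b y => fieldAct_inl s i k b y r t
  simp only [fieldAct, Nat.cast_zero, sub_zero, add_zero, e4, map_zero] at h
  have e5 : ∀ n : ℤ, 𝒴.field s i 0 n t = 0 := fun n => by simp [IntertwiningOperator.field]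
  have e6 : ∀ q : ℕ, (-1 : ℤ) + m - q = m - 1 - q := fun q => by ring
  simp only [pow_zero, intChoose.zero_right, mul_one, one_smul, e5, map_zero, smul_zero, add_zero,
    e6] at h
  rw [extField, extCoeff_apply, E.proj_act, E.proj_act, E.proj_generator,
    (VertexOperatorAlgebra.creation b).1, h, E.retract_act_neg_one,
    finsum_eq_sum_range (N := N) fun j hj => by rw [ha j (by omega), map_zero, smul_zero],
    finsum_eq_sum_range (N := N) fun j hj => by rw [hb j (by omega), map_zero, smul_zero]]
  simp only [map_sub, map_sum, map_smul, LinearMap.sub_apply, LinearMap.sum_apply,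
    LinearMap.smul_apply, IntertwiningOperator.field, fieldAct]
  abel

theorem extField_act (s : ℂ) (i : ℕ) (m : ℤ) (a : V) (x : P) (r : ℤ) (t : T) :
    I.extField s i (act m a x) r t =
      fieldAct (fun n => E.extAct 𝒴 n a) (fun n => act n a) m (fun n t => I.extField s i x n t)
        r t := by
  have hadd : ∀ (x y : P) n t,
      I.extField s i (x + y) n t = I.extField s i x n t + I.extField s i y n t := fun x y n t => by
    simp only [extField, map_add, LinearMap.add_apply]
  obtain ⟨y, b, rfl⟩ : ∃ y b, x = E.incl y + act (-1) b E.generator := ⟨_, _, eq_incl_add x⟩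
  rw [map_add, hadd, ← E.incl_act, extField_incl, I.extField_act_act_neg_one,
    ← fieldAct_inl (E := E) (𝒴 := 𝒴) s i m a y]
  simp only [hadd, extField_incl]
  exact (fieldBracket_add_field (VOAModule.isTruncated_act (M := T) a)
    (isTruncated_inl_field s i _) (fun n => by simp)
    (I.isTruncated_extField s i _) (fun n => map_zero _) m 0 r t).symm

/-- By the Leibniz rule, [a_m, ·] on the normally ordered product of b with 𝒴(p, z) has two parts: b
against [a_m, 𝒴(p, z)], and [a_m, b] against 𝒴(p, z). They match a_j b_{-1} p = b_{-1} a_j p + [a_j,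
b_{-1}] p. -/
theorem extCoeff_commutator_act_neg_one (m : ℤ) (r : ℂ) (i : ℕ) (a b : V) (t : T) :
    E.extAct 𝒴 m a (I.ofMode r i b t) - I.ofMode r i b (act m a t) =
      ∑ᶠ j : ℕ, intChoose m j •
        I.extCoeff (m + r - j) i (act (j : ℤ) a (act (-1) b E.generator)) t := by
  obtain ⟨N, ha⟩ := E.exists_residue_eq_zero a
  obtain ⟨L, hL⟩ := (VOAModule.isTruncated_act (M := V) a).exists_add b 0
  simp only [zero_add] at hL
  have hL' : ∀ l : ℕ, L ≤ l → mode (l : ℤ) a b = 0 := hL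
  -- The commutator of a_m with the modes of b is needed on S × T as well as on T.
  let _ := I.extModule
  have hbr : ∀ (M : Type u) [AddCommGroup M] [Module ℂ M] [VOAModule V M] (n : ℤ) (x : M),
      (∑ l ∈ Finset.range L, intChoose m l • act (m + n - l) (mode l a b)) x =
        act m a (act n b x) - act n b (act m a x) := by
    intro M _ _ _ n x
    rw [VOAModule.commutativity, LinearMap.sum_apply, finsum_eq_sum_range (N := L)]
    · simp only [LinearMap.smul_apply]
    · intro l hl
      rw [hL' l hl, map_zero, LinearMap.zero_apply, smul_zero]
  have hz : I.ofMode r i b = I.ofMode (r + (0 : ℤ)) i b := by simp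
  have h := fieldBracket_leibniz (φ := I.field r i) (aM := fun n => E.extAct 𝒴 n b)
    (aT := fun n => act n b) (fM := E.extAct 𝒴 m a) (fT := act m a)
    (cM := fun n => ∑ l ∈ Finset.range L, intChoose m l • E.extAct 𝒴 (m + n - l) (mode l a b))
    (cT := fun n => ∑ l ∈ Finset.range L, intChoose m l • act (m + n - l) (mode l a b))
    (VOAModule.isTruncated_act (M := T) b) (fun x => by
      choose f hf using fun l : ℕ => VOAModule.truncation (mode l a b) x
      refine ⟨∑ l ∈ Finset.range L, |f l| + L - m, fun n hn => ?_⟩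
      simp only [LinearMap.sum_apply, LinearMap.smul_apply]
      refine Finset.sum_eq_zero fun l hl => ?_
      have h1 : |f l| ≤ ∑ l ∈ Finset.range L, |f l| :=
        Finset.single_le_sum (f := fun l => |f l|) (fun _ _ => abs_nonneg _) hl
      have h2 := le_abs_self (f l)
      have h3 := Finset.mem_range.mp hl
      rw [hf l _ (by omega), smul_zero]) (I.isTruncated_field r i)
    (fun n x => hbr (S × T) n x) (fun n x => hbr T n x) (-1) 0 0 t
  have e1 : ∀ n x, E.extAct 𝒴 m a (I.field r i n x) - I.field r i n (act m a x) =
      ∑ q ∈ Finset.range N, intChoose m q •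
        LinearMap.inl ℂ S T (𝒴.field r i (E.residue q a) (n + (m - q)) x) := by
    intro n x
    rw [← fieldBracket_zero_left (aM := fun n => E.extAct 𝒴 n a) (aT := fun n => act n a)
      (φ := fun n x => I.field r i n x) m n x, I.field_commutator_eq_sum ha]
    simp only [add_sub_assoc]
  have e2 : ∀ l : ℕ, fieldBracket (fun n => E.extAct 𝒴 (m + n - l) (mode l a b))
      (fun n => act (m + n - l) (mode l a b)) (-1) 0 (fun n x => I.field r i n x) 0 t =
      ∑ᶠ j : ℕ, intChoose (m - l) j •
        I.extCoeff (m + r - (l + j : ℕ)) i (act (-1 + j) (mode l a b) E.generator) t := by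
    intro l
    have h1 := fieldBracket_shift_modes (aM := fun n => E.extAct 𝒴 n (mode l a b))
      (aT := fun n => act n (mode l a b)) (-1) 0 (m - l) (fun n x => I.field r i n x) 0 t
    have h2 : ∀ n : ℤ, n + (m - l) = m + n - l := fun n => by ring
    simp only [h2] at h1
    rw [h1, I.fieldBracket_field]
    refine finsum_congr fun j => ?_
    rw [extField, show r + ((0 + (m + 0 - l) - j : ℤ) : ℂ) = m + r - (l + j : ℕ) by push_cast; ring]
    simp only [add_zero]
  have e3 : fieldBracket (fun n => E.extAct 𝒴 n b) (fun n => act n b) (-1) 0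
      (fun n x => ∑ q ∈ Finset.range N, intChoose m q •
        LinearMap.inl ℂ S T (𝒴.field r i (E.residue q a) (n + (m - q)) x)) 0 t =
      ∑ q ∈ Finset.range N, intChoose m q • LinearMap.inl ℂ S T
        (𝒴.coeff (m + r - q) i (act (-1) b (E.residue q a)) t) := by
    rw [fieldBracket_sum_field (φ := fun (q : ℕ) n x =>
      LinearMap.inl ℂ S T (𝒴.field r i (E.residue q a) (n + (m - q)) x)) _ _
      (VOAModule.isTruncated_act (M := T) b)]
    · refine Finset.sum_congr rfl fun q _ => ?_
      rw [fieldBracket_shift_field (φ := fun n x =>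
        LinearMap.inl ℂ S T (𝒴.field r i (E.residue q a) n x))]
      have := fieldAct_inl (E := E) (𝒴 := 𝒴) r i (-1) b (E.residue q a) (0 + (m - q)) t
      rw [fieldAct] at this
      rw [this, IntertwiningOperator.field]
      congr 5
      push_cast; ring
    · intro q x
      obtain ⟨K, hK⟩ := isTruncated_inl_field (S := S) (𝒴 := 𝒴) r i (E.residue q a) x
      exact ⟨K - (m - q), fun n hn => hK _ (by omega)⟩
    · intro q n
      simp
  have e4 := fieldBracket_sum_modes (Finset.range L) (fun l => intChoose m l)
    (dM := fun l n => E.extAct 𝒴 (m + n - l) (mode l a b))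
    (dT := fun l n => act (m + n - l) (mode l a b)) (φ := I.field r i)
    (fun l x => by
      obtain ⟨K, hK⟩ := VOAModule.truncation (mode l a b) x
      exact ⟨K + l - m, fun n hn => hK _ (by omega)⟩) (I.isTruncated_field r i) (-1) 0 0 t
  have e5 := I.fieldAct_field r i b 0
  rw [fieldAct] at e5
  simp only [e1, e5, e3] at h
  rw [hz, h, e4]
  simp only [e2]
  let g : ℕ → ℕ → S × T := fun l q =>
    I.extCoeff (m + r - q) i (act (q - 1 - l) (mode l a b) E.generator) t
  have hg : ∀ l, (g l).HasFiniteSupport := fun l => by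
    obtain ⟨K, hK⟩ := (VOAModule.isTruncated_act (mode l a b)).exists_add E.generator (-1 - l)
    exact hasFiniteSupport_of_eventually (N := K) fun q hq => by
      have := hK q hq
      simp only [g]
      rw [show (q : ℤ) - 1 - l = -1 - l + q by ring, this, map_zero, LinearMap.zero_apply]
  have e6 : ∀ q : ℕ, I.extCoeff (m + r - q) i (act (q : ℤ) a (act (-1) b E.generator)) t =
      LinearMap.inl ℂ S T (𝒴.coeff (m + r - q) i (act (-1) b (E.residue q a)) t) +
      ∑ l ∈ Finset.range L, intChoose q l • g l q := by
    intro q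
    have := VOAModule.commutativity q (-1) a b E.generator
    rw [finsum_eq_sum_range (N := L) fun l hl => by
      rw [hL' l hl, map_zero, LinearMap.zero_apply, smul_zero], ← E.incl_residue (k := (q : ℤ)) (Int.natCast_nonneg q) a,
      ← E.incl_act, sub_eq_iff_eq_add'] at this
    rw [this, map_add, LinearMap.add_apply, extCoeff_incl]
    simp only [map_sum, LinearMap.sum_apply, map_smul, LinearMap.smul_apply, g,
      ← sub_eq_add_neg]
  simp only [e6, smul_add, Finset.smul_sum]
  rw [finsum_add_distrib]
  · congr 1
    · refine (finsum_eq_sum_range fun q hq => ?_).symm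
      rw [ha q (by omega)]
      simp
    · rw [← sum_finsum_comm]
      · refine Finset.sum_congr rfl fun l _ => ?_
        -- With q = l + j, the identity C(m, q) C(q, l) = C(m, l) C(m-l, j) matches the two sums;
        -- terms with q < l vanish.
        refine Eq.trans ?_
          (finsum_add_shift (fun q : ℕ => intChoose m q • intChoose q l • g l q) l
            (HasFiniteSupport.smul_fun (HasFiniteSupport.smul_fun (hg l) _) _) ?_)
        · rw [smul_finsum]
          refine finsum_congr fun j => ?_
          rw [smul_smul, smul_smul, intChoose.natCast, intChoose.mul_revision]
          simp only [g]
          rw [show ((l + j : ℕ) : ℤ) - 1 - l = -1 + j by push_cast; ring]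
        · intro q hq
          rw [intChoose.natCast, Nat.choose_eq_zero_of_lt hq, Nat.cast_zero, zero_smul, smul_zero]
      · intro l _
        exact HasFiniteSupport.smul_fun (HasFiniteSupport.smul_fun (hg l) _) _
  · exact hasFiniteSupport_of_eventually (N := N) fun q hq => by
      rw [ha q (by omega)]
      simp
  · exact Function.HasFiniteSupport.sum (fun l =>
      HasFiniteSupport.smul_fun (HasFiniteSupport.smul_fun (hg l) fun q : ℕ => intChoose q l)
        fun q : ℕ => intChoose m q) _

end Primitive

end UnitExtension

/-! ### Derivative property, assembly, and injectivity -/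

namespace UnitExtension

variable {V : Type u} [AddCommGroup V] [Module ℂ V] [VertexOperatorAlgebra V]
    {R P : Type u} [AddCommGroup R] [Module ℂ R] [VOAModule V R]
    [AddCommGroup P] [Module ℂ P] [VOAModule V P]
    {T S : Type u} [AddCommGroup T] [Module ℂ T] [VOAModule V T]
    [AddCommGroup S] [Module ℂ S] [VOAModule V S]
    {E : UnitExtension V R P} {𝒴 : IntertwiningOperator V R T S} (I : E.Primitive 𝒴)

namespace Primitive

theorem lift_derivative (r : ℂ) (i : ℕ) (t : T) :
    LinearMap.inl ℂ S T (𝒴.coeff r i (E.residue 0 omega) t) =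
      -(r • I.lift (r - 1) i t) + ((i : ℂ) + 1) • I.lift (r - 1) (i + 1) t := by
  rw [I.derivative, lift_apply, lift_apply, if_neg (by omega : ¬(r - 1 = -1 ∧ i + 1 = 0))]
  ext
  · simp
  · simp +contextual

/-- The left side is the operator of L(-1)b_{-1} p = b_{-1} L(-1)p + (L(-1)b)_{-1} p.
Differentiating 𝒴(p, z) inside the normally ordered product gives coefficients depending on j; the
shift (L(-1)b)_n = -n b_{n-1} cancels that dependence, leaving the uniform factor -r. -/
theorem ofMode_derivative (r : ℂ) (i : ℕ) (b : V) (t : T) :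
    LinearMap.inl ℂ S T (𝒴.coeff r i (act (-1) b (E.residue 0 omega)) t) +
        I.ofMode r i (mode 0 omega b) t =
      -(r • I.ofMode (r - 1) i b t) + ((i : ℂ) + 1) • I.ofMode (r - 1) (i + 1) b t := by
  let A : ℕ → ℕ → S × T := fun i j => E.extAct 𝒴 (-1 - j) b (I.lift (r - 1 + j) i t)
  let B : ℕ → ℕ → S × T := fun i j => I.lift (r - 1 - 1 - j) i (act (j : ℤ) b t)
  have hA : ∀ i, (A i).HasFiniteSupport := fun i => I.hasFiniteSupport_lift_left _ b (r - 1) i t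
  have hB : ∀ i, (B i).HasFiniteSupport := fun i => I.hasFiniteSupport_lift_right _ b i t
  have h1 : LinearMap.inl ℂ S T (𝒴.coeff r i (act (-1) b (E.residue 0 omega)) t) =
      ∑ᶠ j : ℕ, (-((r + j) • A i j) + ((i : ℂ) + 1) • A (i + 1) j) +
      ∑ᶠ j : ℕ, (-((r - 1 - j) • B i j) + ((i : ℂ) + 1) • B (i + 1) j) := by
    have h := fieldAct_inl (E := E) (𝒴 := 𝒴) r i (-1) b (E.residue 0 omega) 0 t
    rw [fieldAct_neg_one] at h
    simp only [IntertwiningOperator.field, Int.cast_zero, add_zero, zero_add] at h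
    rw [← h]
    congr 1
    · refine finsum_congr fun j => ?_
      rw [I.lift_derivative]
      simp only [A, map_add, map_neg, map_smul]
      push_cast
      rw [show r + (j : ℂ) - 1 = r - 1 + j by ring]
    · refine finsum_congr fun j => ?_
      rw [I.lift_derivative]
      simp only [B]
      push_cast
      rw [show r + (-1 - (j : ℂ)) = r - 1 - j by ring, show r - 1 - (j : ℂ) - 1 = r - 1 - 1 - j by ring]
  have h2 : I.ofMode r i (mode 0 omega b) t =
      ∑ᶠ j : ℕ, (j : ℂ) • A i j + ∑ᶠ j : ℕ, -(((j : ℂ) + 1) • B i j) := by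
    rw [ofMode_apply]
    congr 1
    · rw [← finsum_add_shift (fun j : ℕ => (j : ℂ) • A i j) 1 (HasFiniteSupport.smul_fun (hA i) _)]
      · refine finsum_congr fun j => ?_
        have := I.extModule.derivative (-1 - j) b (I.lift (r + j) i t)
        refine this.trans ?_
        simp only [A]
        rw [← neg_smul]
        push_cast
        rw [show -1 - (j : ℤ) - 1 = -1 - (1 + j) by ring, show r - 1 + (1 + (j : ℂ)) = r + j by ring,
          show -(-1 - (j : ℂ)) = 1 + j by ring]
        rfl
      · intro n hn
        obtain rfl : n = 0 := by omega
        simp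
    · rw [← finsum_add_shift _ 1 (I.hasFiniteSupport_lift_right _ _ _ _)]
      · refine finsum_congr fun j => ?_
        rw [VOAModule.derivative, map_neg, map_smul]
        simp only [B]
        push_cast
        rw [show (1 : ℤ) + j - 1 = j by ring, show r - 1 - (1 + (j : ℂ)) = r - 1 - 1 - j by ring,
          add_comm (1 : ℂ)]
      · intro n hn
        obtain rfl : n = 0 := by omega
        rw [VOAModule.derivative]
        simp
  have h3 : ∀ i, I.ofMode (r - 1) i b t = ∑ᶠ j : ℕ, A i j + ∑ᶠ j : ℕ, B i j := fun i => rfl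
  have sA : ∀ (c : ℕ → ℂ) (i : ℕ), (fun j => c j • A i j).HasFiniteSupport := fun c i =>
    HasFiniteSupport.smul_fun (hA i) c
  have sB : ∀ (c : ℕ → ℂ) (i : ℕ), (fun j => c j • B i j).HasFiniteSupport := fun c i =>
    HasFiniteSupport.smul_fun (hB i) c
  rw [h1, h2, h3, h3, add_add_add_comm, smul_add, smul_add]
  simp only [smul_finsum, ← neg_smul]
  rw [← finsum_add_distrib, ← finsum_add_distrib, neg_add, add_add_add_comm]
  · congr 1
    · rw [← finsum_neg_distrib, ← finsum_add_distrib]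
      · exact finsum_congr fun j => by module
      · simpa only [← neg_smul] using sA (fun _ => -r) i
      · exact sA (fun _ => (i : ℂ) + 1) (i + 1)
    · rw [← finsum_neg_distrib, ← finsum_add_distrib]
      · exact finsum_congr fun j => by module
      · simpa only [← neg_smul] using sB (fun _ => -r) i
      · exact sB (fun _ => (i : ℂ) + 1) (i + 1)
  · exact Function.HasFiniteSupport.add (sB _ i) (sB (fun _ => (i : ℂ) + 1) (i + 1))
  · exact sB _ i
  · exact Function.HasFiniteSupport.add (sA _ i) (sA (fun _ => (i : ℂ) + 1) (i + 1))
  · exact sA _ i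

theorem extCoeff_derivative (r : ℂ) (i : ℕ) (x : P) (t : T) :
    I.extCoeff r i (act 0 (omega : V) x) t =
      -(r • I.extCoeff (r - 1) i x t) + ((i : ℂ) + 1) • I.extCoeff (r - 1) (i + 1) x t := by
  obtain ⟨y, b, rfl⟩ : ∃ y b, x = E.incl y + act (-1) b E.generator := ⟨_, _, eq_incl_add x⟩
  have h1 : act 0 (omega : V) (act (-1) b E.generator) =
      E.incl (act (-1) b (E.residue 0 omega)) + act (-1) (mode 0 omega b) E.generator := by
    rw [VOAModule.act_zero_omega_commute, VOAModule.derivative, E.incl_act,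
      E.incl_residue le_rfl, sub_eq_add_neg]
  simp only [map_add, LinearMap.add_apply, h1, ← E.incl_act, extCoeff_incl, extCoeff_mode]
  rw [I.ofMode_derivative, 𝒴.derivative]
  simp only [map_add, map_neg, map_smul]
  module

theorem extCoeff_commutator (m : ℤ) (r : ℂ) (i : ℕ) (a : V) (x : P) (t : T) :
    E.extAct 𝒴 m a (I.extCoeff r i x t) - I.extCoeff r i x (act m a t) =
      ∑ᶠ j : ℕ, intChoose m j • I.extCoeff (m + r - j) i (act (j : ℤ) a x) t := by
  obtain ⟨y, b, rfl⟩ : ∃ y b, x = E.incl y + act (-1) b E.generator := ⟨_, _, eq_incl_add x⟩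
  have hfs : ∀ z : P, (fun j : ℕ => intChoose m j •
      I.extCoeff (m + r - j) i (act (j : ℤ) a z) t).HasFiniteSupport := fun z => by
    simpa only [zero_add] using VOAModule.mode_hasFiniteSupport a z 0
      (fun j x => intChoose m j • I.extCoeff (m + r - j) i x t) fun j => by simp
  have h := congrArg (LinearMap.inl ℂ S T) (𝒴.commutativity m r i a y t)
  rw [← finsum_smul_map LinearMap.inl_injective, map_sub] at h
  simp only [map_add, LinearMap.add_apply, smul_add]
  rw [finsum_add_distrib (hfs _) (hfs _), ← I.extCoeff_commutator_act_neg_one]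
  simp only [← E.incl_act, extCoeff_incl, extCoeff_mode, extAct_inl]
  rw [← h]
  abel

theorem extCoeff_log_bounded (x : P) : ∃ k : ℕ, ∀ i, k < i → ∀ r, I.extCoeff r i x = 0 := by
  obtain ⟨k₁, h₁⟩ := 𝒴.log_bounded (E.retract x)
  obtain ⟨k₂, h₂⟩ := I.log_bounded
  have h₃ : ∀ i, k₂ < i → ∀ r t, I.lift r i t = 0 := fun i hi r t => by
    rw [lift_apply, h₂ i hi, if_neg (by omega)]
    rfl
  refine ⟨k₁ + k₂, fun i hi r => LinearMap.ext fun t => ?_⟩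
  rw [extCoeff_apply, h₁ i (by omega), ofMode_apply]
  simp [h₃ i (by omega)]

theorem extCoeff_associativity (m : ℤ) (r : ℂ) (i : ℕ) (a : V) (x : P) (t : T) :
    I.extCoeff r i (act m a x) t =
      ∑ᶠ j : ℕ, ((-1 : ℂ) ^ j * intChoose m j) • E.extAct 𝒴 (m - j) a (I.extCoeff (r + j) i x t) -
      ∑ᶠ j : ℕ, ((-1 : ℂ) ^ (m + j) * intChoose m j) •
        I.extCoeff (m + r - j) i x (act (j : ℤ) a t) := by
  have h := I.extField_act r i m a x 0 t
  simp only [extField, fieldAct, fieldBracket, Int.cast_zero, add_zero, zero_add] at h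
  rw [h]
  congr 1
  refine finsum_congr fun j => ?_
  rw [show r + ((m - j : ℤ) : ℂ) = m + r - j by push_cast; ring]

/-- The extension of `𝒴` to `P`, with values in the extension of `T` by `S`. -/
noncomputable def extIntertwining :
    @IntertwiningOperator V _ _ _ P T (S × T) _ _ _ _ _ _ _ _ I.extModule :=
  let _ := I.extModule
  { coeff := I.extCoeff
    log_bounded := I.extCoeff_log_bounded
    truncation := fun x t i => I.exists_extCoeff_eq_zero x t i
    derivative := I.extCoeff_derivative
    commutativity := I.extCoeff_commutator
    associativity := I.extCoeff_associativity }

theorem isFinGen_extModule (hS : IsFinGen V S) (hT : IsFinGen V T) :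
    @IsFinGen V _ _ _ (S × T) _ _ I.extModule := by
  let _ := I.extModule
  obtain ⟨G, hG, hG'⟩ := hS
  obtain ⟨H, hH, hH'⟩ := hT
  refine ⟨LinearMap.inl ℂ S T '' G ∪ LinearMap.inr ℂ S T '' H,
    (hG.image _).union (hH.image _), fun N hN hsub => ?_⟩
  rw [Set.union_subset_iff, Set.image_subset_iff, Set.image_subset_iff] at hsub
  have h1 : N.comap (LinearMap.inl ℂ S T) = ⊤ := by
    refine hG' _ (fun n a x hx => ?_) hsub.1
    rw [Submodule.mem_comap] at hx ⊢
    rw [← E.extAct_inl]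
    exact hN n a _ hx
  have h1' : ∀ s : S, LinearMap.inl ℂ S T s ∈ N := fun s => by
    have : s ∈ N.comap (LinearMap.inl ℂ S T) := h1 ▸ Submodule.mem_top
    exact this
  have h2 : N.comap (LinearMap.inr ℂ S T) = ⊤ := by
    refine hH' _ (fun n a x hx => ?_) hsub.2
    rw [Submodule.mem_comap] at hx ⊢
    have := N.sub_mem (hN n a _ hx) (h1' (E.cocycle 𝒴 n a x))
    have e : act n a (LinearMap.inr ℂ S T x) - LinearMap.inl ℂ S T (E.cocycle 𝒴 n a x) =
        LinearMap.inr ℂ S T (act n a x) := by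
      change E.extAct 𝒴 n a _ - _ = _
      rw [extAct_apply]
      ext <;> simp
    rwa [e] at this
  refine eq_top_iff.mpr fun x _ => ?_
  have h3 : x.2 ∈ N.comap (LinearMap.inr ℂ S T) := h2 ▸ Submodule.mem_top
  have h4 := N.add_mem (h1' x.1) h3
  have e : LinearMap.inl ℂ S T x.1 + LinearMap.inr ℂ S T x.2 = x := by ext <;> simp
  rwa [e] at h4

theorem extIntertwining_isSurjective (h𝒴 : 𝒴.IsSurjective) :
    @IntertwiningOperator.IsSurjective V _ _ _ P T (S × T) _ _ _ _ _ _ _ _ I.extModule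
      I.extIntertwining := by
  let _ := I.extModule
  rw [IntertwiningOperator.IsSurjective] at h𝒴 ⊢
  set N := Submodule.span ℂ {x : S × T | ∃ r i w u, I.extIntertwining.coeff r i w u = x}
  have h1 : N.comap (LinearMap.inl ℂ S T) = ⊤ := by
    rw [eq_top_iff, ← h𝒴, Submodule.span_le]
    rintro _ ⟨r, i, w, u, rfl⟩
    exact Submodule.subset_span ⟨r, i, E.incl w, u, I.extCoeff_incl r i w u⟩
  refine eq_top_iff.mpr fun x _ => ?_
  have h3 : x.1 ∈ N.comap (LinearMap.inl ℂ S T) := h1 ▸ Submodule.mem_top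
  have h4 : I.lift (-1) 0 x.2 ∈ N :=
    Submodule.subset_span ⟨-1, 0, E.generator, x.2, I.extCoeff_generator _ _ _⟩
  have h5 := N.add_mem h3 h4
  have e : LinearMap.inl ℂ S T x.1 + I.lift (-1) 0 x.2 = x := by
    rw [I.lift_constant]
    ext <;> simp
  rwa [e] at h5

end Primitive

/-- The universal property of P ⊠ T, applied to the extended operator, yields f. On the spanning
coefficients f ∘ F is the inclusion of S into S × T. -/
theorem injective_inducedMap (E : UnitExtension V R P) {PT : Type u} [AddCommGroup PT]
    [Module ℂ PT] [VOAModule V PT] (hT : IsFinGen V T) (h𝒴 : 𝒴.IsTensorProduct)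
    {𝒴P : IntertwiningOperator V P T PT} (h𝒴P : 𝒴P.IsTensorProduct) {F : S →ₗ[ℂ] PT}
    (hF : IntertwiningOperator.IsInducedMap 𝒴 𝒴P E.incl F) : Function.Injective F := by
  obtain ⟨I⟩ := E.nonempty_primitive 𝒴
  let _ := I.extModule
  obtain ⟨f, -, hf⟩ := h𝒴P.universal (S × T) I.extIntertwining
    (I.isFinGen_extModule h𝒴.finGen hT) (I.extIntertwining_isSurjective h𝒴.surjective)
  have h : f ∘ₗ F = LinearMap.inl ℂ S T := by
    refine LinearMap.ext_on h𝒴.surjective ?_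
    rintro _ ⟨r, i, w, u, rfl⟩
    rw [LinearMap.comp_apply, hF.map_coeff, hf]
    exact I.extCoeff_incl r i w u
  have h' : Function.Injective (f ∘ₗ F) := h ▸ LinearMap.inl_injective
  rw [LinearMap.coe_comp] at h'
  exact h'.of_comp

end UnitExtension

/-! ### Quotient modules and finite generation -/

section Quotient

variable {V : Type u} [AddCommGroup V] [Module ℂ V] [VertexOperatorAlgebra V]
  {M N : Type u} [AddCommGroup M] [Module ℂ M] [VOAModule V M]
  [AddCommGroup N] [Module ℂ N] [VOAModule V N]

theorem VOAModule.nat_mode_hasFiniteSupport {X : Type*} [AddCommGroup X] (a : V) (x : M)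
    (f : ℕ → M → X) (hf : ∀ j, f j 0 = 0) :
    (fun j : ℕ => f j (act (j : ℤ) a x)).HasFiniteSupport := by
  simpa only [zero_add] using VOAModule.mode_hasFiniteSupport a x 0 f hf

theorem LinearMap.map_finsum_smul {X Y : Type*} [AddCommGroup X] [Module ℂ X] [AddCommGroup Y]
    [Module ℂ Y] (f : X →ₗ[ℂ] Y) (c : ℕ → ℂ) {g : ℕ → X}
    (hg : (fun j => c j • g j).HasFiniteSupport) :
    f (∑ᶠ j, c j • g j) = ∑ᶠ j, c j • f (g j) := by
  rw [map_finsum f hg]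
  exact finsum_congr fun j => map_smul _ _ _

theorem VOAModule.IsHom.isStable_range {f : M →ₗ[ℂ] N} (hf : IsHom V f) :
    IsStable V (LinearMap.range f) := by
  rintro n a _ ⟨x, rfl⟩
  exact ⟨act n a x, hf n a x⟩

theorem VOAModule.IsFinGen.of_surjective {f : M →ₗ[ℂ] N} (hf : IsHom V f)
    (hsurj : Function.Surjective f) (hM : IsFinGen V M) : IsFinGen V N := by
  obtain ⟨G, hG, hG'⟩ := hM
  refine ⟨f '' G, hG.image _, fun L hL hsub => ?_⟩
  have h : L.comap f = ⊤ := hG' _ (fun n a x hx => by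
    rw [Submodule.mem_comap] at hx ⊢
    rw [hf]
    exact hL n a _ hx) fun x hx => hsub ⟨x, hx, rfl⟩
  refine eq_top_iff.mpr fun y _ => ?_
  obtain ⟨x, rfl⟩ := hsurj y
  exact (h ▸ Submodule.mem_top : x ∈ L.comap f)

/-- The quotient of a `V`-module by a submodule. -/
noncomputable abbrev VOAModule.quotient (L : Submodule ℂ M) (hL : IsStable V L) :
    VOAModule V (M ⧸ L) where
  act n :=
    { toFun a := L.mapQ L (act n a) fun x hx => hL n a x hx
      map_add' a b := by
        ext x
        simp
      map_smul' c a := by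
        ext x
        simp }
  truncation a x := by
    obtain ⟨x, rfl⟩ := L.mkQ_surjective x
    obtain ⟨K, hK⟩ := VOAModule.truncation a x
    exact ⟨K, fun n hn => congrArg L.mkQ (hK n hn)⟩
  vacuum_act n x := by
    obtain ⟨x, rfl⟩ := L.mkQ_surjective x
    refine (congrArg L.mkQ (VOAModule.vacuum_act n x)).trans ?_
    split_ifs <;> simp
  derivative n a x := by
    obtain ⟨x, rfl⟩ := L.mkQ_surjective x
    refine (congrArg L.mkQ (VOAModule.derivative n a x)).trans ?_
    rw [map_neg, map_smul]
    rfl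
  commutativity m n a b x := by
    obtain ⟨x, rfl⟩ := L.mkQ_surjective x
    have h := congrArg L.mkQ (VOAModule.commutativity m n a b x)
    have hfs : (fun i : ℕ => ((Ring.choose m i : ℤ) : ℂ) •
        act (m + n - i) (mode i a b) x).HasFiniteSupport :=
      VOAModule.nat_mode_hasFiniteSupport a b
        (fun i y => ((Ring.choose m i : ℤ) : ℂ) • act (m + n - i) y x) fun i => by simp
    rw [map_sub, LinearMap.map_finsum_smul _ _ hfs] at h
    exact h
  associativity m n a b x := by
    obtain ⟨x, rfl⟩ := L.mkQ_surjective x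
    have h := congrArg L.mkQ (VOAModule.associativity m n a b x)
    rw [map_sub, LinearMap.map_finsum_smul _ _ (VOAModule.mode_hasFiniteSupport b x n
        (fun i y => ((-1 : ℂ) ^ i * ((Ring.choose m i : ℤ) : ℂ)) • act (m - i) a y)
        fun i => by simp),
      LinearMap.map_finsum_smul _ _ (VOAModule.nat_mode_hasFiniteSupport a x
        (fun i y => ((-1 : ℂ) ^ (m + i) * ((Ring.choose m i : ℤ) : ℂ)) • act (m + n - i) b y)
        fun i => by simp)] at h
    exact h

end Quotient

/-! ### Right exactness of the tensor product -/

namespace IntertwiningOperator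

variable {V : Type u} [AddCommGroup V] [Module ℂ V] [VertexOperatorAlgebra V]
    {A B C U : Type u} [AddCommGroup A] [Module ℂ A] [VOAModule V A]
    [AddCommGroup B] [Module ℂ B] [VOAModule V B]
    [AddCommGroup C] [Module ℂ C] [VOAModule V C]
    [AddCommGroup U] [Module ℂ U] [VOAModule V U]

/-- An intertwining operator which vanishes, after composition with a homomorphism `π`, on the
kernel of an epimorphism `ρ` factors through `ρ`. -/
theorem exists_descent {S Q : Type u} [AddCommGroup S] [Module ℂ S] [VOAModule V S]
    [AddCommGroup Q] [Module ℂ Q] [VOAModule V Q] (𝒴 : IntertwiningOperator V B U S)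
    {ρ : B →ₗ[ℂ] C} (hρ : IsHom V ρ) (hsurj : Function.Surjective ρ) {π : S →ₗ[ℂ] Q}
    (hπ : IsHom V π) (h0 : ∀ r i b u, ρ b = 0 → π (𝒴.coeff r i b u) = 0) :
    ∃ 𝒴' : IntertwiningOperator V C U Q,
      ∀ r i b u, 𝒴'.coeff r i (ρ b) u = π (𝒴.coeff r i b u) := by
  -- The section is only linear; the vanishing on `ker ρ` makes the result independent of it, so
  -- every axiom can be checked on elements `ρ b`.
  obtain ⟨σ, hσ⟩ := ρ.exists_rightInverse_of_surjective (LinearMap.range_eq_top.mpr hsurj)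
  let F : ℂ → ℕ → C →ₗ[ℂ] U →ₗ[ℂ] Q := fun r i => (𝒴.coeff r i ∘ₗ σ).compr₂ π
  have hF : ∀ r i b u, F r i (ρ b) u = π (𝒴.coeff r i b u) := by
    intro r i b u
    have h1 : ρ (σ (ρ b) - b) = 0 := by
      rw [map_sub, ← LinearMap.comp_apply ρ σ, hσ, LinearMap.id_apply, sub_self]
    have h2 := h0 r i _ u h1
    rw [map_sub, LinearMap.sub_apply, map_sub, sub_eq_zero] at h2
    exact h2
  have hρ' : ∀ n (a : V) b, act n a (ρ b) = ρ (act n a b) := fun n a b => (hρ n a b).symm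
  have hπ' : ∀ n (a : V) s, act n a (π s) = π (act n a s) := fun n a s => (hπ n a s).symm
  refine ⟨⟨F, ?_, ?_, ?_, ?_, ?_⟩, hF⟩
  · intro c
    obtain ⟨k, hk⟩ := 𝒴.log_bounded (σ c)
    refine ⟨k, fun i hi r => LinearMap.ext fun u => ?_⟩
    simp [F, hk i hi r]
  · intro c u i
    obtain ⟨K, hK⟩ := 𝒴.truncation (σ c) u i
    exact ⟨K, fun r hr => by simp [F, hK r hr]⟩
  · intro r i c u
    obtain ⟨b, rfl⟩ := hsurj c
    rw [hρ', hF, hF, hF, 𝒴.derivative, map_add, map_neg, map_smul, map_smul]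
  · intro m r i a c u
    obtain ⟨b, rfl⟩ := hsurj c
    simp only [hρ', hF, hπ', ← map_sub]
    rw [𝒴.commutativity, LinearMap.map_finsum_smul]
    exact VOAModule.nat_mode_hasFiniteSupport a b
      (fun j x => ((Ring.choose m j : ℤ) : ℂ) • 𝒴.coeff (m + r - j) i x u) fun j => by simp
  · intro m r i a c u
    obtain ⟨b, rfl⟩ := hsurj c
    simp only [hρ', hF, hπ']
    rw [𝒴.associativity, map_sub, LinearMap.map_finsum_smul, LinearMap.map_finsum_smul]
    · exact VOAModule.nat_mode_hasFiniteSupport a u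
        (fun j x => ((-1 : ℂ) ^ (m + j) * ((Ring.choose m j : ℤ) : ℂ)) •
          𝒴.coeff (m + r - j) i b x) fun j => by simp
    · obtain ⟨K, hK⟩ := (𝒴.isTruncated_field r i b).exists_add u 0
      refine hasFiniteSupport_of_eventually (N := K) fun j hj => ?_
      have := hK j hj
      simp only [field, zero_add, Int.cast_natCast] at this
      rw [this, map_zero, smul_zero]

variable {AU BU CU : Type u} [AddCommGroup AU] [Module ℂ AU] [VOAModule V AU]
    [AddCommGroup BU] [Module ℂ BU] [VOAModule V BU]
    [AddCommGroup CU] [Module ℂ CU] [VOAModule V CU]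
    {𝒴A : IntertwiningOperator V A U AU} {𝒴B : IntertwiningOperator V B U BU}
    {𝒴C : IntertwiningOperator V C U CU} {τ : A →ₗ[ℂ] B} {ρ : B →ₗ[ℂ] C}
    {τU : AU →ₗ[ℂ] BU} {ρU : BU →ₗ[ℂ] CU}

theorem IsInducedMap.surjective (hC : 𝒴C.IsSurjective) (hρ : IsInducedMap 𝒴B 𝒴C ρ ρU)
    (hsurj : Function.Surjective ρ) : Function.Surjective ρU := by
  rw [← LinearMap.range_eq_top, eq_top_iff, ← hC, Submodule.span_le]
  rintro _ ⟨r, i, c, u, rfl⟩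
  obtain ⟨b, rfl⟩ := hsurj c
  exact ⟨_, hρ.map_coeff r i b u⟩

/-- The operator for B, reduced modulo the image of `τU`, kills ker ρ and descends to C. By
universality of C ⊠ U the quotient map factors through `ρU`, so ker `ρU` lies in that image. -/
theorem IsInducedMap.exact (hA : 𝒴A.IsSurjective) (hB : 𝒴B.IsTensorProduct)
    (hC : 𝒴C.IsTensorProduct) (hρhom : IsHom V ρ) (hex : Function.Exact τ ρ)
    (hsurj : Function.Surjective ρ) (hτ : IsInducedMap 𝒴A 𝒴B τ τU)
    (hρ : IsInducedMap 𝒴B 𝒴C ρ ρU) : Function.Exact τU ρU := by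
  have hcomp : ρU ∘ₗ τU = 0 := by
    refine LinearMap.ext_on hA ?_
    rintro _ ⟨r, i, a, u, rfl⟩
    rw [LinearMap.comp_apply, hτ.map_coeff, hρ.map_coeff, hex.apply_apply_eq_zero, map_zero,
      LinearMap.zero_apply, LinearMap.zero_apply]
  let L := LinearMap.range τU
  let _ := VOAModule.quotient L hτ.isHom.isStable_range
  have hmk : IsHom V L.mkQ := fun n a x => rfl
  obtain ⟨𝒴', h𝒴'⟩ := 𝒴B.exists_descent hρhom hsurj hmk fun r i b u hb => by
    -- An element of `ker ρ` comes from A, and its coefficients lie in the image of `τU`.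
    obtain ⟨a, rfl⟩ := (hex b).mp hb
    rw [← hτ.map_coeff]
    exact (Submodule.Quotient.mk_eq_zero L).mpr ⟨_, rfl⟩
  have hs : 𝒴'.IsSurjective := by
    rw [IsSurjective, eq_top_iff, ← L.range_mkQ, LinearMap.range_eq_map, ← hB.surjective,
      Submodule.map_span, Submodule.span_le]
    rintro _ ⟨_, ⟨r, i, b, u, rfl⟩, rfl⟩
    exact Submodule.subset_span ⟨r, i, ρ b, u, h𝒴' r i b u⟩
  obtain ⟨f, -, hf⟩ := hC.universal (BU ⧸ L) 𝒴' (hB.finGen.of_surjective hmk L.mkQ_surjective) hs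
  have hf' : f ∘ₗ ρU = L.mkQ := by
    refine LinearMap.ext_on hB.surjective ?_
    rintro _ ⟨r, i, b, u, rfl⟩
    rw [LinearMap.comp_apply, hρ.map_coeff, hf, h𝒴']
  intro x
  constructor
  · intro hx
    have h : L.mkQ x = 0 := by rw [← hf', LinearMap.comp_apply, hx, map_zero]
    exact (Submodule.Quotient.mk_eq_zero L).mp h
  · rintro ⟨y, rfl⟩
    exact LinearMap.congr_fun hcomp y

end IntertwiningOperator

end

theorem mainTheorem3 (V : Type u) [AddCommGroup V] [Module ℂ V] [VertexOperatorAlgebra V]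
    (hC2 : VertexOperatorAlgebra.IsC2Cofinite V) (hCFT : VertexOperatorAlgebra.IsCFTType V)
    (R P T : Type u)
    [AddCommGroup R] [Module ℂ R] [VOAModule V R]
    [AddCommGroup P] [Module ℂ P] [VOAModule V P]
    [AddCommGroup T] [Module ℂ T] [VOAModule V T]
    (τ : R →ₗ[ℂ] P) (ρ : P →ₗ[ℂ] V)
    (hρ : VOAModule.IsProjectiveCover V ρ)
    (hτ : VOAModule.IsHom V τ) (hτinj : Function.Injective τ) (hτρ : Function.Exact τ ρ)
    (hT : VOAModule.IsFinGen V T)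
    (RT PT VT : Type u)
    [AddCommGroup RT] [Module ℂ RT] [VOAModule V RT]
    [AddCommGroup PT] [Module ℂ PT] [VOAModule V PT]
    [AddCommGroup VT] [Module ℂ VT] [VOAModule V VT]
    (𝒴R : IntertwiningOperator V R T RT) (h𝒴R : 𝒴R.IsTensorProduct)
    (𝒴P : IntertwiningOperator V P T PT) (h𝒴P : 𝒴P.IsTensorProduct)
    (𝒴V : IntertwiningOperator V V T VT) (h𝒴V : 𝒴V.IsTensorProduct)
    (τT : RT →ₗ[ℂ] PT) (hτT : IntertwiningOperator.IsInducedMap 𝒴R 𝒴P τ τT)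
    (ρT : PT →ₗ[ℂ] VT) (hρT : IntertwiningOperator.IsInducedMap 𝒴P 𝒴V ρ ρT) :
    Function.Injective τT ∧ Function.Exact τT ρT ∧ Function.Surjective ρT := by
  refine ⟨?_, hτT.exact h𝒴R.surjective h𝒴P h𝒴V hρ.isHom hτρ hρ.surjective hρT,
    hρT.surjective h𝒴V.surjective hρ.surjective⟩
  obtain ⟨E, rfl, -⟩ := UnitExtension.exists_of_exact τ ρ hτ hρ.isHom hτinj hτρ hρ.surjective
  exact E.injective_inducedMap hT h𝒴R h𝒴P hτT
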